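/- **Setup.** All characters are over an algebraically closed field of characteristic $0$. Let $W_m$ be the group of $m\times m$ signed permutation matrices (the Weyl group of type $B_m$), $\epsilon:W_m\to\{\pm1\}$ the homomorphism sending a signed permutation matrix to the product of its nonzero entries' signs, and $W_m'=\ker\epsilon$ (the Weyl group of type $D_m$). For $a+b=n$, with $a,b\ge 0$ and $n\ge 1$, the group $W_a'\times W_b'$ is embedded block-diagonally in $W_n'$. A $\beta$-set is a finite set $X\subset\mathbb{N}_0$; its rank is $\operatorname{rk}(X)=\sum_{x\in X}x-\binom{|X|}{2}$. If $X=\{x_1<\dots<x_s\}$ then the numbers $x_i-(i-1)$ form a partition of $\operatorname{rk}(X)$, and $X$ also denotes the irreducible (Specht) character of $\mathfrak{S}_{\operatorname{rk}(X)}$ labelled by this partition, where the one-row partition labels the trivial character. For $\beta$-sets $X,Y,Z$ put $c_{XY}^Z=\langle \operatorname{Ind}_{\mathfrak{S}_{\operatorname{rk}X}\times\mathfrak{S}_{\operatorname{rk}Y}}^{\mathfrak{S}_{\operatorname{rk}Z}}(X\boxtimes Y),Z\rangle$ if $\operatorname{rk}Z=\operatorname{rk}X+\operatorname{rk}Y$,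 and $c_{XY}^Z=0$ otherwise. A symbol of rank $m$ (and defect $0$) is a pair $\binom{X_1}{X_2}$ of $\beta$-sets with $|X_1|=|X_2|$ and $\operatorname{rk}X_1+\operatorname{rk}X_2=m$, up to simultaneous shifts $X_i\mapsto\{0,\dots,k-1\}\cup(X_i+k)$. It is degenerate if $X_1=X_2$. It labels the irreducible character of $W_m$ induced from the character $X_1\boxtimes(X_2\otimes\epsilon)$ of $W_{\operatorname{rk}X_1}\times W_{\operatorname{rk}X_2}$, where $X_i$ is inflated through $W_{\operatorname{rk}X_i}\to\mathfrak{S}_{\operatorname{rk}X_i}$. The restriction of this character to $W_m'$ depends only on the unordered symbol; if the symbol is non-degenerate it is irreducible and is denoted by the same symbol, and if the symbol is degenerate (and $m\ge1$) it is a sum of two distinct irreducible characters $\binom{X_1}{X_1}_+$, $\binom{X_1}{X_1}_-$. (For $m=0$ the degenerate symbol labels the trivial character of the trivial group $W_0'$.) **Statement.** Let $a,b\ge 0$, $n=a+b\ge 1$, and let $E=A\boxtimes B$ be an irreducible character of $W_a'\times W_b'$, where the character $A$ of $W_a'$ is labelled by the unordered symbol $\binom{A_1}{A_2}$ of rank $a$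 and the character $B$ of $W_b'$ by the unordered symbol $\binom{B_1}{B_2}$ of rank $b$ (with one of the signs $\pm$ if the symbol is degenerate of positive rank). Call an unordered symbol $\binom{X_1}{X_2}$ of rank $n$ admissible if there are indexings $\{i_1,i_2\}=\{j_1,j_2\}=\{1,2\}$ with $\operatorname{rk}(X_k)=\operatorname{rk}(A_{i_k})+\operatorname{rk}(B_{j_k})$ for $k\in\{1,2\}$. For such a symbol, ordered in any way, and any such indexings, put $$a_{AB}^{X_1X_2}=\begin{cases} c_{A_{i_1}B_{j_1}}^{X_1}c_{A_{i_2}B_{j_2}}^{X_2}+\delta_Ac_{A_{i_2}B_{j_1}}^{X_1}c_{A_{i_1}B_{j_2}}^{X_2}+\delta_Bc_{A_{i_1}B_{j_2}}^{X_1}c_{A_{i_2}B_{j_1}}^{X_2}+\delta_{A\odot B}c_{A_{i_2}B_{j_2}}^{X_1}c_{A_{i_1}B_{j_1}}^{X_2}&\text{if }A_1\ne A_2,\ B_1\ne B_2,\\ c_{A_{i_1}B_{j_1}}^{X_1}c_{A_{i_2}B_{j_2}}^{X_2}+\delta_Bc_{A_{i_1}B_{j_2}}^{X_1}c_{A_{i_2}B_{j_1}}^{X_2}&\text{if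 }A_1=A_2,\ B_1\ne B_2,\\ c_{A_{i_1}B_{j_1}}^{X_1}c_{A_{i_2}B_{j_2}}^{X_2}+\delta_Ac_{A_{i_2}B_{j_1}}^{X_1}c_{A_{i_1}B_{j_2}}^{X_2}&\text{if }A_1\ne A_2,\ B_1=B_2,\\ c_{A_{i_1}B_{j_1}}^{X_1}c_{A_{i_2}B_{j_2}}^{X_2}&\text{if }A_1=A_2,\ B_1=B_2, \end{cases}$$ where $\delta_A$ (resp. $\delta_B$) is $1$ if $\operatorname{rk}A_1=\operatorname{rk}A_2$ (resp. $\operatorname{rk}B_1=\operatorname{rk}B_2$) and $0$ otherwise, and $\delta_{A\odot B}$ is $1$ if $\operatorname{rk}A_{i_1}+\operatorname{rk}B_{j_1}=\operatorname{rk}A_{i_2}+\operatorname{rk}B_{j_2}$ and $0$ otherwise. Then, for any choice of these orderings and indexings and of the names $\pm$, $$\operatorname{Ind}_{W_a'\times W_b'}^{W_n'}(E)=\sum_{X_1\ne X_2}a_{AB}^{X_1X_2}\binom{X_1}{X_2}+\sum_{X_1=X_2}\left(a_{AB}^{X_1,+}\binom{X_1}{X_2}_++a_{AB}^{X_1,-}\binom{X_1}{X_2}_-\right),$$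 where the sums run over the admissible unordered symbols, with suitable coefficients $a_{AB}^{X_1,\pm}\in\mathbb{N}_0$ which satisfy $a_{AB}^{X_1,+}+a_{AB}^{X_1,-}=a_{AB}^{X_1X_1}$, and $a_{AB}^{X_1,+}=a_{AB}^{X_1,-}=\frac12a_{AB}^{X_1X_1}$ whenever $\binom{A_1}{A_2}$ or $\binom{B_1}{B_2}$ is non-degenerate. -/

import Mathlib

/-! ### Class functions and characters of finite groups -/

noncomputable section

/-- `χ` is the character of an irreducible finite-dimensional representation of `G` over `K`. -/
def IsIrrChar {K G : Type*} [Field K] [Group G] (χ : G → K) : Prop :=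
  ∃ (d : ℕ) (ρ : Representation K G (Fin d → K)), ρ.IsIrreducible ∧ ρ.character = χ

/-- The scalar product `|G|⁻¹ ∑ φ(g) ψ(g⁻¹)` of class functions on a finite group. -/
def charInner {K G : Type*} [Field K] [Group G] [Fintype G] (φ ψ : G → K) : K :=
  (Nat.card G : K)⁻¹ * ∑ g : G, φ g * ψ g⁻¹

open Classical in
/-- The class function on `G` induced from the class function `χ` on `H`, where `H` is seen as a
subgroup of `G` through the injective homomorphism `f`:
`(Ind χ)(g) = |H|⁻¹ ∑_{x ∈ G, x⁻¹ g x ∈ H} χ(x⁻¹ g x)`. -/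
def indChar {K G H : Type*} [Field K] [Group G] [Fintype G] [Group H] [Fintype H]
    (f : H →* G) (χ : H → K) (g : G) : K :=
  (Nat.card H : K)⁻¹ * ∑ x : G, ∑ h : H, if f h = x⁻¹ * g * x then χ h else 0

/-- The exterior tensor product of class functions. -/
def boxChar {K G H : Type*} [Field K] (φ : G → K) (ψ : H → K) (g : G × H) : K :=
  φ g.1 * ψ g.2

/-! ### β-sets and characters of symmetric groups -/

namespace BetaSet

/-- The rank of a β-set (a finite set of natural numbers); the subtraction never truncates, see
`BetaSet.card_cells_add`. -/
def rank (B : Finset ℕ) : ℕ := ∑ x ∈ B, x - B.card.choose 2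

/-- The shift `B⁺ᵏ = {0, …, k - 1} ∪ {b + k | b ∈ B}`. -/
def shift (k : ℕ) (B : Finset ℕ) : Finset ℕ := Finset.range k ∪ B.image (· + k)

/-- The cells of the Young diagram of the partition attached to `B = {x₁ < ⋯ < x_s}`, whose parts
are `x_i - (i - 1) = #{y < x_i | y ∉ B}`. The row belonging to the part of `x ∈ B` consists of the
cells `(x, y)` with `y < x` and `y ∉ B`, and its `j`-th cell is the one where `y` is the `j`-th
natural number outside `B`; so two cells are in the same row (column) of the diagram if and only
if they have the same first (second) coordinate. -/
def cells (B : Finset ℕ) : Finset (ℕ × ℕ) :=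
  (B ×ˢ Finset.range (B.sup id)).filter fun p => p.2 ∉ B ∧ p.2 < p.1

theorem mem_cells {B : Finset ℕ} {p : ℕ × ℕ} : p ∈ cells B ↔ p.1 ∈ B ∧ p.2 ∉ B ∧ p.2 < p.1 := by
  simp only [cells, Finset.mem_filter, Finset.mem_product, Finset.mem_range]
  constructor
  · rintro ⟨⟨h1, _⟩, h2⟩
    exact ⟨h1, h2⟩
  · rintro ⟨h1, h2, h3⟩
    exact ⟨⟨h1, lt_of_lt_of_le h3 (Finset.le_sup (f := id) h1)⟩, h2, h3⟩

theorem card_cells_add (B : Finset ℕ) :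
    (cells B).card + B.card.choose 2 = ∑ x ∈ B, x := by
  induction B using Finset.induction_on_max with
  | empty => simp [cells]
  | insert m s hm ih =>
    have hms : m ∉ s := fun h => lt_irrefl _ (hm m h)
    have hsub : s ⊆ Finset.range m := fun x hx => Finset.mem_range.2 (hm x hx)
    have hcard : s.card ≤ m := by simpa using Finset.card_le_card hsub
    have hdec : cells (insert m s) = cells s ∪ ({m} ×ˢ (Finset.range m \ s)) := by
      ext ⟨x, y⟩
      simp only [mem_cells, Finset.mem_union, Finset.mem_insert, Finset.mem_product,
        Finset.mem_singleton, Finset.mem_sdiff, Finset.mem_range]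
      constructor
      · rintro ⟨h1 | h1, h2, h3⟩
        · exact Or.inr ⟨h1, h1 ▸ h3, fun h => h2 (Or.inr h)⟩
        · exact Or.inl ⟨h1, fun h => h2 (Or.inr h), h3⟩
      · rintro (⟨h1, h2, h3⟩ | ⟨h1, h2, h3⟩)
        · refine ⟨Or.inr h1, ?_, h3⟩
          rintro (h | h)
          · have := hm x h1
            omega
          · exact h2 h
        · refine ⟨Or.inl h1, ?_, h1 ▸ h2⟩
          rintro (h | h)
          · omega
          · exact h3 h
    have hdisj : Disjoint (cells s) ({m} ×ˢ (Finset.range m \ s)) := by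
      rw [Finset.disjoint_left]
      rintro ⟨x, y⟩ h1 h2
      rw [mem_cells] at h1
      rw [Finset.mem_product, Finset.mem_singleton] at h2
      exact hms (h2.1 ▸ h1.1)
    rw [hdec, Finset.card_union_of_disjoint hdisj, Finset.card_product, Finset.card_singleton,
      Finset.card_sdiff_of_subset hsub, Finset.card_range, Finset.card_insert_of_notMem hms,
      Finset.sum_insert hms, Nat.choose_succ_succ' s.card 1, Nat.choose_one_right]
    simp only [Nat.reduceAdd]
    omega

theorem card_cells (B : Finset ℕ) : (cells B).card = rank B := by
  have := card_cells_add B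
  unfold rank
  omega

open Classical in
/-- The Young symmetrizer of the Young diagram of `B`: the product of the sum of all row
permutations and of the signed sum of all column permutations. -/
def youngSymmetrizer (K : Type*) [Field K] (B : Finset ℕ) :
    MonoidAlgebra K (Equiv.Perm (cells B)) :=
  (∑ p : Equiv.Perm (cells B),
      if ∀ c, (p c).1.1 = c.1.1 then MonoidAlgebra.single p 1 else 0) *
    ∑ q : Equiv.Perm (cells B),
      if ∀ c, (q c).1.2 = c.1.2 then MonoidAlgebra.single q ((Equiv.Perm.sign q : ℤ) : K) else 0

/-- The Specht module of the partition of `B`: the left ideal of the group algebra generated by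
the Young symmetrizer. -/
def spechtModule (K : Type*) [Field K] (B : Finset ℕ) :
    Submodule (MonoidAlgebra K (Equiv.Perm (cells B))) (MonoidAlgebra K (Equiv.Perm (cells B))) :=
  Submodule.span _ {youngSymmetrizer K B}

/-- The representation of the symmetric group on the Specht module by left multiplication. -/
def spechtRep (K : Type*) [Field K] (B : Finset ℕ) :
    Representation K (Equiv.Perm (cells B)) (spechtModule K B) :=
  ((Algebra.lsmul K K (spechtModule K B)).toMonoidHom).comp
    (MonoidAlgebra.of K (Equiv.Perm (cells B)))

/-- The irreducible character of `𝔖_n` labelled by the β-set `B` of rank `n` (for one row, i.e.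
for `B = {n}`, it is the trivial character). The numbering of the cells does not matter, as
characters are class functions. -/
def symChar (K : Type*) [Field K] {n : ℕ} (B : Finset ℕ) (h : rank B = n)
    (σ : Equiv.Perm (Fin n)) : K :=
  (spechtRep K B).character
    (((cells B).equivFinOfCardEq ((card_cells B).trans h)).symm.permCongr σ)

end BetaSet

/-- The inclusion `𝔖_a × 𝔖_b → 𝔖_n`, for an identification of the disjoint union of the two index
sets with the third one. -/
def symBlock {α β ι : Type*} (e : α ⊕ β ≃ ι) :
    Equiv.Perm α × Equiv.Perm β →* Equiv.Perm ι :=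
  e.permCongrHom.toMonoidHom.comp (Equiv.Perm.sumCongrHom α β)

/-- The Littlewood–Richardson coefficient `c_{XY}^Z`, the multiplicity of `Z` in the character
induced from `X ⊠ Y`; it is `0` if the rank of `Z` is not the sum of the ranks of `X` and `Y`. -/
def lrCoeff (K : Type*) [Field K] (X Y Z : Finset ℕ) : K :=
  if h : BetaSet.rank Z = BetaSet.rank X + BetaSet.rank Y then
    charInner
      (indChar (symBlock finSumFinEquiv)
        (boxChar (BetaSet.symChar K X rfl) (BetaSet.symChar K Y rfl)))
      (BetaSet.symChar K Z h)
  else 0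

/-! ### Weyl groups of type B and D -/

/-- The group of signed permutations of the index set `ι`. The element `(v, σ)` stands for the
signed permutation matrix that maps the basis vector `e_i` to `v (σ i) • e_(σ i)`. For `ι = Fin n`
this is the Weyl group `W_n` of type `B_n`. -/
abbrev SignedPerm (ι : Type*) : Type _ := (ι → ℤˣ) ⋊[mulAutArrow (A := ι)] Equiv.Perm ι

theorem SignedPerm.mul_left_apply {ι : Type*} (g h : SignedPerm ι) (i : ι) :
    (g * h).left i = g.left i * h.left (g.right⁻¹ i) := rfl

instance {ι : Type*} [Fintype ι] [DecidableEq ι] : Fintype (SignedPerm ι) :=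
  Fintype.ofEquiv _ SemidirectProduct.equivProd.symm

/-- The linear character of `W_n` that is trivial on permutations and `-1` on every diagonal
matrix with exactly one entry `-1`. -/
def signChar (ι : Type*) [Fintype ι] : SignedPerm ι →* ℤˣ where
  toFun g := ∏ i, g.left i
  map_one' := by simp
  map_mul' g h := by
    rw [SemidirectProduct.mul_left]
    simp only [Pi.mul_apply, Finset.prod_mul_distrib]
    congr 1
    exact Equiv.prod_comp (g.right⁻¹) h.left

/-- The Weyl group `W'_n` of type `D_n`, the kernel of `signChar` in `W_n`. -/
abbrev WeylD (n : ℕ) : Subgroup (SignedPerm (Fin n)) := (signChar (Fin n)).ker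

instance (n : ℕ) : Fintype (WeylD n) := Fintype.ofFinite _

/-- The inclusion `W_a × W_b → W_n` as block diagonal matrices. -/
def signedBlock {α β ι : Type*} (e : α ⊕ β ≃ ι) :
    SignedPerm α × SignedPerm β →* SignedPerm ι where
  toFun p := ⟨fun i => Sum.elim p.1.left p.2.left (e.symm i),
    symBlock e (p.1.right, p.2.right)⟩
  map_one' := by
    ext i
    · rcases h : e.symm i <;> simp [h]
    · simp [symBlock]
  map_mul' p q := by
    ext i
    · obtain ⟨s, rfl⟩ := e.surjective i
      have hs : e.symm ((symBlock e (p.1.right, p.2.right))⁻¹ (e s)) =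
          (Equiv.Perm.sumCongr p.1.right p.2.right)⁻¹ s := by
        rw [Equiv.symm_apply_eq, Equiv.Perm.inv_eq_iff_eq]
        simp [symBlock, Equiv.permCongrHom]
      rw [SignedPerm.mul_left_apply]
      change ((Sum.elim (p * q).1.left (p * q).2.left (e.symm (e s)) : ℤˣ) : ℤ) =
        ((Sum.elim p.1.left p.2.left (e.symm (e s)) * Sum.elim q.1.left q.2.left
        (e.symm ((symBlock e (p.1.right, p.2.right))⁻¹ (e s))) : ℤˣ) : ℤ)
      rw [hs, Equiv.symm_apply_apply]
      rcases s with s | s <;> rfl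
    · simp [symBlock]

theorem signChar_signedBlock {α β ι : Type*} [Fintype α] [Fintype β] [Fintype ι] (e : α ⊕ β ≃ ι)
    (p : SignedPerm α × SignedPerm β) :
    signChar ι (signedBlock e p) = signChar α p.1 * signChar β p.2 := by
  change ∏ i, Sum.elim p.1.left p.2.left (e.symm i) = (∏ i, p.1.left i) * ∏ i, p.2.left i
  rw [Equiv.prod_comp e.symm (Sum.elim p.1.left p.2.left), Fintype.prod_sum_type]
  simp

/-- The inclusion `W'_a × W'_b → W'_(a+b)`, where `W'_a` acts on the first `a` coordinates and
`W'_b` on the last `b` coordinates. -/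
def weylDBlock (a b : ℕ) : WeylD a × WeylD b →* WeylD (a + b) :=
  ((signedBlock finSumFinEquiv).comp
    ((WeylD a).subtype.prodMap (WeylD b).subtype)).codRestrict (WeylD (a + b)) fun p => by
      have h1 : signChar _ p.1.1 = 1 := p.1.2
      have h2 : signChar _ p.2.1 = 1 := p.2.2
      rw [MonoidHom.mem_ker, MonoidHom.comp_apply, signChar_signedBlock]
      simp [h1, h2]

/-! ### Symbols of defect zero -/

/-- A β-pair of defect `0` and rank `n`. -/
structure BetaPair (n : ℕ) where
  row : Fin 2 → Finset ℕ
  defect_zero : (row 0).card = (row 1).card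
  rank_eq : BetaSet.rank (row 0) + BetaSet.rank (row 1) = n

namespace BetaPair

/-- A symbol is degenerate if its two rows agree. -/
def Degenerate {n : ℕ} (P : BetaPair n) : Prop := P.row 0 = P.row 1

instance {n : ℕ} (P : BetaPair n) : Decidable P.Degenerate :=
  inferInstanceAs (Decidable (P.row 0 = P.row 1))

/-- The irreducible character of `W_n` labelled by the symbol with rows `A₁` and `A₂`: with `k` and
`l` the ranks of the rows, `A₁` gives a character of `W_k` through `W_k → 𝔖_k`, and `A₂` gives a
character of `W_l` through `W_l → 𝔖_l`, which is multiplied with the character `signChar`; their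
exterior tensor product is induced from `W_k × W_l` to `W_n`. -/
def charB (K : Type*) [Field K] {n : ℕ} (P : BetaPair n) : SignedPerm (Fin n) → K :=
  indChar (signedBlock (finSumFinEquiv.trans (finCongr P.rank_eq)))
    (boxChar
      (fun x => BetaSet.symChar K (P.row 0) rfl x.right)
      (fun y => BetaSet.symChar K (P.row 1) rfl y.right * ((signChar _ y : ℤ) : K)))

/-- The restriction to `W'_n` of the character of `W_n` labelled by `P`. If `P` is non-degenerate
this is the irreducible character of `W'_n` labelled by `P`. -/
def resD (K : Type*) [Field K] {n : ℕ} (P : BetaPair n) (g : WeylD n) : K := P.charB K g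

/-- `φ` is an irreducible character of `W'_n` labelled by the symbol `P`, or by one of `P_+` and
`P_-` if `P` is degenerate: it is an irreducible constituent of the restriction to `W'_n` of the
character of `W_n` labelled by `P`. -/
def IsLabelOf {K : Type*} [Field K] {n : ℕ} (P : BetaPair n) (φ : WeylD n → K) : Prop :=
  IsIrrChar φ ∧ charInner φ (P.resD K) ≠ 0

end BetaPair

theorem BetaSet.shift_shift (k l : ℕ) (B : Finset ℕ) :
    BetaSet.shift k (BetaSet.shift l B) = BetaSet.shift (k + l) B := by
  ext x
  simp only [BetaSet.shift, Finset.mem_union, Finset.mem_range, Finset.mem_image]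
  constructor
  · rintro (h | ⟨y, h | ⟨z, hz, rfl⟩, rfl⟩)
    · exact Or.inl (by omega)
    · exact Or.inl (by omega)
    · exact Or.inr ⟨z, hz, by omega⟩
  · rintro (h | ⟨z, hz, rfl⟩)
    · by_cases hk : x < k
      · exact Or.inl hk
      · exact Or.inr ⟨x - k, Or.inl (by omega), by omega⟩
    · exact Or.inr ⟨z + l, Or.inr ⟨z, hz, rfl⟩, by omega⟩

theorem BetaSet.shift_injective (k : ℕ) : Function.Injective (BetaSet.shift k) := by
  have key : ∀ (B : Finset ℕ) (x : ℕ), x ∈ B ↔ x + k ∈ BetaSet.shift k B := by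
    intro B x
    simp [BetaSet.shift]
  intro A B h
  ext x
  rw [key A, key B, h]

theorem BetaSet.shift_zero (B : Finset ℕ) : BetaSet.shift 0 B = B := by
  simp [BetaSet.shift]

/-- Two β-pairs give the same symbol with the order of the rows forgotten if, up to permuting the
rows of one of them, one is a shift of the other. -/
def BetaPair.setoid (n : ℕ) : Setoid (BetaPair n) where
  r P Q := ∃ (σ : Equiv.Perm (Fin 2)) (k : ℕ),
    (∀ i, BetaSet.shift k (P.row (σ i)) = Q.row i) ∨
      (∀ i, P.row (σ i) = BetaSet.shift k (Q.row i))
  iseqv := by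
    refine ⟨fun P => ⟨1, 0, Or.inl fun i => BetaSet.shift_zero _⟩, ?_, ?_⟩
    · rintro P Q ⟨σ, k, h | h⟩
      · exact ⟨σ⁻¹, k, Or.inr fun i => by rw [← h]; simp⟩
      · exact ⟨σ⁻¹, k, Or.inl fun i => by rw [← h]; simp⟩
    · have cancel : ∀ (k l : ℕ) (f g : Fin 2 → Finset ℕ),
          (∀ i, BetaSet.shift k (f i) = BetaSet.shift l (g i)) →
          ∃ m, (∀ i, BetaSet.shift m (f i) = g i) ∨ (∀ i, f i = BetaSet.shift m (g i)) := by
        intro k l f g h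
        rcases le_total k l with hkl | hkl
        · refine ⟨l - k, Or.inr fun i => BetaSet.shift_injective k ?_⟩
          rw [h, BetaSet.shift_shift]
          congr 1
          omega
        · refine ⟨k - l, Or.inl fun i => BetaSet.shift_injective l ?_⟩
          rw [← h, BetaSet.shift_shift]
          congr 1
          omega
      have toComm : ∀ {P Q : BetaPair n} {σ : Equiv.Perm (Fin 2)} {k : ℕ},
          ((∀ i, BetaSet.shift k (P.row (σ i)) = Q.row i) ∨
            (∀ i, P.row (σ i) = BetaSet.shift k (Q.row i))) →
          ∃ a b, ∀ i, BetaSet.shift a (P.row (σ i)) = BetaSet.shift b (Q.row i) := by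
        rintro P Q σ k (h | h)
        · exact ⟨k, 0, fun i => by rw [h, BetaSet.shift_zero]⟩
        · exact ⟨0, k, fun i => by rw [← h, BetaSet.shift_zero]⟩
      rintro P Q R ⟨σ, k, h⟩ ⟨τ, l, h'⟩
      obtain ⟨a, b, hab⟩ := toComm h
      obtain ⟨c, d, hcd⟩ := toComm h'
      refine ⟨σ * τ, cancel (c + a) (b + d) (fun i => P.row ((σ * τ) i)) R.row fun i => ?_⟩
      rw [← BetaSet.shift_shift, Equiv.Perm.mul_apply, hab, BetaSet.shift_shift, add_comm c b,
        ← BetaSet.shift_shift, hcd, BetaSet.shift_shift]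

theorem BetaSet.rank_add_choose (B : Finset ℕ) :
    BetaSet.rank B + B.card.choose 2 = ∑ x ∈ B, x := by
  rw [← BetaSet.card_cells, BetaSet.card_cells_add]

theorem BetaSet.exists_shift_one {B : Finset ℕ} (h0 : 0 ∈ B) :
    ∃ C, BetaSet.shift 1 C = B ∧ C.card + 1 = B.card ∧ BetaSet.rank C = BetaSet.rank B := by
  have hinj : Function.Injective (fun x : ℕ => x + 1) := fun x y h => by simpa using h
  let C := (B.erase 0).image (· - 1)
  have hC : C.image (· + 1) = B.erase 0 := by
    ext x
    simp only [C, Finset.mem_image, Finset.mem_erase]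
    constructor
    · rintro ⟨_, ⟨y, ⟨hy, hyB⟩, rfl⟩, rfl⟩
      have : y - 1 + 1 = y := by omega
      rw [this]
      exact ⟨hy, hyB⟩
    · rintro ⟨hx, hxB⟩
      exact ⟨x - 1, ⟨x, ⟨hx, hxB⟩, rfl⟩, by omega⟩
  have hcard : C.card + 1 = B.card := by
    rw [← Finset.card_image_of_injective C hinj, hC, Finset.card_erase_add_one h0]
  refine ⟨C, ?_, hcard, ?_⟩
  · rw [BetaSet.shift, hC]
    ext x
    simp only [Finset.range_one, Finset.mem_union, Finset.mem_singleton, Finset.mem_erase]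
    constructor
    · rintro (rfl | h)
      · exact h0
      · exact h.2
    · intro h
      by_cases hx : x = 0
      · exact Or.inl hx
      · exact Or.inr ⟨hx, h⟩
  · have h1 := BetaSet.rank_add_choose C
    have h2 := BetaSet.rank_add_choose B
    have h3 : ∑ x ∈ B, x = ∑ x ∈ C, x + C.card := by
      rw [← Finset.add_sum_erase B _ h0, ← hC, Finset.sum_image (fun x _ y _ h => hinj h),
        Finset.sum_add_distrib]
      simp
    rw [← hcard, Nat.choose_succ_succ' C.card 1, Nat.choose_one_right] at h2
    simp only [Nat.reduceAdd] at h2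
    omega

theorem BetaSet.zero_mem_of_rank_lt {B : Finset ℕ} (h : BetaSet.rank B < B.card) : 0 ∈ B := by
  by_contra h0
  rw [← BetaSet.card_cells] at h
  refine absurd h (not_lt.2 ?_)
  refine Finset.card_le_card_of_injOn (fun x => (x, 0)) (fun x hx => ?_)
    (fun x _ y _ hxy => (Prod.mk.inj hxy).1)
  have hx0 : x ≠ 0 := fun hx0 => h0 (hx0 ▸ hx)
  exact BetaSet.mem_cells.2 ⟨hx, h0, Nat.pos_of_ne_zero hx0⟩

theorem BetaSet.le_rank_add_card {B : Finset ℕ} {x : ℕ} (hx : x ∈ B) :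
    x ≤ BetaSet.rank B + B.card := by
  have h1 : (Finset.range x \ B).card ≤ (BetaSet.cells B).card :=
    Finset.card_le_card_of_injOn (fun y => (x, y))
      (fun y hy => by
        have hy' := Finset.mem_sdiff.1 hy
        exact BetaSet.mem_cells.2 ⟨hx, hy'.2, Finset.mem_range.1 hy'.1⟩)
      (fun y _ z _ h => (Prod.mk.inj h).2)
  have h2 := Finset.le_card_sdiff B (Finset.range x)
  rw [BetaSet.card_cells] at h1
  rw [Finset.card_range] at h2
  omega

theorem BetaPair.exists_small {n : ℕ} : ∀ (m : ℕ) (P : BetaPair n), (P.row 0).card = m →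
    ∃ Q : BetaPair n, (BetaPair.setoid n).r Q P ∧ (Q.row 0).card ≤ n := by
  intro m
  induction m with
  | zero =>
    intro P h
    exact ⟨P, (BetaPair.setoid n).refl P, by omega⟩
  | succ m ih =>
    intro P h
    by_cases hn : (P.row 0).card ≤ n
    · exact ⟨P, (BetaPair.setoid n).refl P, hn⟩
    · have hr := P.rank_eq
      have hd := P.defect_zero
      obtain ⟨C, hC, hC1, hC2⟩ := BetaSet.exists_shift_one
        (BetaSet.zero_mem_of_rank_lt (B := P.row 0) (by omega))
      obtain ⟨D, hD, hD1, hD2⟩ := BetaSet.exists_shift_one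
        (BetaSet.zero_mem_of_rank_lt (B := P.row 1) (by omega))
      obtain ⟨Q, hQ, hQn⟩ := ih ⟨![C, D], by simp; omega, by simp; omega⟩ (by simp; omega)
      refine ⟨Q, (BetaPair.setoid n).trans hQ ⟨1, 1, Or.inl fun i => ?_⟩, hQn⟩
      fin_cases i <;> simp [hC, hD]

/-- The symbols of rank `n` and defect `0` with the order of the rows forgotten (each degenerate
symbol occurs once). -/
abbrev USymbol (n : ℕ) : Type := Quotient (BetaPair.setoid n)

instance (n : ℕ) : Finite (USymbol n) := by
  let S := {P : BetaPair n // ∀ i, P.row i ∈ (Finset.range (2 * n + 1)).powerset}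
  have hS : Finite S := Finite.of_injective
    (fun (P : S) (i : Fin 2) => (⟨P.1.row i, P.2 i⟩ : (Finset.range (2 * n + 1)).powerset))
    fun P Q h => by
      rcases P with ⟨⟨r, _, _⟩, _⟩
      rcases Q with ⟨⟨r', _, _⟩, _⟩
      have : r = r' := funext fun i => congrArg Subtype.val (congrFun h i)
      subst this
      rfl
  refine Finite.of_surjective (fun P : S => (Quotient.mk _ P.1 : USymbol n)) fun X => ?_
  obtain ⟨P, rfl⟩ := Quotient.exists_rep X
  obtain ⟨Q, hQ, hn⟩ := BetaPair.exists_small _ P rfl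
  have hr := Q.rank_eq
  have hd := Q.defect_zero
  refine ⟨⟨Q, fun i => ?_⟩, Quotient.sound hQ⟩
  rw [Finset.mem_powerset]
  intro x hx
  rw [Finset.mem_range]
  fin_cases i
  · have := BetaSet.le_rank_add_card hx
    simp only [Fin.zero_eta] at this
    omega
  · have := BetaSet.le_rank_add_card hx
    simp only [Fin.mk_one] at this
    omega

instance (n : ℕ) : Fintype (USymbol n) := Fintype.ofFinite _

/-! ### The coefficients -/

/-- The ranks of the rows of `X` are the sums of the ranks of the rows of `A` and `B`, with the
rows of `A` and `B` indexed by `i` and `j`. -/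
def Admissible {a b : ℕ} (A : BetaPair a) (B : BetaPair b) (X : BetaPair (a + b))
    (i j : Equiv.Perm (Fin 2)) : Prop :=
  ∀ k, BetaSet.rank (X.row k) = BetaSet.rank (A.row (i k)) + BetaSet.rank (B.row (j k))

/-- Kronecker delta on natural numbers. -/
def kdelta (K : Type*) [Field K] (r s : ℕ) : K := if r = s then 1 else 0

/-- The coefficient `a_{AB}^{X₁X₂}`, for rows of `A` and `B` indexed by `i` and `j`. Here `δ_A`,
`δ_B` and `δ_{A⊙B}` compare the ranks of the two rows of `A`, of `B`, and of the symbol with rows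
`A_{i_1} ⊙ B_{j_1}` and `A_{i_2} ⊙ B_{j_2}`, whose ranks are the sums of the ranks. -/
def aCoeff (K : Type*) [Field K] {a b : ℕ} (A : BetaPair a) (B : BetaPair b) (X : BetaPair (a + b))
    (i j : Equiv.Perm (Fin 2)) : K :=
  let c (p q k : Fin 2) : K := lrCoeff K (A.row p) (B.row q) (X.row k)
  let rA (p : Fin 2) : ℕ := BetaSet.rank (A.row p)
  let rB (q : Fin 2) : ℕ := BetaSet.rank (B.row q)
  let δA : K := kdelta K (rA 0) (rA 1)
  let δB : K := kdelta K (rB 0) (rB 1)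
  let δAB : K := kdelta K (rA (i 0) + rB (j 0)) (rA (i 1) + rB (j 1))
  if A.Degenerate then
    if B.Degenerate then
      c (i 0) (j 0) 0 * c (i 1) (j 1) 1
    else
      c (i 0) (j 0) 0 * c (i 1) (j 1) 1 + δB * (c (i 0) (j 1) 0 * c (i 1) (j 0) 1)
  else
    if B.Degenerate then
      c (i 0) (j 0) 0 * c (i 1) (j 1) 1 + δA * (c (i 1) (j 0) 0 * c (i 0) (j 1) 1)
    else
      c (i 0) (j 0) 0 * c (i 1) (j 1) 1 + δA * (c (i 1) (j 0) 0 * c (i 0) (j 1) 1)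
        + δB * (c (i 0) (j 1) 0 * c (i 1) (j 0) 1)
        + δAB * (c (i 1) (j 1) 0 * c (i 0) (j 0) 1)

open Classical in
/-- The unordered symbols that occur in the sum, where `rep` is a system of representatives. -/
def sumIndex {a b : ℕ} (A : BetaPair a) (B : BetaPair b)
    (rep : USymbol (a + b) → BetaPair (a + b)) : Finset (USymbol (a + b)) :=
  Finset.univ.filter fun X => ∃ i j, Admissible A B (rep X) i j

end

/-! The proof passes through type B. Let `V` be the character of `W'_n` induced from `E`. By
Frobenius reciprocity the scalar product of `V` with the restriction of an irreducible character of
`W_n` can be computed after inducing `V` further to `W_n`. By transitivity this is the same as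
inducing each factor first to `W_a` and `W_b` and then inducing the product to `W_n`. A character
labelled by a symbol induces to the type B character of the symbol, plus that of the symbol with
exchanged rows when the symbol is non-degenerate (`BetaPair.IsLabelOf.indChar_eq`). So at most four
type B inductions remain.

In type B, four blocks can be regrouped by rows instead of by factors (`indChar_boxChar_inflInd`):
the two upper rows are multiplied in one symmetric group and the two lower rows in another. Hence
each multiplicity is a product of two Littlewood–Richardson coefficients (`charInner_blockB_charB`),
and the four products add up to `blockMult`. The deltas in the stated coefficient are redundant: for
admissible indexings a Littlewood–Richardson coefficient with the wrong ranks is zero anyway. This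
also explains the independence of the indexings (`aCoeff_eq_blockMult`).

To return to type D, note that exchanging rows amounts to a twist by the sign character, whose
kernel is `W'_n`. Therefore restrictions of type B characters have norm one in the non-degenerate
case and norm two in the degenerate case (`charInner_resD`). In the latter case the two constituents
are exchanged by any element outside `W'_n`, and the multiplicity computed above is the sum of
theirs. If one of the two factors is non-degenerate, it is invariant under a sign change in its
block, so `V` is invariant under an element outside `W'_n` and the two multiplicities agree.

It remains to see that every constituent of `V` has a label. Class functions of symmetric groups are
spanned by Specht characters (`BetaSet.mem_span_symChar`), so the character induced to `W_n` lies in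
the span of the labelled type B characters. An unlabelled constituent would be orthogonal to all of
these, which is impossible as multiplicities are nonnegative (`exists_isLabelOf_of_constituent`).
The facts on Specht characters are derived from Young symmetrizers by counting cells of diagrams,
and the orthogonality in type B by a Mackey argument with diagonal sign changes. -/

noncomputable section

open Representation

/-! ### Irreducible representations and characters up to isomorphism. -/

theorem Representation.isIrreducible_iff_submodule {K G V : Type*} [Field K] [Group G]
    [AddCommGroup V] [Module K V] (ρ : Representation K G V) :
    ρ.IsIrreducible ↔ Nontrivial V ∧
      ∀ p : Submodule K V, (∀ g, ∀ v ∈ p, ρ g v ∈ p) → p = ⊥ ∨ p = ⊤ := by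
  constructor
  · intro h
    refine ⟨?_, fun p hp => ?_⟩
    · by_contra hn
      rw [not_nontrivial_iff_subsingleton] at hn
      refine bot_ne_top (α := Subrepresentation ρ) (Subrepresentation.toSubmodule_injective ?_)
      exact Subsingleton.elim _ _
    · rcases eq_bot_or_eq_top (⟨p, fun g v hv => hp g v hv⟩ : Subrepresentation ρ) with h | h
      · left; exact congrArg Subrepresentation.toSubmodule h
      · right; exact congrArg Subrepresentation.toSubmodule h
  · rintro ⟨hn, h⟩
    refine { exists_pair_ne := ⟨⊥, ⊤, fun h => ?_⟩, eq_bot_or_eq_top := fun p => ?_ }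
    · exact bot_ne_top (α := Submodule K V) (congrArg Subrepresentation.toSubmodule h)
    · rcases h p.toSubmodule (fun g v hv => p.apply_mem_toSubmodule g hv) with h | h
      · left; exact Subrepresentation.toSubmodule_injective h
      · right; exact Subrepresentation.toSubmodule_injective h

/-- `χ` is the character of a finite-dimensional representation of `G` over `K`. -/
def IsChar {K G : Type*} [Field K] [Group G] (χ : G → K) : Prop :=
  ∃ (d : ℕ) (ρ : Representation K G (Fin d → K)), ρ.character = χ

theorem IsIrrChar.isChar {K G : Type*} [Field K] [Group G] {χ : G → K} (h : IsIrrChar χ) :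
    IsChar χ := by
  obtain ⟨d, ρ, -, h⟩ := h
  exact ⟨d, ρ, h⟩

section Transport

variable {K G V W : Type*} [Field K] [Group G] [AddCommGroup V] [Module K V]
  [AddCommGroup W] [Module K W]

/-- Transport of a representation along a linear equivalence. -/
def Representation.congrRep (ρ : Representation K G V) (e : V ≃ₗ[K] W) : Representation K G W :=
  ((e.conjAlgEquiv K).toAlgHom.toMonoidHom).comp ρ

theorem Representation.congrRep_apply (ρ : Representation K G V) (e : V ≃ₗ[K] W) (g : G) (w : W) :
    ρ.congrRep e g w = e (ρ g (e.symm w)) := rfl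

/-- The transported representation is equivalent to the original one. -/
def Representation.equivCongrRep (ρ : Representation K G V) (e : V ≃ₗ[K] W) :
    Representation.Equiv ρ (ρ.congrRep e) :=
  Representation.Equiv.mk e fun g => by
    ext v
    simp [congrRep_apply]

theorem Representation.isIrreducible_of_equiv {ρ : Representation K G V} {σ : Representation K G W}
    (e : Representation.Equiv ρ σ) (h : ρ.IsIrreducible) : σ.IsIrreducible := by
  rw [isIrreducible_iff_submodule] at h ⊢
  obtain ⟨hn, h⟩ := h
  have hcomm : ∀ g v, e (ρ g v) = σ g (e v) := fun g v =>
    IntertwiningMap.isIntertwining ρ σ e.toIntertwiningMap g v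
  refine ⟨e.toLinearEquiv.toEquiv.symm.nontrivial, fun p hp => ?_⟩
  rcases h (p.comap e.toLinearEquiv.toLinearMap) (fun g v hv => by
    change e (ρ g v) ∈ p
    rw [hcomm]
    exact hp g _ hv) with h | h
  · left
    rw [eq_bot_iff]
    intro w hw
    obtain ⟨v, rfl⟩ := e.toLinearEquiv.surjective w
    have : v ∈ p.comap e.toLinearEquiv.toLinearMap := hw
    rw [h, Submodule.mem_bot] at this
    simp [this]
  · right
    rw [eq_top_iff]
    intro w _
    obtain ⟨v, rfl⟩ := e.toLinearEquiv.surjective w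
    have : v ∈ p.comap e.toLinearEquiv.toLinearMap := h ▸ Submodule.mem_top
    exact this

theorem IsChar.of_rep [FiniteDimensional K V] (ρ : Representation K G V) : IsChar ρ.character := by
  let e := (Module.finBasis K V).equivFun
  exact ⟨_, ρ.congrRep e, (char_iso (ρ.equivCongrRep e)).symm⟩

theorem IsIrrChar.of_rep [FiniteDimensional K V] (ρ : Representation K G V)
    (h : ρ.IsIrreducible) : IsIrrChar ρ.character := by
  let e := (Module.finBasis K V).equivFun
  exact ⟨_, ρ.congrRep e, isIrreducible_of_equiv (ρ.equivCongrRep e) h,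
    (char_iso (ρ.equivCongrRep e)).symm⟩

theorem IsChar.comp {H : Type*} [Group H] {χ : G → K} (h : IsChar χ) (f : H →* G) :
    IsChar (χ ∘ f) := by
  obtain ⟨d, ρ, rfl⟩ := h
  exact ⟨d, ρ.comp f, rfl⟩

theorem IsIrrChar.comp_surjective {H : Type*} [Group H] {χ : G → K} (h : IsIrrChar χ) (f : H →* G)
    (hf : Function.Surjective f) : IsIrrChar (χ ∘ f) := by
  obtain ⟨d, ρ, h, rfl⟩ := h
  rw [isIrreducible_iff_submodule] at h
  refine ⟨d, ρ.comp f, ?_, rfl⟩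
  rw [isIrreducible_iff_submodule]
  refine ⟨h.1, fun p hp => h.2 p fun g v hv => ?_⟩
  obtain ⟨x, rfl⟩ := hf g
  exact hp x v hv

theorem IsChar.mul_comm {χ : G → K} (h : IsChar χ) (x y : G) : χ (x * y) = χ (y * x) := by
  obtain ⟨d, ρ, rfl⟩ := h
  exact char_mul_comm _ _ _

theorem IsChar.mul {χ ψ : G → K} (h : IsChar χ) (h' : IsChar ψ) : IsChar (χ * ψ) := by
  obtain ⟨d, ρ, rfl⟩ := h
  obtain ⟨d', ρ', rfl⟩ := h'
  rw [← char_tensor]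
  exact IsChar.of_rep _

theorem IsChar.boxChar {H : Type*} [Group H] {χ : G → K} {ψ : H → K} (h : IsChar χ)
    (h' : IsChar ψ) : IsChar (boxChar χ ψ) :=
  (h.comp (MonoidHom.fst G H)).mul (h'.comp (MonoidHom.snd G H))

end Transport

/-! ### Orthogonality and decomposition into irreducible characters. -/

section Inner

variable {K G : Type*} [Field K] [Group G] [Fintype G]

/-- The scalar product of class functions as a bilinear form. -/
def charForm (K G : Type*) [Field K] [Group G] [Fintype G] :
    (G → K) →ₗ[K] (G → K) →ₗ[K] K :=
  LinearMap.mk₂ K charInner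
    (fun φ φ' ψ => by simp [charInner, add_mul, Finset.sum_add_distrib, mul_add])
    (fun c φ ψ => by
      simp only [charInner, Pi.smul_apply, smul_eq_mul, Finset.mul_sum]
      congr! 1
      ring)
    (fun φ ψ ψ' => by simp [charInner, mul_add, Finset.sum_add_distrib])
    (fun c φ ψ => by
      simp only [charInner, Pi.smul_apply, smul_eq_mul, Finset.mul_sum]
      congr! 1
      ring)

theorem charForm_apply (φ ψ : G → K) : charForm K G φ ψ = charInner φ ψ := rfl

theorem charInner_comm (φ ψ : G → K) : charInner φ ψ = charInner ψ φ := by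
  unfold charInner
  congr 1
  rw [← Equiv.sum_comp (Equiv.inv G)]
  simp [mul_comm]

theorem charInner_comp_equiv {H : Type*} [Group H] [Fintype H] (e : H ≃* G) (φ ψ : G → K) :
    charInner (φ ∘ e) (ψ ∘ e) = charInner φ ψ := by
  unfold charInner
  rw [Nat.card_congr e.toEquiv, ← Equiv.sum_comp e.toEquiv]
  simp

variable [CharZero K]

/-- Maschke's theorem, by induction on the dimension: a proper invariant subspace has an invariant
complement, and the trace is additive over the two summands. -/
theorem IsChar.exists_multiset {χ : G → K} (h : IsChar χ) :
    ∃ s : Multiset (G → K), (∀ ψ ∈ s, IsIrrChar ψ) ∧ s.sum = χ := by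
  obtain ⟨d, ρ, rfl⟩ := h
  induction d using Nat.strong_induction_on with
  | _ d ih =>
  -- The induction runs over representations on coordinate spaces; a choice of basis extends it to
  -- the subspaces that arise.
  have ih' : ∀ (V : Type _) [AddCommGroup V] [Module K V] [FiniteDimensional K V]
      (σ : Representation K G V), Module.finrank K V < d →
      ∃ s : Multiset (G → K), (∀ ψ ∈ s, IsIrrChar ψ) ∧ s.sum = σ.character := by
    intro V _ _ _ σ hd
    rw [char_iso (σ.equivCongrRep (Module.finBasis K V).equivFun)]
    exact ih _ hd _
  by_cases hirr : ρ.IsIrreducible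
  · exact ⟨{ρ.character}, by simpa using ⟨d, ρ, hirr, rfl⟩, by simp⟩
  by_cases hd : d = 0
  · subst hd
    refine ⟨0, by simp, ?_⟩
    ext g
    simp only [character, Multiset.sum_zero, Pi.zero_apply]
    rw [Subsingleton.elim (ρ g) 0, map_zero]
  · have : NeZero d := ⟨hd⟩
    rw [isIrreducible_iff_submodule] at hirr
    push Not at hirr
    obtain ⟨p, hp, hp0, hp1⟩ := hirr inferInstance
    have : NeZero (Nat.card G : K) := ⟨Nat.cast_ne_zero.2 Nat.card_pos.ne'⟩
    obtain ⟨q, hq⟩ := exists_isCompl (⟨p, fun g v hv => hp g v hv⟩ : Subrepresentation ρ)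
    set P : Subrepresentation ρ := ⟨p, fun g v hv => hp g v hv⟩
    have hc : IsCompl p q.toSubmodule := by
      constructor
      · rw [disjoint_iff]
        exact congrArg Subrepresentation.toSubmodule hq.inf_eq_bot
      · rw [codisjoint_iff]
        exact congrArg Subrepresentation.toSubmodule hq.sup_eq_top
    have hadd := Submodule.finrank_add_eq_of_isCompl hc
    rw [Module.finrank_fin_fun] at hadd
    have hp' : 0 < Module.finrank K p := by
      rw [Nat.pos_iff_ne_zero, Ne, Submodule.finrank_eq_zero]; exact hp0
    have hq' : 0 < Module.finrank K q.toSubmodule := by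
      rw [Nat.pos_iff_ne_zero, Ne, Submodule.finrank_eq_zero]
      intro h
      rw [h] at hc
      exact hp1 (by simpa using hc.sup_eq_top)
    obtain ⟨s, hs, hs'⟩ := ih' _ P.toRepresentation (show Module.finrank K p < d by omega)
    obtain ⟨t, ht, ht'⟩ := ih' _ q.toRepresentation (by omega)
    refine ⟨s + t, fun ψ hψ => (Multiset.mem_add.1 hψ).elim (hs ψ) (ht ψ), ?_⟩
    rw [Multiset.sum_add, hs', ht']
    ext g
    have key : ρ g = (p.prodEquivOfIsCompl q.toSubmodule hc).conj
        (LinearMap.prodMap (P.toRepresentation g) (q.toRepresentation g)) := by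
      refine LinearMap.ext fun v => ?_
      obtain ⟨⟨v, w⟩, rfl⟩ := (p.prodEquivOfIsCompl q.toSubmodule hc).surjective v
      rw [LinearEquiv.conj_apply_apply, LinearEquiv.symm_apply_apply]
      simp only [Submodule.coe_prodEquivOfIsCompl', map_add, LinearMap.prodMap_apply]
      rfl
    simp only [character, Pi.add_apply]
    rw [key, LinearMap.trace_conj', LinearMap.trace_prodMap']

/-- Schur orthogonality distinguishes isomorphic from non-isomorphic representations. That equal
characters force an isomorphism follows from it as well: otherwise the same scalar product would be
both `0` and `1`. -/
theorem IsIrrChar.charInner_eq [IsAlgClosed K] {χ ψ : G → K} [Decidable (χ = ψ)] (h : IsIrrChar χ)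
    (h' : IsIrrChar ψ) : charInner χ ψ = if χ = ψ then 1 else 0 := by
  classical
  obtain ⟨d, ρ, hρ, rfl⟩ := h
  obtain ⟨d', ρ', hρ', rfl⟩ := h'
  have : Invertible (Nat.card G : K) := invertibleOfNonzero (Nat.cast_ne_zero.2 Nat.card_pos.ne')
  have h1 := char_orthonormal ρ ρ'
  unfold charInner
  rw [h1]
  congr 1
  refine propext ⟨fun ⟨e⟩ => (char_iso e).symm, fun h => ?_⟩
  by_contra hne
  rw [if_neg hne, ← h] at h1
  have h2 := char_orthonormal ρ ρ
  rw [h1, if_pos ⟨Representation.Equiv.refl ρ⟩] at h2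
  exact zero_ne_one h2

variable [IsAlgClosed K]

theorem IsIrrChar.charInner_self {χ : G → K} (h : IsIrrChar χ) : charInner χ χ = 1 := by
  classical
  rw [h.charInner_eq h, if_pos rfl]

theorem IsIrrChar.charInner_of_ne {χ ψ : G → K} (h : IsIrrChar χ) (h' : IsIrrChar ψ) (hne : χ ≠ ψ) :
    charInner χ ψ = 0 := by
  classical
  rw [h.charInner_eq h', if_neg hne]

/-- A character is the sum of its irreducible constituents, with multiplicities given by the scalar
product. -/
theorem IsChar.exists_mult {χ : G → K} (h : IsChar χ) :
    ∃ (m : (G → K) →₀ ℕ), (∀ ψ ∈ m.support, IsIrrChar ψ) ∧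
      (∀ ψ, IsIrrChar ψ → charInner χ ψ = m ψ) ∧ χ = ∑ ψ ∈ m.support, (m ψ : K) • ψ := by
  classical
  obtain ⟨s, hs, rfl⟩ := h.exists_multiset
  have hsum : s.sum = ∑ ψ ∈ s.toFinset, (s.count ψ : K) • ψ := by
    rw [Finset.sum_multiset_count]
    simp only [Nat.cast_smul_eq_nsmul]
  refine ⟨Multiset.toFinsupp s, ?_, ?_, ?_⟩
  · simpa using hs
  · intro ψ hψ
    rw [hsum, ← charForm_apply, map_sum, LinearMap.sum_apply]
    simp only [map_smul, LinearMap.smul_apply, charForm_apply, Multiset.toFinsupp_apply]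
    rw [Finset.sum_eq_single ψ]
    · simp [hψ.charInner_self]
    · intro φ hφ hne
      rw [(hs φ (by simpa using hφ)).charInner_of_ne hψ hne, smul_zero]
    · intro hn
      simp [Multiset.count_eq_zero_of_notMem (by simpa using hn)]
  · simpa using hsum

omit [IsAlgClosed K] in
-- The scalar product is the dimension of a space of intertwining maps. Being natural numbers, such
-- values cannot cancel in a sum.
theorem IsChar.exists_nat_charInner {χ ψ : G → K} (h : IsChar χ) (h' : IsChar ψ) :
    ∃ n : ℕ, charInner χ ψ = n := by
  obtain ⟨d, ρ, rfl⟩ := h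
  obtain ⟨d', ρ', rfl⟩ := h'
  have : Invertible (Nat.card G : K) := invertibleOfNonzero (Nat.cast_ne_zero.2 Nat.card_pos.ne')
  exact ⟨_, card_inv_mul_sum_char_mul_char_eq_finrank _ _⟩

theorem IsChar.charInner_self_eq {χ : G → K} {m : (G → K) →₀ ℕ}
    (hirr : ∀ ψ ∈ m.support, IsIrrChar ψ)
    (hχ : χ = ∑ ψ ∈ m.support, (m ψ : K) • ψ) :
    charInner χ χ = ((∑ ψ ∈ m.support, m ψ ^ 2 : ℕ) : K) := by
  have h1 : ∀ φ ∈ m.support, charInner χ φ = m φ := by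
    intro φ hφ
    rw [hχ, ← charForm_apply, map_sum, LinearMap.sum_apply, Finset.sum_eq_single φ]
    · simp [charForm_apply, (hirr φ hφ).charInner_self]
    · intro ψ hψ hne
      simp [charForm_apply, (hirr ψ hψ).charInner_of_ne (hirr φ hφ) hne]
    · exact fun h => absurd hφ h
  have h2 : charInner χ χ = charForm K G χ (∑ ψ ∈ m.support, (m ψ : K) • ψ) := by
    rw [← hχ, charForm_apply]
  rw [h2, map_sum]
  push_cast
  refine Finset.sum_congr rfl fun ψ hψ => ?_
  rw [map_smul, charForm_apply, h1 ψ hψ, smul_eq_mul, sq]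

/-- The norm is the sum of the squares of the multiplicities, so norm one leaves room for a single
constituent, of multiplicity one. -/
theorem IsChar.isIrrChar_of_charInner_self {χ : G → K} (h : IsChar χ) (h1 : charInner χ χ = 1) :
    IsIrrChar χ := by
  obtain ⟨m, hirr, hm, hχ⟩ := h.exists_mult
  rw [charInner_self_eq hirr hχ] at h1
  have h1 : ∑ ψ ∈ m.support, m ψ ^ 2 = 1 := by exact_mod_cast h1
  have hpos : ∀ ψ ∈ m.support, 1 ≤ m ψ ^ 2 := fun ψ hψ =>
    Nat.one_le_iff_ne_zero.2 (pow_ne_zero _ (Finsupp.mem_support_iff.1 hψ))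
  have hcard : m.support.card ≤ 1 := by
    rw [← h1, Finset.card_eq_sum_ones]
    exact Finset.sum_le_sum hpos
  obtain ⟨ψ, hψ⟩ : m.support.Nonempty := by
    rw [Finset.nonempty_iff_ne_empty]
    intro h
    simp [h] at h1
  have hs : m.support = {ψ} := Finset.eq_singleton_iff_unique_mem.2
    ⟨hψ, fun φ hφ => Finset.card_le_one.1 hcard _ hφ _ hψ⟩
  rw [hs, Finset.sum_singleton] at h1 hχ
  have : m ψ = 1 := by simpa using h1
  rw [hχ, this]
  simpa using hirr ψ hψ

/-- Two distinct constituents already contribute at least two to the sum of squares, which leaves no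
room for other constituents or higher multiplicities. -/
theorem IsChar.eq_add_of_charInner_self {χ ψ₁ ψ₂ : G → K} (h : IsChar χ)
    (h2 : charInner χ χ = 2) (hψ₁ : IsIrrChar ψ₁) (hψ₂ : IsIrrChar ψ₂) (hne : ψ₁ ≠ ψ₂)
    (h₁ : charInner χ ψ₁ ≠ 0) (h₂ : charInner χ ψ₂ ≠ 0) : χ = ψ₁ + ψ₂ := by
  classical
  obtain ⟨m, hirr, hm, hχ⟩ := h.exists_mult
  rw [charInner_self_eq hirr hχ] at h2
  have h2 : ∑ ψ ∈ m.support, m ψ ^ 2 = 2 := by exact_mod_cast h2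
  rw [hm _ hψ₁] at h₁
  rw [hm _ hψ₂] at h₂
  have hpos : ∀ ψ ∈ m.support, 1 ≤ m ψ ^ 2 := fun ψ hψ =>
    Nat.one_le_iff_ne_zero.2 (pow_ne_zero _ (Finsupp.mem_support_iff.1 hψ))
  have hcard : m.support.card ≤ 2 := by
    rw [← h2, Finset.card_eq_sum_ones]
    exact Finset.sum_le_sum hpos
  have hsub : {ψ₁, ψ₂} ⊆ m.support := by
    intro φ hφ
    rw [Finset.mem_insert, Finset.mem_singleton] at hφ
    rw [Finsupp.mem_support_iff]
    rcases hφ with rfl | rfl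
    · exact_mod_cast h₁
    · exact_mod_cast h₂
  have hs : {ψ₁, ψ₂} = m.support := Finset.eq_of_subset_of_card_le hsub
    (by rwa [Finset.card_pair hne])
  rw [← hs] at h2 hχ hpos
  rw [Finset.sum_pair hne] at h2 hχ
  have p1 := hpos ψ₁ (by simp)
  have p2 := hpos ψ₂ (by simp)
  have q1 : m ψ₁ = 1 := by
    have : m ψ₁ ^ 2 = 1 := by omega
    simpa using this
  have q2 : m ψ₂ = 1 := by
    have : m ψ₂ ^ 2 = 1 := by omega
    simpa using this
  rw [hχ, q1, q2]
  simp

end Inner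

end

/-! ### Class functions and induction. -/

noncomputable section

open Representation

/-- Class functions on a group. -/
def IsClassFun {K G : Type*} [Group G] (χ : G → K) : Prop := ∀ x y, χ (x * y) = χ (y * x)

theorem IsChar.isClassFun {K G : Type*} [Field K] [Group G] {χ : G → K} (h : IsChar χ) :
    IsClassFun χ := h.mul_comm

theorem IsClassFun.conj {K G : Type*} [Group G] {χ : G → K} (h : IsClassFun χ) (x g : G) :
    χ (x⁻¹ * g * x) = χ g := by
  rw [h, mul_inv_cancel_left]

theorem IsClassFun.conj' {K G : Type*} [Group G] {χ : G → K} (h : IsClassFun χ) (x g : G) :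
    χ (x * g * x⁻¹) = χ g := by
  rw [h, inv_mul_cancel_left]

theorem IsClassFun.comp {K G H : Type*} [Group G] [Group H] {χ : G → K} (h : IsClassFun χ)
    (f : H →* G) : IsClassFun (χ ∘ f) := fun x y => by
  simp only [Function.comp_apply, map_mul]
  exact h _ _

theorem IsClassFun.boxChar {K G H : Type*} [Field K] [Group G] [Group H] {χ : G → K} {ψ : H → K}
    (h : IsClassFun χ) (h' : IsClassFun ψ) : IsClassFun (boxChar χ ψ) := fun x y => by
  simp only [_root_.boxChar, Prod.fst_mul, Prod.snd_mul]
  rw [h, h']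

section Ind

variable {K : Type*} [Field K] {G H : Type*} [Group G] [Fintype G] [Group H] [Fintype H]

theorem indChar_isClassFun (f : H →* G) (χ : H → K) : IsClassFun (indChar f χ) := fun x y => by
  unfold indChar
  congr 1
  rw [← Equiv.sum_comp (Equiv.mulLeft x)]
  refine Finset.sum_congr rfl fun z _ => Finset.sum_congr rfl fun h _ => ?_
  congr! 2
  simp only [Equiv.coe_mulLeft]
  group

theorem indChar_add (f : H →* G) (χ ψ : H → K) : indChar f (χ + ψ) = indChar f χ + indChar f ψ := by
  ext g
  simp only [indChar, Pi.add_apply, ← mul_add, ← Finset.sum_add_distrib]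
  congr 1
  refine Finset.sum_congr rfl fun x _ => Finset.sum_congr rfl fun h _ => ?_
  split_ifs <;> simp

theorem indChar_smul (f : H →* G) (c : K) (χ : H → K) : indChar f (c • χ) = c • indChar f χ := by
  ext g
  simp only [indChar, Pi.smul_apply, smul_eq_mul]
  rw [mul_left_comm c, Finset.mul_sum Finset.univ _ c]
  congr 1
  refine Finset.sum_congr rfl fun x _ => ?_
  rw [Finset.mul_sum]
  refine Finset.sum_congr rfl fun h _ => ?_
  split_ifs <;> simp

variable [CharZero K]

/-- Frobenius reciprocity. -/
theorem charInner_indChar (f : H →* G) (χ : H → K) {ψ : G → K} (hψ : IsClassFun ψ) :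
    charInner (indChar f χ) ψ = charInner χ (ψ ∘ f) := by
  classical
  have hG : (Nat.card G : K) ≠ 0 := Nat.cast_ne_zero.2 Nat.card_pos.ne'
  unfold charInner indChar
  rw [inv_mul_eq_iff_eq_mul₀ hG, mul_left_comm]
  simp only [mul_assoc]
  rw [← Finset.mul_sum]
  congr 1
  simp only [Finset.sum_mul]
  rw [Finset.sum_comm]
  have : ∀ x : G, ∑ g : G, ∑ h : H, (if f h = x⁻¹ * (g * x) then χ h else 0) * ψ g⁻¹ =
      ∑ h : H, χ h * (ψ ∘ f) h⁻¹ := by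
    intro x
    rw [Finset.sum_comm]
    refine Finset.sum_congr rfl fun h _ => ?_
    rw [Finset.sum_eq_single (x * f h * x⁻¹)]
    · rw [if_pos (by group)]
      congr 1
      rw [mul_inv_rev, mul_inv_rev, inv_inv, ← mul_assoc, hψ.conj', Function.comp_apply, map_inv]
    · intro g _ hg
      rw [if_neg, zero_mul]
      intro h'
      apply hg
      rw [h']
      group
    · simp
  rw [Finset.sum_congr rfl fun x _ => this x, Finset.sum_const, Finset.card_univ, nsmul_eq_mul,
    Fintype.card_eq_nat_card]

/-- Transitivity of induction. -/
theorem indChar_indChar {L : Type*} [Group L] [Fintype L] (g : G →* L) (f : H →* G) (χ : H → K) :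
    indChar g (indChar f χ) = indChar (g.comp f) χ := by
  classical
  have hG : (Nat.card G : K) ≠ 0 := Nat.cast_ne_zero.2 Nat.card_pos.ne'
  ext z
  unfold indChar
  rw [inv_mul_eq_iff_eq_mul₀ hG, mul_left_comm]
  have key : ∀ x : L, (∑ y : G, if g y = x⁻¹ * z * x then (Nat.card H : K)⁻¹ * ∑ u : G, ∑ h : H,
      (if f h = u⁻¹ * y * u then χ h else 0) else 0) = (Nat.card H : K)⁻¹ * ∑ u : G, ∑ h : H,
      if g (f h) = (x * g u)⁻¹ * z * (x * g u) then χ h else 0 := by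
    intro x
    have : ∀ (y u : G) (h : H), (if g y = x⁻¹ * z * x then
        (if f h = u⁻¹ * y * u then χ h else 0) else 0) =
        if y = u * f h * u⁻¹ then
          if g (f h) = (x * g u)⁻¹ * z * (x * g u) then χ h else 0 else 0 := by
      intro y u h
      by_cases h1 : y = u * f h * u⁻¹
      · subst h1
        rw [if_pos (show f h = u⁻¹ * (u * f h * u⁻¹) * u by group), if_pos rfl]
        refine if_congr ?_ rfl rfl
        rw [map_mul, map_mul, map_inv, mul_inv_eq_iff_eq_mul, ← eq_inv_mul_iff_mul_eq]
        simp only [mul_inv_rev, mul_assoc]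
      · rw [if_neg h1]
        have : ¬ f h = u⁻¹ * y * u := fun h2 => h1 (by rw [h2]; group)
        rw [if_neg this, ite_self]
    have h3 : ∀ y : G, (if g y = x⁻¹ * z * x then (Nat.card H : K)⁻¹ * ∑ u : G, ∑ h : H,
      (if f h = u⁻¹ * y * u then χ h else 0) else 0) = (Nat.card H : K)⁻¹ * ∑ u : G, ∑ h : H,
        (if g y = x⁻¹ * z * x then (if f h = u⁻¹ * y * u then χ h else 0) else 0) := by
      intro y
      split_ifs
      · rfl
      · simp
    simp only [h3, this]
    rw [← Finset.mul_sum, Finset.sum_comm]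
    congr 1
    refine Finset.sum_congr rfl fun u _ => ?_
    rw [Finset.sum_comm]
    refine Finset.sum_congr rfl fun h _ => ?_
    rw [Finset.sum_ite_eq' Finset.univ, if_pos (Finset.mem_univ _)]
  rw [Finset.sum_congr rfl fun x _ => key x, ← Finset.mul_sum]
  congr 1
  rw [Finset.sum_comm]
  have : ∀ u : G, (∑ x : L, ∑ h : H, if g (f h) = (x * g u)⁻¹ * z * (x * g u) then χ h else 0) =
      ∑ x : L, ∑ h : H, if (g.comp f) h = x⁻¹ * z * x then χ h else 0 := fun u =>
    Equiv.sum_comp (Equiv.mulRight (g u))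
      (fun x => ∑ h : H, if (g.comp f) h = x⁻¹ * z * x then χ h else 0)
  rw [Finset.sum_congr rfl fun u _ => this u, Finset.sum_const, Finset.card_univ, nsmul_eq_mul,
    Fintype.card_eq_nat_card]

omit [CharZero K] in
theorem indChar_boxChar {G' H' : Type*} [Group G'] [Fintype G'] [Group H'] [Fintype H']
    (f : H →* G) (f' : H' →* G') (χ : H → K) (χ' : H' → K) :
    indChar (f.prodMap f') (boxChar χ χ') = boxChar (indChar f χ) (indChar f' χ') := by
  classical
  ext ⟨g, g'⟩
  simp only [boxChar, indChar, Nat.card_prod, Nat.cast_mul, mul_inv]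
  rw [mul_mul_mul_comm, Finset.sum_mul_sum, Fintype.sum_prod_type]
  congr 1
  refine Finset.sum_congr rfl fun x _ => Finset.sum_congr rfl fun x' _ => ?_
  rw [Finset.sum_mul_sum, Fintype.sum_prod_type]
  refine Finset.sum_congr rfl fun h _ => Finset.sum_congr rfl fun h' _ => ?_
  simp only [MonoidHom.prodMap, MonoidHom.prod_apply, MonoidHom.coe_comp, MonoidHom.coe_fst,
    MonoidHom.coe_snd, Function.comp_apply, Prod.ext_iff, Prod.fst_mul, Prod.snd_mul, Prod.fst_inv,
    Prod.snd_inv]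
  split_ifs <;> simp_all

omit [CharZero K] in
/-- The projection formula. -/
theorem indChar_mul_comp (f : H →* G) (χ : H → K) {ψ : G → K} (hψ : IsClassFun ψ) :
    indChar f (χ * ψ ∘ f) = indChar f χ * ψ := by
  classical
  ext g
  simp only [indChar, Pi.mul_apply, Function.comp_apply, mul_assoc, Finset.sum_mul]
  congr 1
  refine Finset.sum_congr rfl fun x _ => Finset.sum_congr rfl fun h _ => ?_
  split_ifs with h1
  · rw [h1, ← mul_assoc, hψ.conj]
  · simp

omit [CharZero K] in
-- A translation of the outer sum absorbs the conjugation by `x`. This makes induction independent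
-- of how blocks are identified with coordinates.
theorem indChar_congr {H' : Type*} [Group H'] [Fintype H'] (f : H →* G) (f' : H' →* G)
    (e : H ≃* H') (χ : H → K) (χ' : H' → K) (x : G) (hχ : ∀ h, χ h = χ' (e h))
    (hf : ∀ h, f h = x * f' (e h) * x⁻¹) : indChar f χ = indChar f' χ' := by
  classical
  ext g
  unfold indChar
  rw [Nat.card_congr e.toEquiv, ← Equiv.sum_comp (Equiv.mulRight x⁻¹)]
  congr 1
  refine Finset.sum_congr rfl fun y _ => ?_
  rw [← Equiv.sum_comp e.toEquiv]
  refine Finset.sum_congr rfl fun h _ => ?_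
  rw [hχ, hf]
  refine if_congr ?_ rfl rfl
  simp only [Equiv.coe_mulRight, mul_inv_rev, inv_inv]
  have h2 : x * y⁻¹ * g * (y * x⁻¹) = x * (y⁻¹ * g * y) * x⁻¹ := by group
  rw [h2, mul_left_inj, mul_right_inj]
  rfl

omit [CharZero K] in
/-- Invariance of an induced class function under an automorphism of the group. -/
theorem indChar_comp_equiv (f : H →* G) (e : G ≃* G) (d : H ≃* H) (χ : H → K)
    (hf : ∀ h, e (f h) = f (d h)) (hχ : ∀ h, χ (d h) = χ h) (g : G) :
    indChar f χ (e g) = indChar f χ g := by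
  classical
  unfold indChar
  rw [← Equiv.sum_comp e.toEquiv]
  congr 1
  refine Finset.sum_congr rfl fun y _ => ?_
  rw [← Equiv.sum_comp d.toEquiv]
  refine Finset.sum_congr rfl fun h _ => ?_
  change (if f (d h) = (e y)⁻¹ * e g * e y then χ (d h) else 0) = _
  rw [hχ, ← hf, ← map_inv, ← map_mul, ← map_mul, e.apply_eq_iff_eq]

end Ind

section IndRep

variable {K : Type*} [Field K] {G H : Type*} [Group G] [Group H]

/-- The trace of `σ g ∘ e`, for an idempotent `e` commuting with the representation `σ`, is a
character. -/
theorem isChar_trace_idempotent {V : Type*} [AddCommGroup V] [Module K V] [FiniteDimensional K V]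
    (σ : Representation K G V) (e : V →ₗ[K] V) (he : e * e = e) (hc : ∀ g, σ g * e = e * σ g) :
    IsChar fun g => LinearMap.trace K V (σ g * e) := by
  have hc' : ∀ g v, σ g (e v) = e (σ g v) := fun g v => LinearMap.congr_fun (hc g) v
  let S : Subrepresentation σ := ⟨LinearMap.range e, by
    rintro g _ ⟨v, rfl⟩
    exact ⟨σ g v, (hc' g v).symm⟩⟩
  have h := IsChar.of_rep S.toRepresentation
  convert! h using 1
  ext g
  let ι : LinearMap.range e →ₗ[K] V := (LinearMap.range e).subtype
  let π : V →ₗ[K] LinearMap.range e := e.rangeRestrict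
  have h1 : σ g * e = (σ g ∘ₗ ι) ∘ₗ π := rfl
  rw [h1, LinearMap.trace_comp_comm']
  refine congrArg (LinearMap.trace K _) (LinearMap.ext ?_)
  rintro ⟨_, v, rfl⟩
  refine Subtype.ext ?_
  change e (σ g (e v)) = σ g (e v)
  rw [hc', ← Module.End.mul_apply, he]

/-- Characters induced from characters are characters. -/
theorem IsChar.indChar [CharZero K] [Fintype G] [Fintype H] {χ : H → K} (hχ : IsChar χ)
    (f : H →* G) : IsChar (indChar f χ) := by
  classical
  obtain ⟨d, ρ, rfl⟩ := hχ
  have hH : (Nat.card H : K) ≠ 0 := Nat.cast_ne_zero.2 Nat.card_pos.ne'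
  -- The induced representation consists of the functions `F` with `F (f h * x) = ρ h (F x)`, on
  -- which `G` acts by right translation `σ`. These are the invariants of the commuting action `τ`
  -- of `H`, and the averaging operator `e` projects onto them.
  let σ : Representation K G (G → Fin d → K) :=
    { toFun := fun g => LinearMap.funLeft K _ (fun x => x * g)
      map_one' := by ext; simp [LinearMap.funLeft]
      map_mul' := fun g g' => by
        refine LinearMap.ext fun F => ?_
        ext x
        simp [LinearMap.funLeft_apply, mul_assoc] }
  let τ : Representation K H (G → Fin d → K) :=
    { toFun := fun h => LinearMap.pi fun x => ρ h ∘ₗ LinearMap.proj ((f h)⁻¹ * x)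
      map_one' := by refine LinearMap.ext fun F => ?_; ext; simp
      map_mul' := fun g g' => by
        refine LinearMap.ext fun F => ?_
        ext x
        simp [mul_assoc] }
  let e : (G → Fin d → K) →ₗ[K] (G → Fin d → K) := (Nat.card H : K)⁻¹ • ∑ h, τ h
  have hτe : ∀ h, τ h * e = e := by
    intro h
    simp only [e, mul_smul_comm]
    congr 1
    rw [Finset.mul_sum, ← Equiv.sum_comp (Equiv.mulLeft h) (fun x => τ x)]
    simp only [Equiv.coe_mulLeft, map_mul]
  have he : e * e = e := by
    conv_lhs => enter [1]; rw [show e = (Nat.card H : K)⁻¹ • ∑ h, τ h from rfl]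
    rw [smul_mul_assoc, Finset.sum_mul, Finset.sum_congr rfl fun h _ => hτe h,
      Finset.sum_const, Finset.card_univ, ← Nat.cast_smul_eq_nsmul K, smul_smul,
      Fintype.card_eq_nat_card, inv_mul_cancel₀ hH, one_smul]
  have hcomm : ∀ g h, σ g * τ h = τ h * σ g := by
    intro g h
    refine LinearMap.ext fun F => ?_
    ext x
    simp [σ, τ, LinearMap.funLeft_apply, mul_assoc]
  have hc : ∀ g, σ g * e = e * σ g := by
    intro g
    simp only [e, mul_smul_comm, smul_mul_assoc, Finset.mul_sum, Finset.sum_mul, hcomm]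
  -- The operator permutes the summands indexed by the points of `G`, so only fixed points
  -- contribute to the trace. Reindexing by inversion turns the fixed point condition into the one
  -- in the definition of induction.
  have htr : ∀ g h, LinearMap.trace K _ (σ g * τ h) =
      ∑ x : G, if f h = x⁻¹ * g * x then ρ.character h else 0 := by
    intro g h
    rw [LinearMap.trace_eq_matrix_trace K (Pi.basis fun _ : G => Pi.basisFun K (Fin d)),
      Matrix.trace, Fintype.sum_sigma, ← Equiv.sum_comp (Equiv.inv G)]
    refine Finset.sum_congr rfl fun x _ => ?_
    have hch : ρ.character h = ∑ i, ρ h (Pi.single i 1) i := by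
      rw [character, LinearMap.trace_eq_matrix_trace K (Pi.basisFun K (Fin d)), Matrix.trace]
      simp
    have hσ : ∀ F y, (σ g * τ h) F y = ρ h (F ((f h)⁻¹ * (y * g))) := fun F y => rfl
    have hx : f h = x⁻¹ * g * x ↔ (f h)⁻¹ * (x⁻¹ * g) = x⁻¹ := by
      rw [inv_mul_eq_iff_eq_mul, ← mul_inv_eq_iff_eq_mul, eq_comm]
    rw [hch]
    split_ifs with h1
    · refine Finset.sum_congr rfl fun i _ => ?_
      rw [Matrix.diag_apply, LinearMap.toMatrix_apply, Pi.basis_apply, Pi.basis_repr, hσ,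
        Pi.basisFun_apply, Pi.basisFun_repr, Equiv.inv_apply, hx.1 h1, Pi.single_eq_same]
    · refine Finset.sum_eq_zero fun i _ => ?_
      rw [Matrix.diag_apply, LinearMap.toMatrix_apply, Pi.basis_apply, Pi.basis_repr, hσ,
        Pi.basisFun_apply, Pi.basisFun_repr, Equiv.inv_apply,
        Pi.single_eq_of_ne (fun h2 => h1 (hx.2 h2)), map_zero, Pi.zero_apply]
  have := isChar_trace_idempotent σ e he hc
  convert! this using 1
  ext g
  simp only [e, mul_smul_comm, map_smul, Finset.mul_sum, map_sum, htr, smul_eq_mul]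
  rw [_root_.indChar, Finset.sum_comm, Finset.mul_sum]
  simp only [Finset.mul_sum]

end IndRep

end

noncomputable section

open Representation

/-! ### Left ideals of the group algebra generated by one element. -/

section LeftIdeal

variable {K G : Type*} [Field K] [Group G]

instance [Finite G] : FiniteDimensional K (MonoidAlgebra K G) :=
  Module.Finite.equiv (MonoidAlgebra.coeffLinearEquiv K).symm

/-- The representation of `G` on the left ideal of the group algebra generated by `c`. -/
def leftIdealRep (c : MonoidAlgebra K G) :
    Representation K G (Submodule.span (MonoidAlgebra K G) {c}) :=
  ((Algebra.lsmul K K (Submodule.span (MonoidAlgebra K G) {c})).toMonoidHom).comp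
    (MonoidAlgebra.of K G)

theorem leftIdealRep_apply (c : MonoidAlgebra K G) (g : G)
    (v : Submodule.span (MonoidAlgebra K G) {c}) :
    leftIdealRep c g v = MonoidAlgebra.of K G g • v := rfl

instance [Finite G] (c : MonoidAlgebra K G) :
    FiniteDimensional K (Submodule.span (MonoidAlgebra K G) {c}) :=
  inferInstanceAs (FiniteDimensional K
    ((Submodule.span (MonoidAlgebra K G) {c}).restrictScalars K))

/-- By Maschke the left ideal has a complement; the component of `1` in the ideal acts on it as a
right identity. -/
theorem exists_mul_eq_of_mem_leftIdeal [CharZero K] [Finite G]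
    (L : Submodule (MonoidAlgebra K G) (MonoidAlgebra K G)) : ∃ e ∈ L, ∀ x ∈ L, x * e = x := by
  have : NeZero (Nat.card G : K) := ⟨Nat.cast_ne_zero.2 Nat.card_pos.ne'⟩
  obtain ⟨M, hM⟩ := MonoidAlgebra.Submodule.exists_isCompl L
  obtain ⟨e, he, f, hf, hef⟩ := Submodule.mem_sup.1 (hM.sup_eq_top ▸ Submodule.mem_top (x := 1))
  refine ⟨e, he, fun x hx => ?_⟩
  have h1 : x * f = x - x * e := by
    rw [eq_sub_iff_add_eq, ← mul_add, add_comm f, hef, mul_one]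
  have h2 : x * f ∈ L ⊓ M := ⟨h1 ▸ L.sub_mem hx (L.smul_mem x he), M.smul_mem x hf⟩
  rw [hM.inf_eq_bot, Submodule.mem_bot, h1, sub_eq_zero] at h2
  exact h2.symm

theorem leftIdealRep_smul_mem {c : MonoidAlgebra K G}
    (p : Submodule K (Submodule.span (MonoidAlgebra K G) {c}))
    (hp : ∀ g, ∀ v ∈ p, leftIdealRep c g v ∈ p) (a : MonoidAlgebra K G)
    {v : Submodule.span (MonoidAlgebra K G) {c}} (hv : v ∈ p) : a • v ∈ p := by
  induction a using MonoidAlgebra.induction_on with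
  | of g => exact hp g v hv
  | add x y hx hy => rw [add_smul]; exact p.add_mem hx hy
  | smul r x hx => rw [smul_assoc]; exact p.smul_mem r hx

/-- Let `p` be an invariant subspace. If `c` annihilates `p` from the left, then a right identity of
`p` is killed by every element of the ideal generated by `c`, so `p` is zero. Otherwise `c` times
some element of `p` is a nonzero multiple of `c`, so `p` contains the generator. -/
theorem leftIdealRep_isIrreducible [CharZero K] [Finite G] {c : MonoidAlgebra K G} (hc : c ≠ 0)
    (h : ∀ x, ∃ k : K, c * x * c = k • c) : (leftIdealRep c).IsIrreducible := by
  rw [isIrreducible_iff_submodule]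
  have hcmem := Submodule.mem_span_singleton_self (R := MonoidAlgebra K G) c
  refine ⟨⟨⟨c, hcmem⟩, 0, fun h => hc (congrArg Subtype.val h)⟩, fun p hp => ?_⟩
  by_cases h0 : ∀ y ∈ p, c * (y : MonoidAlgebra K G) = 0
  · left
    let L : Submodule (MonoidAlgebra K G) (MonoidAlgebra K G) :=
      { carrier := {x | ∃ y ∈ p, (y : MonoidAlgebra K G) = x}
        add_mem' := by
          rintro _ _ ⟨y, hy, rfl⟩ ⟨z, hz, rfl⟩
          exact ⟨y + z, p.add_mem hy hz, rfl⟩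
        zero_mem' := ⟨0, p.zero_mem, rfl⟩
        smul_mem' := by
          rintro a _ ⟨y, hy, rfl⟩
          exact ⟨a • y, leftIdealRep_smul_mem p hp a hy, rfl⟩ }
    obtain ⟨e, ⟨y, hy, rfl⟩, he⟩ := exists_mul_eq_of_mem_leftIdeal L
    rw [eq_bot_iff]
    intro z hz
    have h1 := he z ⟨z, hz, rfl⟩
    obtain ⟨a, ha⟩ := Submodule.mem_span_singleton.1 z.2
    rw [← ha, smul_eq_mul, mul_assoc, h0 y hy, mul_zero] at h1
    rw [Submodule.mem_bot]
    refine Subtype.ext ?_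
    rw [← ha, smul_eq_mul, ← h1]
    rfl
  · right
    push Not at h0
    obtain ⟨y, hy, hy0⟩ := h0
    obtain ⟨a, ha⟩ := Submodule.mem_span_singleton.1 y.2
    obtain ⟨k, hk⟩ := h a
    have hcy : c * (y : MonoidAlgebra K G) = k • c := by rw [← ha, smul_eq_mul, ← mul_assoc, hk]
    have hk0 : k ≠ 0 := by
      rintro rfl
      rw [hcy, zero_smul] at hy0
      exact hy0 rfl
    have hcp : (⟨c, hcmem⟩ : Submodule.span (MonoidAlgebra K G) {c}) ∈ p := by
      have h1 := p.smul_mem k⁻¹ (leftIdealRep_smul_mem p hp c hy)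
      convert! h1 using 1
      refine Subtype.ext ?_
      change c = k⁻¹ • (c * (y : MonoidAlgebra K G))
      rw [hcy, smul_smul, inv_mul_cancel₀ hk0, one_smul]
    rw [eq_top_iff]
    rintro z -
    obtain ⟨b, hb⟩ := Submodule.mem_span_singleton.1 z.2
    convert! leftIdealRep_smul_mem p hp b hcp using 1
    exact Subtype.ext hb.symm

/-- An isomorphism maps the right identity `e = a * c` to `e * φ e`, which has the form `a * c * (b
* c')` and vanishes. Then `e = 0`, and so `c = c * e = 0`. -/
theorem leftIdealRep_isEmpty_equiv [CharZero K] [Finite G] {c c' : MonoidAlgebra K G} (hc : c ≠ 0)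
    (h : ∀ x, c * x * c' = 0) :
    IsEmpty (Representation.Equiv (leftIdealRep c) (leftIdealRep c')) := by
  refine ⟨fun φ => ?_⟩
  have hφ : ∀ (a : MonoidAlgebra K G) v, φ (a • v) = a • φ v := by
    intro a v
    induction a using MonoidAlgebra.induction_on with
    | of g => exact IntertwiningMap.isIntertwining _ _ φ.toIntertwiningMap g v
    | add x y hx hy => rw [add_smul, add_smul, map_add, hx, hy]
    | smul r x hx => rw [smul_assoc, smul_assoc, map_smul, hx]
  obtain ⟨e, he, hmul⟩ := exists_mul_eq_of_mem_leftIdeal (Submodule.span (MonoidAlgebra K G) {c})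
  obtain ⟨a, ha⟩ := Submodule.mem_span_singleton.1 he
  obtain ⟨b, hb⟩ := Submodule.mem_span_singleton.1 (φ ⟨e, he⟩).2
  have h1 : φ ⟨e, he⟩ = 0 := by
    have h2 : (⟨e, he⟩ : Submodule.span (MonoidAlgebra K G) {c}) = e • ⟨e, he⟩ :=
      Subtype.ext (hmul e he).symm
    rw [h2, hφ]
    refine Subtype.ext ?_
    change e * (φ ⟨e, he⟩ : MonoidAlgebra K G) = 0
    rw [← hb, ← ha, smul_eq_mul, smul_eq_mul, mul_assoc, ← mul_assoc c, h, mul_zero]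
  have h2 : (⟨e, he⟩ : Submodule.span (MonoidAlgebra K G) {c}) = 0 :=
    φ.toLinearEquiv.map_eq_zero_iff.1 h1
  have h3 : e = 0 := congrArg Subtype.val h2
  apply hc
  rw [← hmul c (Submodule.mem_span_singleton_self c), h3, mul_zero]

theorem leftIdealRep_character_domCongr [Finite G] {H : Type*} [Group H] [Finite H] (e : G ≃* H)
    (c : MonoidAlgebra K G) (x : G) :
    (leftIdealRep (MonoidAlgebra.domCongr K K e c)).character (e x) =
      (leftIdealRep c).character x := by
  let Φ := MonoidAlgebra.domCongr K K e
  have h1 : ∀ v ∈ Submodule.span (MonoidAlgebra K G) {c},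
      Φ v ∈ Submodule.span (MonoidAlgebra K H) {Φ c} := by
    intro v hv
    obtain ⟨a, rfl⟩ := Submodule.mem_span_singleton.1 hv
    rw [smul_eq_mul, map_mul]
    exact Submodule.smul_mem _ _ (Submodule.mem_span_singleton_self _)
  have h2 : ∀ v ∈ Submodule.span (MonoidAlgebra K H) {Φ c},
      Φ.symm v ∈ Submodule.span (MonoidAlgebra K G) {c} := by
    intro v hv
    obtain ⟨a, rfl⟩ := Submodule.mem_span_singleton.1 hv
    rw [smul_eq_mul, map_mul, AlgEquiv.symm_apply_apply]
    exact Submodule.smul_mem _ _ (Submodule.mem_span_singleton_self _)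
  let E : Submodule.span (MonoidAlgebra K G) {c} ≃ₗ[K]
      Submodule.span (MonoidAlgebra K H) {Φ c} :=
    { toFun := fun v => ⟨Φ v, h1 v v.2⟩
      map_add' := fun v w => Subtype.ext (map_add Φ _ _)
      map_smul' := fun k v => Subtype.ext (map_smul Φ k (v : MonoidAlgebra K G))
      invFun := fun v => ⟨Φ.symm v, h2 v v.2⟩
      left_inv := fun v => Subtype.ext (Φ.symm_apply_apply _)
      right_inv := fun v => Subtype.ext (Φ.apply_symm_apply _) }
  have := char_iso (ρ := leftIdealRep c) (σ := (leftIdealRep (Φ c)).comp e.toMonoidHom)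
    (Representation.Equiv.mk E fun g => by
      refine LinearMap.ext fun v => Subtype.ext ?_
      change Φ (MonoidAlgebra.of K G g * (v : MonoidAlgebra K G)) =
        MonoidAlgebra.of K H (e g) * Φ v
      rw [map_mul]
      congr 1
      exact MonoidAlgebra.domCongr_single _ _ _)
  exact (congrFun this x).symm

end LeftIdeal

/-! ### Young symmetrizers. -/

section Young

open Classical in
/-- The Young symmetrizer for a Young diagram with cells `α`, where the functions `r` and `q`
separate the rows and the columns. -/
def youngSym (K : Type*) [Field K] {α : Type*} [Fintype α] (r q : α → ℕ) :
    MonoidAlgebra K (Equiv.Perm α) :=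
  (∑ p : Equiv.Perm α, if ∀ c, r (p c) = r c then MonoidAlgebra.single p 1 else 0) *
    ∑ s : Equiv.Perm α,
      if ∀ c, q (s c) = q c then MonoidAlgebra.single s ((Equiv.Perm.sign s : ℤ) : K) else 0

variable {K : Type*} [Field K] {α : Type*} [Fintype α]

theorem youngSym_congr {r q r' q' : α → ℕ} (hr : ∀ x y, r x = r y ↔ r' x = r' y)
    (hq : ∀ x y, q x = q y ↔ q' x = q' y) : youngSym K r q = youngSym K r' q' := by
  simp only [youngSym, hr, hq]

theorem domCongr_youngSym {β : Type*} [Fintype β] (e : α ≃ β) (r q : β → ℕ) :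
    MonoidAlgebra.domCongr K K e.permCongrHom (youngSym K (r ∘ e) (q ∘ e)) = youngSym K r q := by
  classical
  simp only [youngSym, map_mul, map_sum]
  congr 1
  · refine Fintype.sum_equiv e.permCongrHom.toEquiv _ _ fun p => ?_
    have : (∀ c, (r ∘ e) (p c) = (r ∘ e) c) ↔ ∀ c, r (e.permCongrHom p c) = r c := by
      rw [← e.forall_congr_right]
      simp [Equiv.permCongrHom]
    rw [apply_ite (MonoidAlgebra.domCongr K K e.permCongrHom), map_zero,
      MonoidAlgebra.domCongr_single]
    exact if_congr this rfl rfl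
  · refine Fintype.sum_equiv e.permCongrHom.toEquiv _ _ fun p => ?_
    have : (∀ c, (q ∘ e) (p c) = (q ∘ e) c) ↔ ∀ c, q (e.permCongrHom p c) = q c := by
      rw [← e.forall_congr_right]
      simp [Equiv.permCongrHom]
    rw [apply_ite (MonoidAlgebra.domCongr K K e.permCongrHom), map_zero,
      MonoidAlgebra.domCongr_single]
    refine if_congr this ?_ rfl
    have h2 : Equiv.Perm.sign (e.permCongrHom.toEquiv p) = Equiv.Perm.sign p :=
      Equiv.Perm.sign_permCongr e p
    rw [h2]
    rfl

open Classical in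
/-- The first factor of the Young symmetrizer. -/
def rowSum (K : Type*) [Field K] {α : Type*} [Fintype α] (r : α → ℕ) :
    MonoidAlgebra K (Equiv.Perm α) :=
  ∑ p : Equiv.Perm α, if ∀ c, r (p c) = r c then MonoidAlgebra.single p 1 else 0

open Classical in
/-- The second factor of the Young symmetrizer. -/
def colSum (K : Type*) [Field K] {α : Type*} [Fintype α] (q : α → ℕ) :
    MonoidAlgebra K (Equiv.Perm α) :=
  ∑ s : Equiv.Perm α,
    if ∀ c, q (s c) = q c then MonoidAlgebra.single s ((Equiv.Perm.sign s : ℤ) : K) else 0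

theorem youngSym_eq (r q : α → ℕ) : youngSym K r q = rowSum K r * colSum K q := rfl

theorem Equiv.Perm.apply_inv_self' {α : Type*} (p : Equiv.Perm α) (c : α) : p (p⁻¹ c) = c :=
  p.apply_symm_apply c

theorem Equiv.Perm.inv_apply_self' {α : Type*} (p : Equiv.Perm α) (c : α) : p⁻¹ (p c) = c :=
  p.symm_apply_apply c

theorem rowSum_mul_single {r : α → ℕ} (t : Equiv.Perm α) (ht : ∀ c, r (t c) = r c) :
    rowSum K r * MonoidAlgebra.single t 1 = rowSum K r := by
  classical
  unfold rowSum
  rw [Finset.sum_mul]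
  refine Fintype.sum_equiv (Equiv.mulRight t) _ _ fun p => ?_
  have : (∀ c, r (p c) = r c) ↔ ∀ c, r ((p * t) c) = r c := by
    simp only [Equiv.Perm.mul_apply]
    constructor
    · intro h c
      rw [h, ht]
    · intro h c
      have := h (t⁻¹ c)
      rw [Equiv.Perm.apply_inv_self'] at this
      rw [this, ← ht, Equiv.Perm.apply_inv_self']
  rw [ite_mul, zero_mul, MonoidAlgebra.single_mul_single, one_mul]
  exact if_congr this rfl rfl

open Classical in
theorem single_mul_colSum {q : α → ℕ} (t : Equiv.Perm α)
    (ht : ∀ c, q (t c) = q c) :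
    MonoidAlgebra.single t 1 * colSum K q = ((Equiv.Perm.sign t : ℤ) : K) • colSum K q := by
  unfold colSum
  rw [Finset.mul_sum, Finset.smul_sum (r := ((Equiv.Perm.sign t : ℤ) : K))]
  refine Fintype.sum_equiv (Equiv.mulLeft t) _ _ fun p => ?_
  have : (∀ c, q (p c) = q c) ↔ ∀ c, q ((t * p) c) = q c := by
    simp only [Equiv.Perm.mul_apply, ht]
  rw [mul_ite, mul_zero, MonoidAlgebra.single_mul_single, one_mul, smul_ite, smul_zero]
  refine if_congr this ?_ rfl
  rw [MonoidAlgebra.smul_single, smul_eq_mul, Equiv.coe_mulLeft, Equiv.Perm.sign_mul]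
  have h2 : ((Equiv.Perm.sign t : ℤ) : K) * ((Equiv.Perm.sign t : ℤ) : K) = 1 := by
    rw [← Int.cast_mul, ← Units.val_mul, Int.units_mul_self]; simp
  push_cast
  convert! congrArg (MonoidAlgebra.single (t * p)) (show ((Equiv.Perm.sign p : ℤ) : K) = _ from ?_)
  convert! (one_mul _).symm using 1
  rw [← h2, mul_assoc]

/-- The transposition of `i` and `j` is absorbed by the row sum on the left. Moved past `x` it
becomes a transposition preserving columns, which the column sum absorbs with sign `-1`. So the
product is its own negative. -/
theorem rowSum_mul_colSum_eq_zero [CharZero K] {r q : α → ℕ} (x : Equiv.Perm α)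
    (h : ∃ i j, i ≠ j ∧ r i = r j ∧ q (x⁻¹ i) = q (x⁻¹ j)) :
    rowSum K r * MonoidAlgebra.single x 1 * colSum K q = 0 := by
  classical
  obtain ⟨i, j, hij, hr, hq⟩ := h
  have h1 : ∀ c, r (Equiv.swap i j c) = r c := by
    intro c
    rw [Equiv.swap_apply_def]
    split_ifs <;> simp_all
  have h2 : ∀ c, q ((x⁻¹ * Equiv.swap i j * x) c) = q c := by
    intro c
    have := Equiv.swap_apply_apply x⁻¹ i j
    rw [inv_inv] at this
    rw [← this, Equiv.swap_apply_def]
    split_ifs <;> simp_all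
  have h3 : rowSum K r * MonoidAlgebra.single x 1 * colSum K q =
      -(rowSum K r * MonoidAlgebra.single x 1 * colSum K q) := by
    conv_lhs => rw [← rowSum_mul_single _ h1]
    have h4 : MonoidAlgebra.single (Equiv.swap i j) (1 : K) * MonoidAlgebra.single x 1 =
        MonoidAlgebra.single x 1 * MonoidAlgebra.single (x⁻¹ * Equiv.swap i j * x) 1 := by
      rw [MonoidAlgebra.single_mul_single, MonoidAlgebra.single_mul_single]
      congr 1
      group
    rw [mul_assoc (rowSum K r), h4, ← mul_assoc, mul_assoc, single_mul_colSum _ h2]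
    have h5 : Equiv.Perm.sign (x⁻¹ * Equiv.swap i j * x) = -1 := by
      rw [Equiv.Perm.sign_mul, Equiv.Perm.sign_mul, Equiv.Perm.sign_swap hij, Equiv.Perm.sign_inv]
      rcases Int.units_eq_one_or (Equiv.Perm.sign x) with h | h <;> simp [h]
    rw [h5]
    simp
  have h6 : (2 : K) • (rowSum K r * MonoidAlgebra.single x 1 * colSum K q) = 0 := by
    rw [two_smul]
    nth_rewrite 1 [h3]
    exact neg_add_cancel _
  exact (smul_eq_zero.1 h6).resolve_left two_ne_zero

/-- The coefficient at the identity is one: only the identity preserves both rows and columns, so a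
row permutation and a column permutation are inverse to each other only if both are trivial. -/
theorem youngSym_ne_zero {r q : α → ℕ} (h : ∀ i j, r i = r j → q i = q j → i = j) :
    youngSym K r q ≠ 0 := by
  classical
  intro h0
  have h1 := congrArg (fun x => x.coeff 1) h0
  simp only [youngSym, MonoidAlgebra.coeff_zero, Finsupp.coe_zero, Pi.zero_apply] at h1
  rw [Finset.sum_mul_sum, MonoidAlgebra.coeff_sum, Finsupp.finsetSum_apply,
    Finset.sum_eq_single 1] at h1
  · rw [MonoidAlgebra.coeff_sum, Finsupp.finsetSum_apply, Finset.sum_eq_single 1] at h1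
    · simp at h1
    · intro s _ hs
      split_ifs
      · rw [MonoidAlgebra.single_mul_single, MonoidAlgebra.coeff_single, one_mul,
          Finsupp.single_eq_of_ne hs.symm]
      all_goals simp
    · simp
  · intro p _ hp
    rw [MonoidAlgebra.coeff_sum, Finsupp.finsetSum_apply]
    refine Finset.sum_eq_zero fun s _ => ?_
    split_ifs with h2 h3
    · rw [MonoidAlgebra.single_mul_single, MonoidAlgebra.coeff_single, Finsupp.single_apply, if_neg]
      intro h4
      apply hp
      ext c
      have h5 : s (p c) = c := by
        have : s = p⁻¹ := eq_inv_of_mul_eq_one_right h4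
        rw [this, Equiv.Perm.inv_apply_self']
      rw [Equiv.Perm.one_apply]
      refine h _ _ (h2 c) ?_
      rw [← h3 (p c), h5]
    all_goals simp
  · simp

theorem youngSym_mul_mul_eq_zero [CharZero K] {r q r' q' : α → ℕ}
    (h : ∀ x : Equiv.Perm α, ∃ i j, i ≠ j ∧ r i = r j ∧ q' (x i) = q' (x j))
    (x : MonoidAlgebra K (Equiv.Perm α)) : youngSym K r q * x * youngSym K r' q' = 0 := by
  have key : ∀ y : MonoidAlgebra K (Equiv.Perm α), rowSum K r * y * colSum K q' = 0 := by
    intro y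
    induction y using MonoidAlgebra.induction_on with
    | of g => exact rowSum_mul_colSum_eq_zero g (h g⁻¹)
    | add x y hx hy => rw [mul_add, add_mul, hx, hy, add_zero]
    | smul k x hx => rw [mul_smul_comm, smul_mul_assoc, hx, smul_zero]
  have := key (colSum K q * x * rowSum K r')
  rw [youngSym_eq, youngSym_eq]
  simpa only [mul_assoc] using this

/-- Only the outer row sum and the outer column sum matter; all the rest is an arbitrary element
between them. A group element there either gives zero by a transposition, or is a row permutation
times a column permutation and is absorbed up to sign. -/
theorem youngSym_mul_mul_self [CharZero K] {r q : α → ℕ}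
    (h : ∀ x : Equiv.Perm α, (∃ i j, i ≠ j ∧ r i = r j ∧ q (x i) = q (x j)) ∨
      ∃ p s : Equiv.Perm α, (∀ c, r (p c) = r c) ∧ (∀ c, q (s c) = q c) ∧ x = s * p)
    (x : MonoidAlgebra K (Equiv.Perm α)) :
    ∃ k : K, youngSym K r q * x * youngSym K r q = k • youngSym K r q := by
  classical
  have key : ∀ y : MonoidAlgebra K (Equiv.Perm α), ∃ k : K,
      rowSum K r * y * colSum K q = k • youngSym K r q := by
    intro y
    induction y using MonoidAlgebra.induction_on with
    | of g =>
      -- The dichotomy is used for the inverse, since inverting `s * p` puts the row permutation on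
      -- the left, next to the row sum.
      rcases h g⁻¹ with h | ⟨p, s, hp, hs, hg⟩
      · exact ⟨0, by rw [zero_smul]; exact rowSum_mul_colSum_eq_zero g h⟩
      · have hp' : ∀ c, r (p⁻¹ c) = r c := fun c => by
          rw [← hp, Equiv.Perm.apply_inv_self']
        have hs' : ∀ c, q (s⁻¹ c) = q c := fun c => by
          rw [← hs, Equiv.Perm.apply_inv_self']
        have hg' : g = p⁻¹ * s⁻¹ := by rw [← inv_inv g, hg, mul_inv_rev]
        refine ⟨((Equiv.Perm.sign s⁻¹ : ℤ) : K), ?_⟩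
        have h1 : MonoidAlgebra.of K _ g =
            MonoidAlgebra.single p⁻¹ (1 : K) * MonoidAlgebra.single s⁻¹ 1 := by
          rw [hg', map_mul]; rfl
        rw [h1, ← mul_assoc, rowSum_mul_single _ hp', mul_assoc, single_mul_colSum _ hs',
          mul_smul_comm, youngSym_eq]
    | add x y hx hy =>
      obtain ⟨k, hk⟩ := hx
      obtain ⟨l, hl⟩ := hy
      exact ⟨k + l, by rw [mul_add, add_mul, hk, hl, add_smul]⟩
    | smul k x hx =>
      obtain ⟨l, hl⟩ := hx
      exact ⟨k * l, by rw [mul_smul_comm, smul_mul_assoc, hl, mul_smul]⟩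
  obtain ⟨k, hk⟩ := key (colSum K q * x * rowSum K r)
  refine ⟨k, ?_⟩
  rw [← hk, youngSym_eq]
  simp only [mul_assoc]

end Young

end

noncomputable section

open Representation

namespace BetaSet

/-! ### Counting cells of Young diagrams by rows and columns. -/

section Counting

variable {B C : Finset ℕ}

theorem card_fiber_le_card_rows (σ : cells B ≃ cells C)
    (hσ : ∀ i j : cells B, i.1.1 = j.1.1 → (σ i).1.2 = (σ j).1.2 → i = j) (R : Finset ℕ) (y : ℕ) :
    ((Finset.univ.filter fun u : cells B => u.1.1 ∈ R).filter fun u => (σ u).1.2 = y).card ≤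
      R.card := by
  refine Finset.card_le_card_of_injOn (fun u => u.1.1) (fun u hu => ?_) fun u hu v hv h => ?_
  · simp only [Finset.coe_filter, Finset.mem_filter, Finset.mem_univ, true_and,
      Set.mem_ofPred_eq] at hu
    exact hu.1
  · simp only [Finset.coe_filter, Finset.mem_filter, Finset.mem_univ, true_and,
      Set.mem_ofPred_eq] at hu hv
    exact hσ u v h (hu.2.trans hv.2.symm)

theorem card_fiber_le_card_col (σ : cells B ≃ cells C) (R : Finset ℕ) (y : ℕ) :
    ((Finset.univ.filter fun u : cells B => u.1.1 ∈ R).filter fun u => (σ u).1.2 = y).card ≤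
      (C.filter fun x => y < x).card := by
  refine Finset.card_le_card_of_injOn (fun u => (σ u).1.1) (fun u hu => ?_) fun u hu v hv h => ?_
  · simp only [Finset.coe_filter, Finset.mem_filter, Finset.mem_univ, true_and,
      Set.mem_ofPred_eq] at hu ⊢
    have := mem_cells.1 (σ u).2
    exact ⟨this.1, hu.2 ▸ this.2.2⟩
  · simp only [Finset.coe_filter, Finset.mem_filter, Finset.mem_univ, true_and,
      Set.mem_ofPred_eq] at hu hv
    exact σ.injective (Subtype.ext (Prod.ext h (hu.2.trans hv.2.symm)))

theorem card_cells_fiber {R : Finset ℕ} (hR : R ⊆ B) {y : ℕ} (hy : y ∉ B) :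
    ((Finset.univ.filter fun u : cells B => u.1.1 ∈ R).filter fun u => u.1.2 = y).card =
      (R.filter fun x => y < x).card := by
  refine Finset.card_bij (fun u _ => u.1.1) (fun u hu => ?_) (fun u hu v hv h => ?_) fun x hx => ?_
  · simp only [Finset.mem_filter, Finset.mem_univ, true_and] at hu ⊢
    exact ⟨hu.1, hu.2 ▸ (mem_cells.1 u.2).2.2⟩
  · simp only [Finset.mem_filter, Finset.mem_univ, true_and] at hu hv
    exact Subtype.ext (Prod.ext h (hu.2.trans hv.2.symm))
  · simp only [Finset.mem_filter] at hx
    exact ⟨⟨(x, y), mem_cells.2 ⟨hR hx.1, hy, hx.2⟩⟩, by simpa using hx.1, rfl⟩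

theorem col_mem_range_sdiff {M : ℕ} (hM : ∀ x ∈ B, x ≤ M) (u : cells B) :
    u.1.2 ∈ Finset.range M \ B := by
  have h := mem_cells.1 u.2
  rw [Finset.mem_sdiff, Finset.mem_range]
  exact ⟨lt_of_lt_of_le h.2.2 (hM _ h.1), h.2.1⟩

theorem card_rows_eq_sum {R : Finset ℕ} (hR : R ⊆ B) {M : ℕ} (hM : ∀ x ∈ B, x ≤ M) :
    (Finset.univ.filter fun u : cells B => u.1.1 ∈ R).card =
      ∑ y ∈ Finset.range M \ B, (R.filter fun x => y < x).card := by
  rw [Finset.card_eq_sum_card_fiberwise (f := fun u : cells B => u.1.2)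
    (fun u _ => col_mem_range_sdiff hM u)]
  exact Finset.sum_congr rfl fun y hy => card_cells_fiber hR (Finset.mem_sdiff.1 hy).2

theorem card_rows_eq_sum_image (σ : cells B ≃ cells C) (R : Finset ℕ) {M : ℕ}
    (hM : ∀ x ∈ C, x ≤ M) :
    (Finset.univ.filter fun u : cells B => u.1.1 ∈ R).card = ∑ y ∈ Finset.range M \ C,
      ((Finset.univ.filter fun u : cells B => u.1.1 ∈ R).filter fun u => (σ u).1.2 = y).card :=
  Finset.card_eq_sum_card_fiberwise (f := fun u : cells B => (σ u).1.2)
    (fun u _ => col_mem_range_sdiff hM (σ u))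

/-- If the cells of every row are moved to different columns, then every cell ends up in a column
that meets its row. -/
theorem col_lt_row (σ : cells B ≃ cells B)
    (hσ : ∀ i j : cells B, i.1.1 = j.1.1 → (σ i).1.2 = (σ j).1.2 → i = j) (u : cells B) :
    (σ u).1.2 < u.1.1 := by
  set y := (σ u).1.2 with hy
  have hM : ∀ x ∈ B, x ≤ B.sup id := fun x hx => Finset.le_sup (f := id) hx
  -- `R` consists of the rows that meet column `y`. Counting its cells by column before and after
  -- `σ`, no column can gain cells: columns from `y` on are bounded by their height, columns up to
  -- `y` by one cell per row. The totals agree, so equality holds in every column, in particular in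
  -- column `y`.
  set R := B.filter fun x => y < x with hR
  have hRB : R ⊆ B := Finset.filter_subset _ _
  have h1 := card_rows_eq_sum hRB hM
  rw [card_rows_eq_sum_image σ R hM] at h1
  have hle : ∀ z ∈ Finset.range (B.sup id) \ B,
      ((Finset.univ.filter fun u : cells B => u.1.1 ∈ R).filter fun u => (σ u).1.2 = z).card ≤
        (R.filter fun x => z < x).card := by
    intro z _
    rcases le_total y z with h | h
    · refine (card_fiber_le_card_col σ R z).trans (Finset.card_le_card fun x hx => ?_)
      simp only [hR, Finset.mem_filter] at hx ⊢
      exact ⟨⟨hx.1, h.trans_lt hx.2⟩, hx.2⟩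
    · refine (card_fiber_le_card_rows σ hσ R z).trans (Finset.card_le_card fun x hx => ?_)
      rw [Finset.mem_filter]
      refine ⟨hx, h.trans_lt ?_⟩
      exact (Finset.mem_filter.1 hx).2
  have h2 := (Finset.sum_eq_sum_iff_of_le hle).1 h1 y (col_mem_range_sdiff hM (σ u))
  have hRy : (R.filter fun x => y < x) = R := by simp [hR]
  rw [hRy] at h2
  have hyB : y ∉ B := (mem_cells.1 (σ u).2).2.1
  -- Column `y` has exactly as many cells as `R` has rows, so all cells arriving there come from
  -- rows in `R`.
  have h3 : (Finset.univ.filter fun u : cells B => (σ u).1.2 = y).card = R.card := by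
    have h4 := card_cells_fiber (Finset.Subset.refl B) hyB
    rw [← hR] at h4
    rw [← h4]
    refine Finset.card_bij (fun v _ => σ v) (fun v hv => ?_) (fun v _ w _ h => σ.injective h)
      fun v hv => ⟨σ.symm v, ?_, σ.apply_symm_apply v⟩
    · simp only [Finset.mem_filter, Finset.mem_univ, true_and] at hv ⊢
      exact ⟨(mem_cells.1 (σ v).2).1, hv⟩
    · simp only [Finset.mem_filter, Finset.mem_univ, true_and] at hv ⊢
      rw [Equiv.apply_symm_apply]
      exact hv.2
  have h5 : ((Finset.univ.filter fun u : cells B => u.1.1 ∈ R).filter fun u => (σ u).1.2 = y) =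
      Finset.univ.filter fun u : cells B => (σ u).1.2 = y :=
    Finset.eq_of_subset_of_card_le
      (Finset.filter_subset_filter _ (Finset.filter_subset _ _)) (by rw [h2, h3])
  have h6 : u ∈ Finset.univ.filter fun u : cells B => (σ u).1.2 = y := by simp [hy]
  rw [← h5] at h6
  simp only [Finset.mem_filter, Finset.mem_univ, true_and, hR] at h6
  exact h6.1.2

/-- Each cell is first slid within its row to the column prescribed by `σ`. By `col_lt_row` the new
position lies in the diagram, and by hypothesis no two cells collide. What remains of `σ` moves
cells within columns. -/
theorem exists_row_col_factorization (σ : Equiv.Perm (cells B))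
    (hσ : ∀ i j : cells B, i.1.1 = j.1.1 → (σ i).1.2 = (σ j).1.2 → i = j) :
    ∃ p s : Equiv.Perm (cells B), (∀ c, (p c).1.1 = c.1.1) ∧ (∀ c, (s c).1.2 = c.1.2) ∧
      σ = s * p := by
  let f : cells B → cells B := fun u => ⟨(u.1.1, (σ u).1.2),
    mem_cells.2 ⟨(mem_cells.1 u.2).1, (mem_cells.1 (σ u).2).2.1, col_lt_row σ hσ u⟩⟩
  have hf : Function.Injective f := fun u v h => by
    have h1 : (u.1.1, (σ u).1.2) = (v.1.1, (σ v).1.2) := congrArg Subtype.val h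
    exact hσ u v (Prod.ext_iff.1 h1).1 (Prod.ext_iff.1 h1).2
  let p : Equiv.Perm (cells B) := Equiv.ofBijective f (Finite.injective_iff_bijective.1 hf)
  refine ⟨p, σ * p⁻¹, fun c => rfl, fun c => ?_, by group⟩
  obtain ⟨u, rfl⟩ := p.surjective c
  rw [Equiv.Perm.mul_apply, Equiv.Perm.inv_apply_self']
  rfl

/-- For different diagrams of the same size, one of which is bigger in the first row where they
differ, two cells in a row are moved to the same column. -/
theorem exists_row_col (hcard : B.card = C.card) {m : ℕ} (hmB : m ∈ B) (hmC : m ∉ C)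
    (hm : ∀ x, m < x → (x ∈ B ↔ x ∈ C)) (σ : cells B ≃ cells C) :
    ∃ i j : cells B, i ≠ j ∧ i.1.1 = j.1.1 ∧ (σ i).1.2 = (σ j).1.2 := by
  by_contra hcon
  push Not at hcon
  have hσ : ∀ i j : cells B, i.1.1 = j.1.1 → (σ i).1.2 = (σ j).1.2 → i = j := fun i j h h' => by
    by_contra hij
    exact hcon i j hij h h'
  set M := (B ∪ C).sup id + 1 with hMdef
  have hMB : ∀ x ∈ B, x < M := fun x hx =>
    Nat.lt_succ_of_le (Finset.le_sup (f := id) (Finset.mem_union_left C hx))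
  have hMC : ∀ x ∈ C, x < M := fun x hx =>
    Nat.lt_succ_of_le (Finset.le_sup (f := id) (Finset.mem_union_right B hx))
  -- The cells in the rows from `m` up are counted by column before and after `σ`. Before, each gap
  -- of `B` below `m` accounts for `R.card` cells. After, the gaps of `C` below `m` account for at
  -- most `R.card` cells each, but there is one gap fewer, and column `m` of `C` holds only `R.card
  -- - 1` cells. The columns beyond `m` cannot make up for the deficit.
  set R := B.filter fun x => m ≤ x with hR
  have hRB : R ⊆ B := Finset.filter_subset _ _
  have h1 := card_rows_eq_sum hRB fun x hx => (hMB x hx).le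
  rw [card_rows_eq_sum_image σ R fun x hx => (hMC x hx).le] at h1
  have hRm : R = insert m (C.filter fun x => m < x) := by
    ext x
    simp only [hR, Finset.mem_filter, Finset.mem_insert]
    constructor
    · rintro ⟨h, h'⟩
      rcases h'.eq_or_lt with h' | h'
      · exact Or.inl h'.symm
      · exact Or.inr ⟨(hm x h').1 h, h'⟩
    · rintro (rfl | ⟨h, h'⟩)
      · exact ⟨hmB, le_rfl⟩
      · exact ⟨(hm x h').2 h, h'.le⟩
  have hRk : R.card = (C.filter fun x => m < x).card + 1 := by
    rw [hRm, Finset.card_insert_of_notMem (by simp)]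
  -- the columns are split at `m`
  have hsplit : ∀ (D : Finset ℕ) (f : ℕ → ℕ), ∑ y ∈ Finset.range M \ D, f y =
      ∑ y ∈ Finset.range m \ D, f y + (if m ∈ D then 0 else f m) +
        ∑ y ∈ Finset.Ico (m + 1) M \ D, f y := by
    intro D f
    have hu : Finset.range M = (Finset.range m ∪ {m}) ∪ Finset.Ico (m + 1) M := by
      have := hMB m hmB
      ext x
      simp only [Finset.mem_range, Finset.mem_union, Finset.mem_singleton, Finset.mem_Ico]
      omega
    rw [hu, Finset.union_sdiff_distrib, Finset.union_sdiff_distrib, Finset.sum_union,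
      Finset.sum_union]
    · congr 2
      split_ifs with h
      · rw [Finset.sdiff_eq_empty_iff_subset.2 (by simpa using h), Finset.sum_empty]
      · rw [Finset.sdiff_eq_self_of_disjoint (by simpa using h), Finset.sum_singleton]
    · rw [Finset.disjoint_left]
      intro x hx hx'
      simp only [Finset.mem_sdiff, Finset.mem_range, Finset.mem_singleton] at hx hx'
      omega
    · rw [Finset.disjoint_left]
      intro x hx hx'
      simp only [Finset.mem_sdiff, Finset.mem_range, Finset.mem_singleton, Finset.mem_union,
        Finset.mem_Ico] at hx hx'
      omega
  have hIco : Finset.Ico (m + 1) M \ B = Finset.Ico (m + 1) M \ C := by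
    ext x
    simp only [Finset.mem_sdiff, Finset.mem_Ico]
    refine and_congr_right fun h => not_congr (hm x (by omega))
  rw [hsplit, hsplit, if_neg hmC, if_pos hmB, hIco] at h1
  have e1 : ∑ y ∈ Finset.range m \ B, (R.filter fun x => y < x).card =
      (Finset.range m \ B).card * R.card := by
    rw [Finset.sum_const_nat]
    intro y hy
    congr 1
    rw [Finset.filter_eq_self]
    intro x hx
    simp only [Finset.mem_sdiff, Finset.mem_range, hR, Finset.mem_filter] at hx hy
    omega
  have e2 : ∑ y ∈ Finset.range m \ C, ((Finset.univ.filter fun u : cells B =>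
      u.1.1 ∈ R).filter fun u => (σ u).1.2 = y).card ≤ (Finset.range m \ C).card * R.card := by
    rw [← smul_eq_mul]
    exact Finset.sum_le_card_nsmul _ _ _ fun y _ => card_fiber_le_card_rows σ hσ R y
  have e3 := card_fiber_le_card_col σ R m
  have e4 : ∑ y ∈ Finset.Ico (m + 1) M \ C, ((Finset.univ.filter fun u : cells B =>
      u.1.1 ∈ R).filter fun u => (σ u).1.2 = y).card ≤
      ∑ y ∈ Finset.Ico (m + 1) M \ C, (R.filter fun x => y < x).card := by
    refine Finset.sum_le_sum fun y hy => (card_fiber_le_card_col σ R y).trans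
      (Finset.card_le_card fun x hx => ?_)
    simp only [Finset.mem_sdiff, Finset.mem_Ico, hR, Finset.mem_filter] at hx hy ⊢
    exact ⟨⟨(hm x (by omega)).2 hx.1, by omega⟩, hx.2⟩
  have hcB : (B.filter fun x => x < m).card + R.card = B.card := by
    rw [hR]
    simp only [← not_lt]
    exact Finset.card_filter_add_card_filter_not _
  have hcC : (C.filter fun x => x < m).card + (C.filter fun x => m < x).card = C.card := by
    rw [← Finset.card_filter_add_card_filter_not (s := C) (fun x => x < m)]
    congr 2
    refine Finset.filter_congr fun x hx => ?_
    have : x ≠ m := fun h => hmC (h ▸ hx)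
    omega
  have hrange : ∀ D : Finset ℕ, (Finset.range m \ D).card + (D.filter fun x => x < m).card = m := by
    intro D
    have : D.filter (fun x => x < m) = Finset.range m ∩ D := by
      ext x
      simp [and_comm]
    rw [this, Finset.card_sdiff_add_card_inter, Finset.card_range]
  have hB := hrange B
  have hC := hrange C
  -- The sets have equal size and agree above `m`, while only `B` contains `m`; hence `C` has one
  -- more element below `m`.
  have hk : (Finset.range m \ B).card = (Finset.range m \ C).card + 1 := by omega
  rw [e1, hk, add_mul, one_mul] at h1
  omega

end Counting

end BetaSet

end

/-! ### Specht characters: irreducibility, orthogonality and completeness. -/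

noncomputable section

open Representation

namespace BetaSet

/-- A numbering of the cells of a diagram. -/
def cellEquiv {n : ℕ} (B : Finset ℕ) (h : rank B = n) : cells B ≃ Fin n :=
  (cells B).equivFinOfCardEq ((card_cells B).trans h)

/-- The row of the cell with a given number. -/
def rowFun {n : ℕ} (B : Finset ℕ) (h : rank B = n) (i : Fin n) : ℕ := ((cellEquiv B h).symm i).1.1

/-- The column of the cell with a given number. -/
def colFun {n : ℕ} (B : Finset ℕ) (h : rank B = n) (i : Fin n) : ℕ := ((cellEquiv B h).symm i).1.2

variable {K : Type*} [Field K] {n : ℕ}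

/-- Only the partitions of the cells into rows and columns matter, so Specht modules of different
β-sets can be compared within the group algebra of one symmetric group. -/
theorem character_spechtRep (B : Finset ℕ) (x : Equiv.Perm (cells B)) {α : Type*} [Fintype α]
    (e : cells B ≃ α) (r q : α → ℕ) (hr : ∀ c d, r (e c) = r (e d) ↔ c.1.1 = d.1.1)
    (hq : ∀ c d, q (e c) = q (e d) ↔ c.1.2 = d.1.2) :
    (spechtRep K B).character x = (leftIdealRep (youngSym K r q)).character (e.permCongr x) := by
  have h0 : youngSymmetrizer K B =
      youngSym K (fun c : cells B => c.1.1) (fun c : cells B => c.1.2) := by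
    unfold youngSymmetrizer youngSym
    congr!
  have h1 : youngSymmetrizer K B = youngSym K (r ∘ e) (q ∘ e) :=
    h0.trans (youngSym_congr (fun c d => (hr c d).symm) (fun c d => (hq c d).symm))
  have h2 : (spechtRep K B).character x = (leftIdealRep (youngSymmetrizer K B)).character x := rfl
  rw [h2, h1, ← domCongr_youngSym e]
  exact (leftIdealRep_character_domCongr _ _ _).symm

theorem symChar_eq (B : Finset ℕ) (h : rank B = n) :
    symChar K B h = (leftIdealRep (youngSym K (rowFun B h) (colFun B h))).character := by
  ext σ
  rw [symChar, character_spechtRep B _ (cellEquiv B h) (rowFun B h) (colFun B h)]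
  · congr 1
    exact (cellEquiv B h).permCongr.apply_symm_apply σ
  · simp [rowFun]
  · simp [colFun]

theorem rowFun_colFun_injective (B : Finset ℕ) (h : rank B = n) (i j : Fin n)
    (hr : rowFun B h i = rowFun B h j) (hc : colFun B h i = colFun B h j) : i = j :=
  (cellEquiv B h).symm.injective (Subtype.ext (Prod.ext hr hc))

variable [CharZero K]

theorem leftIdealRep_youngSym_isIrreducible (B : Finset ℕ) (h : rank B = n) :
    (leftIdealRep (youngSym K (rowFun B h) (colFun B h))).IsIrreducible := by
  refine leftIdealRep_isIrreducible
    (youngSym_ne_zero (rowFun_colFun_injective B h)) (youngSym_mul_mul_self fun x => ?_)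
  let e := cellEquiv B h
  let σ : Equiv.Perm (cells B) := e.symm.permCongr x
  by_cases hσ : ∀ i j : cells B, i.1.1 = j.1.1 → (σ i).1.2 = (σ j).1.2 → i = j
  · right
    obtain ⟨p, s, hp, hs, hps⟩ := exists_row_col_factorization σ hσ
    refine ⟨e.permCongr p, e.permCongr s, fun c => ?_, fun c => ?_, ?_⟩
    · simpa [rowFun, e] using hp (e.symm c)
    · simpa [colFun, e] using hs (e.symm c)
    · have : x = e.permCongr σ := (e.permCongr.apply_symm_apply x).symm
      rw [this, hps]
      exact map_mul e.permCongrHom s p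
  · left
    push Not at hσ
    obtain ⟨i, j, hr, hc, hij⟩ := hσ
    refine ⟨e i, e j, e.injective.ne hij, ?_, ?_⟩
    · simpa [rowFun, e] using hr
    · simpa [colFun, e, σ] using hc

theorem symChar_isIrrChar (B : Finset ℕ) (h : rank B = n) : IsIrrChar (symChar K B h) := by
  rw [symChar_eq]
  exact IsIrrChar.of_rep _ (leftIdealRep_youngSym_isIrreducible B h)

theorem symChar_isClassFun (B : Finset ℕ) (h : rank B = n) : IsClassFun (symChar K B h) :=
  (symChar_isIrrChar B h).isChar.isClassFun

theorem symChar_isChar (B : Finset ℕ) (h : rank B = n) : IsChar (symChar K B h) :=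
  (symChar_isIrrChar B h).isChar

/-- By symmetry the largest element where the sets differ may be assumed to lie in `B`. Then
`exists_row_col` makes every product of the two symmetrizers, with any element in between, vanish,
so the modules are not isomorphic. Equal cardinality is essential, as shifted β-sets have the same
character. -/
theorem charInner_symChar_eq_zero [IsAlgClosed K] {B C : Finset ℕ} (hB : rank B = n)
    (hC : rank C = n) (hcard : B.card = C.card) (hne : B ≠ C) :
    charInner (symChar K B hB) (symChar K C hC) = 0 := by
  wlog hm : ∃ m ∈ B, m ∉ C ∧ ∀ x, m < x → (x ∈ B ↔ x ∈ C) generalizing B C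
  · have hsd : ((B \ C) ∪ (C \ B)).Nonempty := by
      rw [Finset.nonempty_iff_ne_empty]
      intro h
      rw [Finset.union_eq_empty, Finset.sdiff_eq_empty_iff_subset,
        Finset.sdiff_eq_empty_iff_subset] at h
      exact hne (h.1.antisymm h.2)
    have hmax := Finset.max'_mem _ hsd
    have hgt : ∀ x, ((B \ C) ∪ (C \ B)).max' hsd < x → (x ∈ B ↔ x ∈ C) := by
      intro x hx
      by_contra hcon
      refine absurd (Finset.le_max' _ x ?_) (not_le.2 hx)
      rw [Finset.mem_union, Finset.mem_sdiff, Finset.mem_sdiff]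
      tauto
    rw [Finset.mem_union, Finset.mem_sdiff, Finset.mem_sdiff] at hmax
    rw [charInner_comm]
    refine this hC hB hcard.symm hne.symm ?_
    rcases hmax with h | h
    · exact absurd ⟨_, h.1, h.2, hgt⟩ hm
    · exact ⟨_, h.1, h.2, fun x hx => (hgt x hx).symm⟩
  obtain ⟨m, hmB, hmC, hm⟩ := hm
  have h0 : IsEmpty (Representation.Equiv (leftIdealRep (youngSym K (rowFun B hB) (colFun B hB)))
      (leftIdealRep (youngSym K (rowFun C hC) (colFun C hC)))) := by
    refine leftIdealRep_isEmpty_equiv (youngSym_ne_zero (rowFun_colFun_injective B hB))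
      (youngSym_mul_mul_eq_zero fun x => ?_)
    obtain ⟨i, j, hij, hr, hc⟩ := exists_row_col hcard hmB hmC hm
      (((cellEquiv B hB).trans x).trans (cellEquiv C hC).symm)
    refine ⟨cellEquiv B hB i, cellEquiv B hB j, (cellEquiv B hB).injective.ne hij, ?_, ?_⟩
    · simpa [rowFun] using hr
    · simpa [colFun] using hc
  have := leftIdealRep_youngSym_isIrreducible (K := K) B hB
  have := leftIdealRep_youngSym_isIrreducible (K := K) C hC
  have : Invertible (Nat.card (Equiv.Perm (Fin n)) : K) :=
    invertibleOfNonzero (Nat.cast_ne_zero.2 Nat.card_pos.ne')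
  rw [charInner_comm, symChar_eq, symChar_eq]
  refine (char_orthonormal _ _).trans (if_neg ?_)
  rwa [not_nonempty_iff]

theorem mem_cells_shift {k : ℕ} {B : Finset ℕ} {x y : ℕ} :
    (x, y) ∈ cells (shift k B) ↔ ∃ z w, (z, w) ∈ cells B ∧ x = z + k ∧ y = w + k := by
  simp only [mem_cells, shift, Finset.mem_union, Finset.mem_range, Finset.mem_image]
  constructor
  · rintro ⟨h | ⟨z, hz, rfl⟩, h2, h3⟩
    · omega
    · push Not at h2
      refine ⟨z, y - k, ⟨hz, fun h => h2.2 _ h (by omega), by omega⟩, rfl, by omega⟩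
  · rintro ⟨z, w, ⟨hz, hw, hlt⟩, rfl, rfl⟩
    refine ⟨Or.inr ⟨z, hz, rfl⟩, ?_, by omega⟩
    rintro (h | ⟨v, hv, h⟩)
    · omega
    · have : v = w := by omega
      exact hw (this ▸ hv)

/-- The cells of a shifted β-set. -/
def cellsShiftEquiv (k : ℕ) (B : Finset ℕ) : cells B ≃ cells (shift k B) :=
  Equiv.ofBijective
    (fun c => ⟨(c.1.1 + k, c.1.2 + k), mem_cells_shift.2 ⟨_, _, c.2, rfl, rfl⟩⟩) <| by
    constructor
    · intro c d h
      have h1 : (c.1.1 + k, c.1.2 + k) = (d.1.1 + k, d.1.2 + k) := congrArg Subtype.val h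
      rw [Prod.mk.injEq] at h1
      exact Subtype.ext (Prod.ext (by omega) (by omega))
    · rintro ⟨⟨x, y⟩, h⟩
      obtain ⟨z, w, hzw, rfl, rfl⟩ := mem_cells_shift.1 h
      exact ⟨⟨(z, w), hzw⟩, rfl⟩

theorem rank_shift (k : ℕ) (B : Finset ℕ) : rank (shift k B) = rank B := by
  rw [← card_cells, ← card_cells]
  simpa using (Fintype.card_congr (cellsShiftEquiv k B)).symm

theorem card_shift (k : ℕ) (B : Finset ℕ) : (shift k B).card = k + B.card := by
  rw [shift, Finset.card_union_of_disjoint, Finset.card_range, Finset.card_image_of_injective]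
  · exact add_left_injective k
  · rw [Finset.disjoint_left]
    intro x hx hx'
    rw [Finset.mem_range] at hx
    obtain ⟨y, -, rfl⟩ := Finset.mem_image.1 hx'
    omega

omit [CharZero K] in
-- A shift translates all cells by `(k, k)` and leaves the relations of sharing a row or column
-- unchanged; the numberings of the cells differ only by a conjugation.
theorem symChar_shift (k : ℕ) (B : Finset ℕ) (h : rank B = n) (h' : rank (shift k B) = n) :
    symChar K (shift k B) h' = symChar K B h := by
  ext σ
  let e := cellsShiftEquiv k B
  let f := cellEquiv (shift k B) h'
  rw [symChar_eq]
  have hval : ∀ c, (e c).1 = (c.1.1 + k, c.1.2 + k) := fun _ => rfl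
  have h2 := character_spechtRep (K := K) B ((e.trans f).symm.permCongr σ) (e.trans f)
    (rowFun _ h') (colFun _ h')
    (fun c d => by simp [rowFun, f, hval])
    (fun c d => by simp [colFun, f, hval])
  have h3 : (e.trans f).permCongr ((e.trans f).symm.permCongr σ) = σ :=
    (e.trans f).permCongr.apply_symm_apply σ
  rw [h3] at h2
  rw [← h2]
  have h4 := (char_conj (spechtRep K B) ((e.trans f).symm.permCongr σ)
    ((e.trans f).trans (cellEquiv B h).symm))
  rw [← h4, symChar]
  congr 1
  refine Equiv.ext fun c => ?_
  change _ = (cellEquiv B h).symm.permCongr σ c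
  simp [Equiv.Perm.mul_apply, Equiv.Perm.inv_def, Equiv.permCongr_apply]

/-- The β-set of the partition given by a list of numbers in increasing order. -/
def ofList : List ℕ → Finset ℕ
  | [] => ∅
  | x :: l => insert x ((ofList l).image (· + 1))

theorem le_of_mem_ofList {x : ℕ} : ∀ {l : List ℕ}, (∀ y ∈ l, x ≤ y) → ∀ z ∈ ofList l, x ≤ z
  | [], _, z, hz => by simp [ofList] at hz
  | y :: l, h, z, hz => by
    rw [ofList, Finset.mem_insert, Finset.mem_image] at hz
    rcases hz with rfl | ⟨w, hw, rfl⟩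
    · exact h _ (by simp)
    · exact (le_of_mem_ofList (fun y hy => h y (by simp [hy])) w hw).trans (Nat.le_succ w)

theorem notMem_image_ofList {x : ℕ} {l : List ℕ} (h : ∀ y ∈ l, x ≤ y) :
    x ∉ (ofList l).image (· + 1) := by
  intro hx
  obtain ⟨w, hw, h'⟩ := Finset.mem_image.1 hx
  have := le_of_mem_ofList h w hw
  omega

theorem card_ofList : ∀ {l : List ℕ}, l.Pairwise (· ≤ ·) → (ofList l).card = l.length
  | [], _ => by simp [ofList]
  | x :: l, h => by
    rw [List.pairwise_cons] at h
    rw [ofList, Finset.card_insert_of_notMem (notMem_image_ofList h.1),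
      Finset.card_image_of_injective _ (add_left_injective 1), card_ofList h.2, List.length_cons]

theorem sum_ofList : ∀ {l : List ℕ}, l.Pairwise (· ≤ ·) →
    ∑ x ∈ ofList l, x = l.sum + l.length.choose 2
  | [], _ => by simp [ofList]
  | x :: l, h => by
    rw [List.pairwise_cons] at h
    rw [ofList, Finset.sum_insert (notMem_image_ofList h.1),
      Finset.sum_image fun y _ z _ h => add_left_injective 1 h, Finset.sum_add_distrib,
      sum_ofList h.2, Finset.sum_const, card_ofList h.2, List.sum_cons, List.length_cons,
      Nat.choose_succ_succ' l.length 1, Nat.choose_one_right, smul_eq_mul, mul_one]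
    simp only [Nat.reduceAdd]
    omega

theorem rank_ofList {l : List ℕ} (h : l.Pairwise (· ≤ ·)) : rank (ofList l) = l.sum := by
  have h1 := rank_add_choose (ofList l)
  rw [sum_ofList h, card_ofList h] at h1
  omega

theorem ofList_injective : ∀ {l l' : List ℕ}, l.Pairwise (· ≤ ·) → l'.Pairwise (· ≤ ·) →
    ofList l = ofList l' → l = l'
  | [], [], _, _, _ => rfl
  | [], y :: l', _, _, h => absurd h.symm (by simp [ofList])
  | x :: l, [], _, _, h => by simp [ofList] at h
  | x :: l, y :: l', hl, hl', h => by
    rw [List.pairwise_cons] at hl hl'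
    have hx : x ∈ ofList (y :: l') := h ▸ Finset.mem_insert_self _ _
    have hy : y ∈ ofList (x :: l) := h ▸ Finset.mem_insert_self _ _
    have h1 : x ≤ y := le_of_mem_ofList (by simpa using hl.1) y hy
    have h2 : y ≤ x := le_of_mem_ofList (by simpa using hl'.1) x hx
    obtain rfl := h1.antisymm h2
    have h3 := congrArg (fun s => s.erase x) h
    simp only [ofList, Finset.erase_insert (notMem_image_ofList hl.1),
      Finset.erase_insert (notMem_image_ofList hl'.1)] at h3
    rw [ofList_injective hl.2 hl'.2 (Finset.image_injective (add_left_injective 1) h3)]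

/-- The β-sets of rank `n` with `N` elements. -/
abbrev OfRank (n N : ℕ) : Type := {B : Finset ℕ // B.card = N ∧ rank B = n}

instance (n N : ℕ) : Finite (OfRank n N) :=
  Finite.of_injective
    (fun B : OfRank n N => (⟨B.1, Finset.mem_powerset.2 fun x hx => by
      have := le_rank_add_card hx
      rw [B.2.1, B.2.2] at this
      exact Finset.mem_range.2 (Nat.lt_succ_of_le this)⟩ : (Finset.range (n + N + 1)).powerset))
    fun B C h => Subtype.ext (congrArg (fun x => x.1) h)

instance (n N : ℕ) : Fintype (OfRank n N) := Fintype.ofFinite _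

/-- A partition of `n` has at most `n` parts, so it can be padded with zeros to exactly `N` parts
and turned into a β-set. -/
theorem card_partition_le {n N : ℕ} (h : n ≤ N) :
    Fintype.card n.Partition ≤ Fintype.card (OfRank n N) := by
  have hcard : ∀ p : n.Partition, p.parts.card ≤ N := by
    intro p
    have h1 := Multiset.card_nsmul_le_sum (s := p.parts) (a := 1) fun x hx => p.parts_pos hx
    rw [p.parts_sum, smul_eq_mul, mul_one] at h1
    exact h1.trans h
  let L : n.Partition → List ℕ := fun p =>
    (p.parts + Multiset.replicate (N - p.parts.card) 0).sort (· ≤ ·)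
  have hL : ∀ p, (L p).Pairwise (· ≤ ·) := fun p => Multiset.pairwise_sort _ _
  refine Fintype.card_le_of_injective (fun p => ⟨ofList (L p), ?_, ?_⟩) fun p p' h => ?_
  · rw [card_ofList (hL p), Multiset.length_sort, Multiset.card_add, Multiset.card_replicate]
    have := hcard p
    omega
  · rw [rank_ofList (hL p), ← Multiset.sum_coe, Multiset.sort_eq]
    simp [p.parts_sum]
  · have h1 := ofList_injective (hL p) (hL p') (congrArg Subtype.val h)
    have h2 : ∀ p, ((L p : List ℕ) : Multiset ℕ).filter (· ≠ 0) = p.parts := by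
      intro p
      rw [Multiset.sort_eq, Multiset.filter_add, Multiset.filter_eq_self.2 fun x hx =>
        (p.parts_pos hx).ne', Multiset.filter_eq_nil.2, add_zero]
      intro x hx
      simp [Multiset.eq_of_mem_replicate hx]
    exact Nat.Partition.ext (by rw [← h2 p, h1, h2])

end BetaSet

/-- The space of class functions. -/
def classFuns (K G : Type*) [Field K] [Group G] : Submodule K (G → K) where
  carrier := {f | IsClassFun f}
  add_mem' hf hg x y := by simp only [Pi.add_apply]; rw [hf, hg]
  zero_mem' _ _ := rfl
  smul_mem' c f hf x y := by simp only [Pi.smul_apply]; rw [hf]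

/-- A class function on a symmetric group is determined by its values on cycle types. -/
theorem finrank_classFuns_perm_le (K : Type*) [Field K] (n : ℕ) :
    Module.finrank K (classFuns K (Equiv.Perm (Fin n))) ≤ Fintype.card n.Partition := by
  classical
  let part : Equiv.Perm (Fin n) → (Fintype.card (Fin n)).Partition := Equiv.Perm.partition
  let T : classFuns K (Equiv.Perm (Fin n)) →ₗ[K] ((Fintype.card (Fin n)).Partition → K) :=
    (LinearMap.funLeft K K (Function.invFun part)).comp (Submodule.subtype _)
  have hT : Function.Injective T := by
    intro f f' h
    refine Subtype.ext (funext fun σ => ?_)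
    have hσ := congrFun h (part σ)
    have h1 : part (Function.invFun part (part σ)) = part σ := Function.invFun_eq ⟨σ, rfl⟩
    obtain ⟨x, hx⟩ := isConj_iff.1 (Equiv.Perm.partition_eq_of_isConj.2 h1)
    have h2 : ∀ f : classFuns K (Equiv.Perm (Fin n)), f.1 σ = T f (part σ) := fun f => by
      have h3 := IsClassFun.conj' f.2 x (Function.invFun part (part σ))
      rw [hx] at h3
      exact h3
    rw [h2, h2, hσ]
  have := LinearMap.finrank_le_finrank_of_injective hT
  rw [Module.finrank_fintype_fun_eq_card] at this
  convert! this
  simp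

/-- The Specht characters are orthonormal, hence independent, and there are at least as many of them
as partitions, whose number bounds the dimension of the space of class functions. -/
theorem BetaSet.mem_span_symChar {K : Type*} [Field K] [CharZero K] [IsAlgClosed K] {n N : ℕ}
    (h : n ≤ N) {φ : Equiv.Perm (Fin n) → K} (hφ : IsClassFun φ) :
    φ ∈ Submodule.span K (Set.range fun B : BetaSet.OfRank n N => BetaSet.symChar K B.1 B.2.2) := by
  classical
  set v := fun B : BetaSet.OfRank n N => BetaSet.symChar K B.1 B.2.2 with hv
  have hvv : ∀ B C, charInner (v B) (v C) = if B = C then 1 else 0 := by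
    intro B C
    split_ifs with hBC
    · subst hBC
      exact (BetaSet.symChar_isIrrChar _ _).charInner_self
    · exact BetaSet.charInner_symChar_eq_zero _ _ (B.2.1.trans C.2.1.symm)
        fun h => hBC (Subtype.ext h)
  have hlin : LinearIndependent K v := by
    rw [Fintype.linearIndependent_iff]
    intro g hg B
    have h1 : charForm K _ (∑ C, g C • v C) (v B) = 0 := by rw [hg, map_zero]; rfl
    rw [map_sum, LinearMap.sum_apply] at h1
    simpa [charForm_apply, hvv] using h1
  have hle : Submodule.span K (Set.range v) ≤ classFuns K (Equiv.Perm (Fin n)) := by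
    rw [Submodule.span_le]
    rintro _ ⟨B, rfl⟩
    exact BetaSet.symChar_isClassFun _ _
  have heq := Submodule.eq_of_le_of_finrank_le hle (by
    rw [finrank_span_eq_card hlin]
    exact (finrank_classFuns_perm_le K n).trans (BetaSet.card_partition_le h))
  rw [heq]
  exact hφ

end

noncomputable section

/-! ### A Mackey formula for scalar products of induced class functions. -/

section Mackey

variable {K : Type*} [Field K] [CharZero K] {G H H' : Type*} [Group G] [Fintype G] [Group H]
  [Fintype H] [Group H'] [Fintype H']

open Classical in
/-- The contribution of `x ∈ G` to the scalar product of two induced class functions. -/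
def mackeyTerm (f : H →* G) (f' : H' →* G) (χ : H → K) (χ' : H' → K) (x : G) : K :=
  ∑ h : H, χ h * ∑ h' : H', if f' h' = x⁻¹ * (f h)⁻¹ * x then χ' h' else 0

theorem charInner_indChar_indChar (f : H →* G) (f' : H' →* G) (χ : H → K) (χ' : H' → K) :
    charInner (indChar f χ) (indChar f' χ') =
      (Nat.card H : K)⁻¹ * (Nat.card H' : K)⁻¹ * ∑ x, mackeyTerm f f' χ χ' x := by
  classical
  rw [charInner_indChar f χ (indChar_isClassFun f' χ')]
  simp only [charInner, Function.comp_apply, indChar, mackeyTerm, map_inv]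
  rw [mul_assoc]
  congr 1
  rw [Finset.sum_comm, Finset.mul_sum]
  refine Finset.sum_congr rfl fun h _ => ?_
  rw [← Finset.mul_sum, mul_left_comm]

omit [CharZero K] [Fintype G] in
-- Translating both summation variables by the matching elements `k` and `k'` preserves the
-- condition in the sum but multiplies the value by `c * c'`.
theorem mackeyTerm_eq_zero (f : H →* G) (f' : H' →* G) (χ : H → K) (χ' : H' → K) (x : G) (k : H)
    (k' : H') (hk : f k = x * f' k' * x⁻¹) (c c' : K) (hχ : ∀ h, χ (k * h) = c * χ h)
    (hχ' : ∀ h, χ' (h * k'⁻¹) = c' * χ' h) (hc : c * c' ≠ 1) : mackeyTerm f f' χ χ' x = 0 := by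
  classical
  have h1 : mackeyTerm f f' χ χ' x = c * c' * mackeyTerm f f' χ χ' x := by
    conv_lhs => unfold mackeyTerm
    rw [← Equiv.sum_comp (Equiv.mulLeft k), mackeyTerm, Finset.mul_sum]
    refine Finset.sum_congr rfl fun h _ => ?_
    rw [Equiv.coe_mulLeft, hχ, mul_mul_mul_comm]
    congr 1
    rw [← Equiv.sum_comp (Equiv.mulRight k'⁻¹), Finset.mul_sum]
    refine Finset.sum_congr rfl fun h' _ => ?_
    rw [Equiv.coe_mulRight, hχ', mul_ite, mul_zero]
    refine if_congr ?_ rfl rfl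
    rw [map_mul, map_mul, map_inv, mul_inv_eq_iff_eq_mul, hk]
    have : x⁻¹ * (x * f' k' * x⁻¹ * f h)⁻¹ * x * f' k' = x⁻¹ * (f h)⁻¹ * x := by group
    rw [this]
  by_contra hne
  exact hc (mul_right_cancel₀ hne (h1.symm.trans (one_mul _).symm))

omit [CharZero K] [Fintype G] in
theorem mackeyTerm_of_mem_range (f : H →* G) (hf : Function.Injective f) (χ χ' : H → K)
    (hχ' : IsClassFun χ') (k : H) :
    mackeyTerm f f χ χ' (f k) = ∑ h, χ h * χ' h⁻¹ := by
  classical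
  refine Finset.sum_congr rfl fun h _ => ?_
  congr 1
  rw [Finset.sum_eq_single (k⁻¹ * h⁻¹ * k)]
  · rw [if_pos (by simp), hχ'.conj]
  · intro h' _ hne
    rw [if_neg]
    intro h1
    exact hne (hf (by rw [h1]; simp))
  · simp

/-- A criterion for induction to preserve scalar products. -/
theorem charInner_indChar_eq (f : H →* G) (hf : Function.Injective f) (χ χ' : H → K)
    (hχ' : IsClassFun χ') (h : ∀ x, x ∉ Set.range f → mackeyTerm f f χ χ' x = 0) :
    charInner (indChar f χ) (indChar f χ') = charInner χ χ' := by
  classical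
  have hH : (Nat.card H : K) ≠ 0 := Nat.cast_ne_zero.2 Nat.card_pos.ne'
  rw [charInner_indChar_indChar, charInner, mul_assoc]
  congr 1
  rw [← Finset.sum_subset (Finset.subset_univ (Finset.univ.map ⟨f, hf⟩)), Finset.sum_map]
  · simp only [Function.Embedding.coeFn_mk, mackeyTerm_of_mem_range f hf χ χ' hχ',
      Finset.sum_const, Finset.card_univ, nsmul_eq_mul, ← Nat.card_eq_fintype_card]
    rw [inv_mul_cancel_left₀ hH]
  · intro x _ hx
    exact h x fun ⟨k, hk⟩ => hx (by simpa using ⟨k, hk⟩)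

end Mackey

/-! ### Block diagonal signed permutations and diagonal sign changes. -/

section SignedBlock

variable {α β ι : Type*}

@[simp]
theorem symBlock_apply_inl (e : α ⊕ β ≃ ι) (p : Equiv.Perm α × Equiv.Perm β) (a : α) :
    symBlock e p (e (Sum.inl a)) = e (Sum.inl (p.1 a)) := by
  simp [symBlock, Equiv.permCongrHom]

@[simp]
theorem symBlock_apply_inr (e : α ⊕ β ≃ ι) (p : Equiv.Perm α × Equiv.Perm β) (b : β) :
    symBlock e p (e (Sum.inr b)) = e (Sum.inr (p.2 b)) := by
  simp [symBlock, Equiv.permCongrHom]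

@[simp]
theorem signedBlock_left_inl (e : α ⊕ β ≃ ι) (p : SignedPerm α × SignedPerm β) (a : α) :
    (signedBlock e p).left (e (Sum.inl a)) = p.1.left a := by
  simp [signedBlock]

@[simp]
theorem signedBlock_left_inr (e : α ⊕ β ≃ ι) (p : SignedPerm α × SignedPerm β) (b : β) :
    (signedBlock e p).left (e (Sum.inr b)) = p.2.left b := by
  simp [signedBlock]

@[simp]
theorem signedBlock_right (e : α ⊕ β ≃ ι) (p : SignedPerm α × SignedPerm β) :
    (signedBlock e p).right = symBlock e (p.1.right, p.2.right) := rfl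

theorem SignedPerm.ext' {g h : SignedPerm ι} (h1 : ∀ i, g.left i = h.left i)
    (h2 : ∀ i, g.right i = h.right i) : g = h :=
  SemidirectProduct.ext (funext h1) (Equiv.ext h2)

theorem symBlock_injective (e : α ⊕ β ≃ ι) : Function.Injective (symBlock e) := by
  intro p p' h
  refine Prod.ext (Equiv.ext fun a => ?_) (Equiv.ext fun b => ?_)
  · have := congrArg (fun s : Equiv.Perm ι => s (e (Sum.inl a))) h
    simpa using this
  · have := congrArg (fun s : Equiv.Perm ι => s (e (Sum.inr b))) h
    simpa using this

theorem signedBlock_injective (e : α ⊕ β ≃ ι) : Function.Injective (signedBlock e) := by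
  intro p p' h
  have h2 := symBlock_injective e (congrArg SemidirectProduct.right h)
  rw [Prod.mk.injEq] at h2
  refine Prod.ext (SemidirectProduct.ext (funext fun a => ?_) h2.1)
    (SemidirectProduct.ext (funext fun b => ?_) h2.2)
  · have := congrArg (fun s : SignedPerm ι => s.left (e (Sum.inl a))) h
    simpa using this
  · have := congrArg (fun s : SignedPerm ι => s.left (e (Sum.inr b))) h
    simpa using this

/-- Signs are unrestricted within blocks, so being block diagonal is a condition on the underlying
permutation; by finiteness it suffices that the first block is mapped to itself. -/
theorem exists_inl_of_notMem_range [Finite α] [Finite β] (e : α ⊕ β ≃ ι) {x : SignedPerm ι}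
    (hx : x ∉ Set.range (signedBlock e)) :
    ∃ a b, x.right (e (Sum.inl a)) = e (Sum.inr b) := by
  by_contra hcon
  push Not at hcon
  apply hx
  have h1 : e.permCongr.symm x.right ∈ (Equiv.Perm.sumCongrHom α β).range := by
    refine Equiv.Perm.mem_sumCongrHom_range_of_perm_mapsTo_inl ?_
    rintro _ ⟨a, rfl⟩
    rcases h : e.permCongr.symm x.right (Sum.inl a) with a' | b
    · exact ⟨a', rfl⟩
    · refine absurd ?_ (hcon a b)
      rw [← h]
      simp
  obtain ⟨p, hp⟩ := h1
  have hp' : symBlock e p = x.right := by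
    change e.permCongr (Equiv.Perm.sumCongrHom α β p) = _
    rw [hp, Equiv.apply_symm_apply]
  refine ⟨(⟨fun a => x.left (e (Sum.inl a)), p.1⟩, ⟨fun b => x.left (e (Sum.inr b)), p.2⟩), ?_⟩
  refine SemidirectProduct.ext (funext fun i => ?_) hp'
  obtain ⟨a | b, rfl⟩ := e.surjective i
  · simp
  · simp

/-- The diagonal matrix with one entry `-1`. -/
def SignedPerm.diag [DecidableEq ι] (i : ι) : SignedPerm ι := ⟨Pi.mulSingle i (-1), 1⟩

theorem SignedPerm.conj_left (x g : SignedPerm ι) (hg : g.right = 1) (i : ι) :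
    (x * g * x⁻¹).left i = g.left (x.right⁻¹ i) := by
  have h1 : (x * g * x⁻¹) * x = x * g := by group
  have h2 := congrArg (fun s : SignedPerm ι => s.left i) h1
  have h3 : (x * g * x⁻¹).right = 1 := by simp [hg]
  rw [SignedPerm.mul_left_apply, SignedPerm.mul_left_apply x g, h3, inv_one,
    Equiv.Perm.one_apply] at h2
  rw [mul_comm (x.left i) (g.left _)] at h2
  exact mul_right_cancel h2

theorem SignedPerm.conj_diag [DecidableEq ι] (x : SignedPerm ι) (i : ι) :
    x * SignedPerm.diag i * x⁻¹ = SignedPerm.diag (x.right i) := by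
  refine SemidirectProduct.ext (funext fun j => ?_) (by simp [SignedPerm.diag])
  rw [SignedPerm.conj_left _ _ rfl]
  simp only [SignedPerm.diag, Pi.mulSingle_apply]
  refine if_congr ?_ rfl rfl
  rw [Equiv.Perm.inv_eq_iff_eq]

theorem signedBlock_diag_inl [DecidableEq ι] [DecidableEq α] (e : α ⊕ β ≃ ι) (a : α) :
    signedBlock e (SignedPerm.diag a, 1) = SignedPerm.diag (e (Sum.inl a)) := by
  refine SemidirectProduct.ext (funext fun i => ?_) ?_
  · obtain ⟨a' | b, rfl⟩ := e.surjective i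
    · simp [SignedPerm.diag, Pi.mulSingle_apply]
    · simp [SignedPerm.diag]
  · simp only [SignedPerm.diag, signedBlock_right]
    exact map_one _

theorem signedBlock_diag_inr [DecidableEq ι] [DecidableEq β] (e : α ⊕ β ≃ ι) (b : β) :
    signedBlock e (1, SignedPerm.diag b) = SignedPerm.diag (e (Sum.inr b)) := by
  refine SemidirectProduct.ext (funext fun i => ?_) ?_
  · obtain ⟨a | b', rfl⟩ := e.surjective i
    · simp [SignedPerm.diag]
    · simp [SignedPerm.diag, Pi.mulSingle_apply]
  · simp only [SignedPerm.diag, signedBlock_right]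
    exact map_one _

variable [Fintype α] [Fintype β] [Fintype ι]

theorem signChar_diag [DecidableEq ι] (i : ι) : signChar ι (SignedPerm.diag i) = -1 := by
  change ∏ j, Pi.mulSingle i (-1 : ℤˣ) j = -1
  rw [Finset.prod_eq_single i]
  · simp
  · intro j _ h
    simp [h]
  · simp

end SignedBlock

section Eps

variable {K : Type*} [Field K] {α β ι : Type*} [Fintype α] [Fintype β] [Fintype ι]

/-- The linear character `signChar` with values in the field. -/
def epsB (K : Type*) [Field K] (ι : Type*) [Fintype ι] (g : SignedPerm ι) : K :=
  ((signChar ι g : ℤ) : K)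

theorem epsB_mul (g h : SignedPerm ι) : epsB K ι (g * h) = epsB K ι g * epsB K ι h := by
  simp [epsB]

theorem epsB_sq (g : SignedPerm ι) : epsB K ι g * epsB K ι g = 1 := by
  rw [epsB, ← Int.cast_mul, ← Units.val_mul, Int.units_mul_self]
  simp

theorem epsB_isClassFun : IsClassFun (epsB K ι) := fun x y => by
  rw [epsB_mul, epsB_mul, mul_comm]

theorem epsB_signedBlock (e : α ⊕ β ≃ ι) (p : SignedPerm α × SignedPerm β) :
    epsB K ι (signedBlock e p) = epsB K α p.1 * epsB K β p.2 := by
  simp [epsB, signChar_signedBlock]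

theorem epsB_inv (g : SignedPerm ι) : epsB K ι g⁻¹ = epsB K ι g := by
  simp [epsB]

end Eps

/-! ### Characters of type B induced from pairs of characters of symmetric groups. -/

section BInd

variable {K : Type*} [Field K] {α β ι : Type*} [Fintype α] [Fintype β] [Fintype ι]
  [DecidableEq α] [DecidableEq β] [DecidableEq ι]

/-- The class function on the signed permutation group that is induced from class functions on two
symmetric groups, inflated to signed permutation groups and the second one twisted by the sign. -/
def inflInd (e : α ⊕ β ≃ ι) (φ : Equiv.Perm α → K) (ψ : Equiv.Perm β → K) : SignedPerm ι → K :=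
  indChar (signedBlock e) (boxChar (fun x => φ x.right) (fun y => ψ y.right * epsB K β y))

theorem BetaPair.charB_eq {n : ℕ} (P : BetaPair n) :
    P.charB K = inflInd (finSumFinEquiv.trans (finCongr P.rank_eq))
      (BetaSet.symChar K (P.row 0) rfl) (BetaSet.symChar K (P.row 1) rfl) := rfl

/-- By the projection formula the twist can be made before inducing. It cancels the sign on the
second block and creates one on the first. -/
theorem inflInd_swap (e : α ⊕ β ≃ ι) (φ : Equiv.Perm α → K) (ψ : Equiv.Perm β → K) :
    inflInd e φ ψ * epsB K ι = inflInd ((Equiv.sumComm β α).trans e) ψ φ := by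
  unfold inflInd
  rw [← indChar_mul_comp _ _ epsB_isClassFun]
  refine indChar_congr _ _ MulEquiv.prodComm _ _ 1 ?_ ?_
  · rintro ⟨x, y⟩
    simp only [boxChar, Pi.mul_apply, Function.comp_apply, epsB_signedBlock,
      MulEquiv.coe_prodComm, Prod.swap_prod_mk]
    linear_combination (φ x.right * ψ y.right * epsB K α x) * epsB_sq (K := K) y
  · rintro ⟨x, y⟩
    rw [one_mul, inv_one, mul_one]
    refine SignedPerm.ext' (fun i => ?_) (fun i => ?_)
    · obtain ⟨a | b, rfl⟩ := e.surjective i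
      · rw [signedBlock_left_inl]
        exact (signedBlock_left_inr ((Equiv.sumComm β α).trans e) (y, x) a).symm
      · rw [signedBlock_left_inr]
        exact (signedBlock_left_inl ((Equiv.sumComm β α).trans e) (y, x) b).symm
    · obtain ⟨a | b, rfl⟩ := e.surjective i
      · rw [signedBlock_right, symBlock_apply_inl]
        exact (symBlock_apply_inr ((Equiv.sumComm β α).trans e) (y.right, x.right) a).symm
      · rw [signedBlock_right, symBlock_apply_inr]
        exact (symBlock_apply_inl ((Equiv.sumComm β α).trans e) (y.right, x.right) b).symm

/-- The permutation matrices. -/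
def SignedPerm.ofPerm (π : Equiv.Perm ι) : SignedPerm ι := ⟨1, π⟩

omit [Fintype ι] [DecidableEq ι] in
theorem SignedPerm.ofPerm_conj_left (π : Equiv.Perm ι) (g : SignedPerm ι) (i : ι) :
    (SignedPerm.ofPerm π * g * (SignedPerm.ofPerm π)⁻¹).left (π i) = g.left i := by
  simp [SignedPerm.mul_left_apply, SignedPerm.ofPerm]

omit [Fintype ι] [DecidableEq ι] in
theorem SignedPerm.ofPerm_conj_right (π : Equiv.Perm ι) (g : SignedPerm ι) (i : ι) :
    (SignedPerm.ofPerm π * g * (SignedPerm.ofPerm π)⁻¹).right (π i) = π (g.right i) := by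
  simp [SignedPerm.ofPerm]

theorem inflInd_congr (e e' : α ⊕ β ≃ ι) (φ : Equiv.Perm α → K) (ψ : Equiv.Perm β → K) :
    inflInd e φ ψ = inflInd e' φ ψ := by
  refine indChar_congr _ _ (MulEquiv.refl _) _ _ (SignedPerm.ofPerm (e'.symm.trans e))
    (fun h => rfl) fun h => ?_
  have hs : ∀ s, (e'.symm.trans e) (e' s) = e s := fun s => by simp
  refine SignedPerm.ext' (fun i => ?_) (fun i => ?_)
  · obtain ⟨a | b, rfl⟩ := e.surjective i
    · rw [signedBlock_left_inl, ← hs, SignedPerm.ofPerm_conj_left, signedBlock_left_inl]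
      rfl
    · rw [signedBlock_left_inr, ← hs, SignedPerm.ofPerm_conj_left, signedBlock_left_inr]
      rfl
  · obtain ⟨a | b, rfl⟩ := e.surjective i
    · rw [signedBlock_right, symBlock_apply_inl, ← hs (Sum.inl a), SignedPerm.ofPerm_conj_right,
        signedBlock_right, symBlock_apply_inl, hs]
      rfl
    · rw [signedBlock_right, symBlock_apply_inr, ← hs (Sum.inr b), SignedPerm.ofPerm_conj_right,
        signedBlock_right, symBlock_apply_inr, hs]
      rfl

variable [CharZero K]

omit [Fintype ι] in
-- The sign change at a coordinate which lies in the twisted block on one side, and is moved by `x`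
-- from the untwisted block on the other side, acts by `-1` and by `1` respectively.
theorem mackeyTerm_signedBlock_eq_zero {α' β' : Type*} [Fintype α'] [Fintype β'] [DecidableEq α']
    [DecidableEq β'] (e : α ⊕ β ≃ ι) (e' : α' ⊕ β' ≃ ι)
    (φ : Equiv.Perm α → K) (ψ : Equiv.Perm β → K)
    (φ' : Equiv.Perm α' → K) (ψ' : Equiv.Perm β' → K) (x : SignedPerm ι) (a : α') (b : β)
    (h : x.right (e' (Sum.inl a)) = e (Sum.inr b)) :
    mackeyTerm (signedBlock e) (signedBlock e')
      (boxChar (fun x => φ x.right) (fun y => ψ y.right * epsB K β y))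
      (boxChar (fun x => φ' x.right) (fun y => ψ' y.right * epsB K β' y)) x = 0 := by
  refine mackeyTerm_eq_zero _ _ _ _ x (1, SignedPerm.diag b) (SignedPerm.diag a, 1) ?_ (-1) 1
    (fun k => ?_) (fun k => ?_) (by norm_num)
  · rw [signedBlock_diag_inl, signedBlock_diag_inr, SignedPerm.conj_diag, h]
  · have h1 : (SignedPerm.diag b * k.2).right = k.2.right := by simp [SignedPerm.diag]
    simp only [boxChar, Prod.fst_mul, Prod.snd_mul, one_mul, h1, epsB_mul]
    have h2 : epsB K β (SignedPerm.diag b) = -1 := by simp [epsB, signChar_diag]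
    rw [h2]
    ring
  · have h1 : (k.1 * (SignedPerm.diag a)⁻¹).right = k.1.right := by simp [SignedPerm.diag]
    simp only [boxChar, Prod.fst_mul, Prod.snd_mul, Prod.inv_mk, inv_one, mul_one, h1, one_mul]

/-- By the pigeonhole principle every `x` moves some coordinate of the larger untwisted block into
the twisted block of the other decomposition, so all Mackey terms vanish. -/
theorem charInner_inflInd_eq_zero_of_lt {α' β' : Type*} [Fintype α'] [Fintype β'] [DecidableEq α']
    [DecidableEq β'] (e : α ⊕ β ≃ ι) (e' : α' ⊕ β' ≃ ι)
    (φ : Equiv.Perm α → K) (ψ : Equiv.Perm β → K)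
    (φ' : Equiv.Perm α' → K) (ψ' : Equiv.Perm β' → K)
    (hlt : Fintype.card α < Fintype.card α') :
    charInner (inflInd e φ ψ) (inflInd e' φ' ψ') = 0 := by
  rw [inflInd, inflInd, charInner_indChar_indChar, Finset.sum_eq_zero, mul_zero]
  intro x _
  obtain ⟨a, b, hab⟩ : ∃ a b, x.right (e' (Sum.inl a)) = e (Sum.inr b) := by
    by_contra hcon
    push Not at hcon
    have hex : ∀ a', ∃ a, x.right (e' (Sum.inl a')) = e (Sum.inl a) := by
      intro a'
      obtain ⟨a | b, hs⟩ := e.surjective (x.right (e' (Sum.inl a')))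
      · exact ⟨a, hs.symm⟩
      · exact absurd hs.symm (hcon a' b)
    choose f hf using hex
    refine absurd (Fintype.card_le_of_injective f fun a₁ a₂ h12 => ?_) (not_le.2 hlt)
    have h3 := (hf a₁).trans ((congrArg (fun a => e (Sum.inl a)) h12).trans (hf a₂).symm)
    exact Sum.inl_injective (e'.injective (x.right.injective h3))
  exact mackeyTerm_signedBlock_eq_zero e e' φ ψ φ' ψ' x a b hab

theorem charInner_inflInd_eq_zero {α' β' : Type*} [Fintype α'] [Fintype β'] [DecidableEq α']
    [DecidableEq β'] (e : α ⊕ β ≃ ι) (e' : α' ⊕ β' ≃ ι)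
    (φ : Equiv.Perm α → K) (ψ : Equiv.Perm β → K)
    (φ' : Equiv.Perm α' → K) (ψ' : Equiv.Perm β' → K)
    (h : Fintype.card α ≠ Fintype.card α') :
    charInner (inflInd e φ ψ) (inflInd e' φ' ψ') = 0 := by
  rcases lt_or_gt_of_ne h with h | h
  · exact charInner_inflInd_eq_zero_of_lt e e' φ ψ φ' ψ' h
  · exact (charInner_comm _ _).trans (charInner_inflInd_eq_zero_of_lt e' e φ' ψ' φ ψ h)

omit [DecidableEq ι] [Fintype ι] [CharZero K] in
theorem charInner_boxChar {G H : Type*} [Group G] [Fintype G] [Group H] [Fintype H]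
    (φ φ' : G → K) (ψ ψ' : H → K) :
    charInner (boxChar φ ψ) (boxChar φ' ψ') = charInner φ φ' * charInner ψ ψ' := by
  simp only [charInner, boxChar, Nat.card_prod, Nat.cast_mul, mul_inv, Fintype.sum_prod_type,
    Prod.fst_inv, Prod.snd_inv]
  rw [mul_mul_mul_comm, Finset.sum_mul_sum]
  congr 1
  refine Finset.sum_congr rfl fun x _ => Finset.sum_congr rfl fun y _ => ?_
  ring

omit [Fintype α] [Fintype β] [DecidableEq α] [DecidableEq β] [CharZero K] in
/-- Sums over the group of signed permutations of functions of the underlying permutation. -/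
theorem sum_signedPerm_right (F : Equiv.Perm ι → K) :
    ∑ x : SignedPerm ι, F x.right = (2 : K) ^ Fintype.card ι * ∑ σ, F σ := by
  refine (Fintype.sum_equiv (SemidirectProduct.equivProd (φ := mulAutArrow (A := ι))) _
    (fun p : (ι → ℤˣ) × Equiv.Perm ι => F p.2) (fun _ => rfl)).trans ?_
  rw [Fintype.sum_prod_type]
  simp

omit [Fintype α] [Fintype β] [DecidableEq α] [DecidableEq β] in
theorem card_signedPerm : (Nat.card (SignedPerm ι) : K) =
    (2 : K) ^ Fintype.card ι * (Nat.card (Equiv.Perm ι) : K) := by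
  have h := sum_signedPerm_right (K := K) (ι := ι) fun _ => 1
  simpa [← Nat.card_eq_fintype_card] using h

omit [Fintype α] [Fintype β] [DecidableEq α] [DecidableEq β] in
theorem charInner_inflate (φ φ' : Equiv.Perm ι → K) :
    charInner (fun x : SignedPerm ι => φ x.right) (fun x => φ' x.right) = charInner φ φ' := by
  unfold charInner
  have h := sum_signedPerm_right (K := K) (ι := ι) fun x => φ x * φ' x⁻¹
  simp only [SemidirectProduct.inv_right]
  rw [h, card_signedPerm, mul_inv, mul_mul_mul_comm,
    inv_mul_cancel₀ (pow_ne_zero _ two_ne_zero), one_mul]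

omit [Fintype α] [Fintype β] [DecidableEq α] [DecidableEq β] [CharZero K] in
theorem charInner_mul_epsB (φ φ' : SignedPerm ι → K) :
    charInner (fun x => φ x * epsB K ι x) (fun x => φ' x * epsB K ι x) = charInner φ φ' := by
  unfold charInner
  congr 1
  refine Finset.sum_congr rfl fun x _ => ?_
  change φ x * epsB K ι x * (φ' x⁻¹ * epsB K ι x⁻¹) = _
  rw [epsB_inv]
  linear_combination φ x * φ' x⁻¹ * epsB_sq (K := K) x

/-- Scalar products of the class functions induced to the signed permutation group. -/
theorem charInner_inflInd (e : α ⊕ β ≃ ι) (φ φ' : Equiv.Perm α → K) (ψ ψ' : Equiv.Perm β → K)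
    (hφ' : IsClassFun φ') (hψ' : IsClassFun ψ') :
    charInner (inflInd e φ ψ) (inflInd e φ' ψ') = charInner φ φ' * charInner ψ ψ' := by
  rw [inflInd, inflInd, charInner_indChar_eq _ (signedBlock_injective e), charInner_boxChar,
    charInner_inflate, charInner_mul_epsB (fun y => ψ y.right) (fun y => ψ' y.right),
    charInner_inflate]
  · refine IsClassFun.boxChar (fun x y => hφ' _ _) fun x y => ?_
    rw [epsB_isClassFun]
    congr 1
    exact hψ' _ _
  · intro x hx
    obtain ⟨a, b, hab⟩ := exists_inl_of_notMem_range e hx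
    exact mackeyTerm_signedBlock_eq_zero e e φ ψ φ' ψ' x a b hab

/-- Induction commutes with inflation to signed permutation groups. -/
theorem indChar_signedBlock_inflate (f : α ⊕ β ≃ ι) (χ : Equiv.Perm α × Equiv.Perm β → K)
    (g : SignedPerm ι) :
    indChar (signedBlock f) (fun p => χ (p.1.right, p.2.right)) g =
      indChar (symBlock f) χ g.right := by
  classical
  have h1 : ∀ x : SignedPerm ι, (∑ p : SignedPerm α × SignedPerm β,
      if signedBlock f p = x⁻¹ * g * x then χ (p.1.right, p.2.right) else 0) =
      ∑ p : Equiv.Perm α × Equiv.Perm β,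
        if symBlock f p = x.right⁻¹ * g.right * x.right then χ p else 0 := by
    intro x
    set y := x⁻¹ * g * x with hy
    have hyr : x.right⁻¹ * g.right * x.right = y.right := rfl
    rw [hyr]
    -- For given underlying permutations the signs of a block element equal to `y` are forced, so
    -- the sum over signed pairs collapses to one over pairs of permutations.
    let j : Equiv.Perm α × Equiv.Perm β → SignedPerm α × SignedPerm β := fun p =>
      (⟨fun a => y.left (f (Sum.inl a)), p.1⟩, ⟨fun b => y.left (f (Sum.inr b)), p.2⟩)
    have hj : Function.Injective j := fun p p' h =>
      Prod.ext (congrArg (fun q => q.1.right) h) (congrArg (fun q => q.2.right) h)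
    rw [← Finset.sum_subset (Finset.subset_univ (Finset.univ.map ⟨j, hj⟩)), Finset.sum_map]
    · refine Finset.sum_congr rfl fun p _ => if_congr ?_ rfl rfl
      constructor
      · intro h
        rw [← h]
        rfl
      · intro h
        refine SemidirectProduct.ext (funext fun i => ?_) h
        obtain ⟨a | b, rfl⟩ := f.surjective i
        · rw [signedBlock_left_inl]
          rfl
        · rw [signedBlock_left_inr]
          rfl
    · intro p _ hp
      rw [if_neg]
      intro h
      apply hp
      simp only [Finset.mem_map, Finset.mem_univ, true_and, Function.Embedding.coeFn_mk]
      refine ⟨(p.1.right, p.2.right), Prod.ext (SemidirectProduct.ext (funext fun a => ?_) rfl)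
        (SemidirectProduct.ext (funext fun b => ?_) rfl)⟩
      · change y.left _ = _
        rw [← h, signedBlock_left_inl]
      · change y.left _ = _
        rw [← h, signedBlock_left_inr]
  have hcard : Fintype.card ι = Fintype.card α + Fintype.card β := by
    rw [← Fintype.card_congr f, Fintype.card_sum]
  have h5 : indChar (signedBlock f) (fun p => χ (p.1.right, p.2.right)) g =
      (Nat.card (SignedPerm α × SignedPerm β) : K)⁻¹ *
        ∑ x : SignedPerm ι, ∑ p : Equiv.Perm α × Equiv.Perm β,
          if symBlock f p = x.right⁻¹ * g.right * x.right then χ p else 0 := by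
    unfold indChar
    congr 1
    refine Finset.sum_congr rfl fun x _ => ?_
    rw [← h1]
    congr!
  have h6 : indChar (symBlock f) χ g.right = (Nat.card (Equiv.Perm α × Equiv.Perm β) : K)⁻¹ *
      ∑ σ : Equiv.Perm ι, ∑ p : Equiv.Perm α × Equiv.Perm β,
        if symBlock f p = σ⁻¹ * g.right * σ then χ p else 0 := by
    unfold indChar
    congr!
  -- The power of two from summing over the signs of `x` cancels against those in the orders of the
  -- two factors.
  rw [h5, h6, sum_signedPerm_right fun σ => ∑ p : Equiv.Perm α × Equiv.Perm β,
    if symBlock f p = σ⁻¹ * g.right * σ then χ p else 0]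
  rw [Nat.card_prod, Nat.card_prod, Nat.cast_mul, Nat.cast_mul, card_signedPerm, card_signedPerm,
    hcard, pow_add]
  have h2 : (2 : K) ≠ 0 := two_ne_zero
  have h3 : (Nat.card (Equiv.Perm α) : K) ≠ 0 := Nat.cast_ne_zero.2 Nat.card_pos.ne'
  have h4 : (Nat.card (Equiv.Perm β) : K) ≠ 0 := Nat.cast_ne_zero.2 Nat.card_pos.ne'
  field_simp

/-- Induction of exterior products of induced class functions. -/
theorem indChar_boxChar_inflInd {α₁ α₂ β₁ β₂ ι₁ ι₂ : Type*} [Fintype α₁] [Fintype α₂] [Fintype β₁]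
    [Fintype β₂] [Fintype ι₁] [Fintype ι₂] [DecidableEq α₁] [DecidableEq α₂] [DecidableEq β₁]
    [DecidableEq β₂] [DecidableEq ι₁] [DecidableEq ι₂]
    (e₁ : α₁ ⊕ β₁ ≃ ι₁) (e₂ : α₂ ⊕ β₂ ≃ ι₂) (e : ι₁ ⊕ ι₂ ≃ ι)
    (f₁ : α₁ ⊕ α₂ ≃ α) (f₂ : β₁ ⊕ β₂ ≃ β) (e' : α ⊕ β ≃ ι)
    (φ₁ : Equiv.Perm α₁ → K) (ψ₁ : Equiv.Perm β₁ → K)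
    (φ₂ : Equiv.Perm α₂ → K) (ψ₂ : Equiv.Perm β₂ → K) :
    indChar (signedBlock e) (boxChar (inflInd e₁ φ₁ ψ₁) (inflInd e₂ φ₂ ψ₂)) =
      inflInd e' (indChar (symBlock f₁) (boxChar φ₁ φ₂))
        (indChar (symBlock f₂) (boxChar ψ₁ ψ₂)) := by
  have h1 : (fun x : SignedPerm α => indChar (symBlock f₁) (boxChar φ₁ φ₂) x.right) =
      indChar (signedBlock f₁) (boxChar (fun x => φ₁ x.right) (fun x => φ₂ x.right)) :=
    funext fun g => (indChar_signedBlock_inflate f₁ (boxChar φ₁ φ₂) g).symm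
  have h2 : (fun y : SignedPerm β => indChar (symBlock f₂) (boxChar ψ₁ ψ₂) y.right * epsB K β y) =
      indChar (signedBlock f₂) (boxChar (fun y => ψ₁ y.right * epsB K β₁ y)
        (fun y => ψ₂ y.right * epsB K β₂ y)) := by
    have h3 : boxChar (fun y : SignedPerm β₁ => ψ₁ y.right * epsB K β₁ y)
        (fun y : SignedPerm β₂ => ψ₂ y.right * epsB K β₂ y) =
        (fun p => boxChar ψ₁ ψ₂ (p.1.right, p.2.right)) * epsB K β ∘ signedBlock f₂ := by
      ext ⟨y, y'⟩
      simp only [boxChar, Pi.mul_apply, Function.comp_apply, epsB_signedBlock]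
      ring
    rw [h3, indChar_mul_comp _ _ epsB_isClassFun]
    exact funext fun g => congrArg (· * epsB K β g)
      (indChar_signedBlock_inflate f₂ (boxChar ψ₁ ψ₂) g).symm
  unfold inflInd
  rw [h1, h2, ← indChar_boxChar, ← indChar_boxChar, indChar_indChar, indChar_indChar]
  -- Both sides are induced from the same four blocks, placed in `ι` by `s` (grouped by factor) or
  -- by `s'` (grouped by row). The permutation matrix comparing these placements conjugates one
  -- embedding into the other.
  let s : ((α₁ ⊕ β₁) ⊕ (α₂ ⊕ β₂)) ≃ ι := (Equiv.sumCongr e₁ e₂).trans e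
  let s' : ((α₁ ⊕ β₁) ⊕ (α₂ ⊕ β₂)) ≃ ι :=
    (Equiv.sumSumSumComm α₁ β₁ α₂ β₂).trans ((Equiv.sumCongr f₁ f₂).trans e')
  have hs : ∀ t, (s'.symm.trans s) (s' t) = s t := fun t => by simp
  refine indChar_congr _ _ (MulEquiv.prodProdProdComm _ _ _ _) _ _
    (SignedPerm.ofPerm (s'.symm.trans s)) ?_ ?_
  · rintro ⟨⟨x, y⟩, x', y'⟩
    simp only [boxChar, MulEquiv.prodProdProdComm_apply]
    ring
  · rintro ⟨⟨x, y⟩, x', y'⟩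
    refine SignedPerm.ext' (fun i => ?_) (fun i => ?_)
    · obtain ⟨t, rfl⟩ := s.surjective i
      rw [← hs, SignedPerm.ofPerm_conj_left, hs]
      rcases t with (t | t) | (t | t) <;> simp [s, s', MonoidHom.prodMap]
    · obtain ⟨t, rfl⟩ := s.surjective i
      rw [← hs t, SignedPerm.ofPerm_conj_right, hs]
      rcases t with (t | t) | (t | t)
      · simp [s, s', MonoidHom.prodMap]
      · simp [s, s', MonoidHom.prodMap]
      · simp [s, s', MonoidHom.prodMap]
      · simp [s, s', MonoidHom.prodMap]

end BInd

end

noncomputable section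

open Representation

/-! ### Induction and restriction for a subgroup of index two. -/

section IndexTwo

variable {K : Type*} [Field K] {G : Type*} [Group G] [Fintype G] (ε : G →* ℤˣ) [Fintype ε.ker]

theorem sum_eq_sum_ker_add {M : Type*} [AddCommMonoid M] {s : G} (hs : ε s = -1) (F : G → M) :
    ∑ x, F x = ∑ y : ε.ker, F y + ∑ y : ε.ker, F (s * y) := by
  classical
  have h1 : ∑ y : ε.ker, F y = ∑ x ∈ Finset.univ.filter (fun x => ε x = 1), F x := by
    rw [Finset.sum_subtype (p := fun x => x ∈ ε.ker)]
    intro x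
    simp [MonoidHom.mem_ker]
  have h2 : ∑ y : ε.ker, F (s * y) = ∑ x ∈ Finset.univ.filter (fun x => ¬ ε x = 1), F x := by
    refine Finset.sum_bij (fun y _ => s * y) (fun y _ => ?_) (fun y _ z _ h => ?_) (fun x hx => ?_)
      fun y _ => rfl
    · have hy : ε y = 1 := y.2
      simp [hs, hy]
    · exact Subtype.ext (mul_left_cancel h)
    · have hx' : ε x = -1 := by
        rcases Int.units_eq_one_or (ε x) with h | h
        · simp [h] at hx
        · exact h
      exact ⟨⟨s⁻¹ * x, by simp [MonoidHom.mem_ker, hs, hx']⟩, Finset.mem_univ _, by simp⟩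
  rw [h1, h2, Finset.sum_filter_add_sum_filter_not]

theorem card_eq_two_mul_card_ker {s : G} (hs : ε s = -1) :
    (Nat.card G : K) = 2 * (Nat.card ε.ker : K) := by
  have := sum_eq_sum_ker_add ε hs fun _ => (1 : K)
  simp only [Finset.sum_const, Finset.card_univ, nsmul_eq_mul, mul_one,
    ← Nat.card_eq_fintype_card] at this
  rw [this, two_mul]

theorem indChar_ker_apply_of_notMem (χ : ε.ker → K) {g : G} (hg : g ∉ ε.ker) :
    indChar ε.ker.subtype χ g = 0 := by
  unfold indChar
  rw [Finset.sum_eq_zero, mul_zero]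
  intro x _
  refine Finset.sum_eq_zero fun h _ => if_neg fun h1 => hg ?_
  have h2 : g = x * h * x⁻¹ := by
    change (h : G) = _ at h1
    rw [h1]
    group
  rw [h2]
  exact ε.normal_ker.conj_mem _ h.2 x

variable [CharZero K]

theorem indChar_ker_apply {χ : ε.ker → K} (hχ : IsClassFun χ) {s : G} (hs : ε s = -1) (g : ε.ker) :
    indChar ε.ker.subtype χ g = χ g + χ (MulAut.conjNormal s⁻¹ g) := by
  classical
  have hN : (Nat.card ε.ker : K) ≠ 0 := Nat.cast_ne_zero.2 Nat.card_pos.ne'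
  unfold indChar
  have h1 : ∀ x : G, (∑ h : ε.ker, if ε.ker.subtype h = x⁻¹ * g * x then χ h else 0) =
      χ (MulAut.conjNormal x⁻¹ g) := by
    intro x
    rw [Finset.sum_eq_single (MulAut.conjNormal x⁻¹ g)]
    · rw [if_pos]
      simp
    · intro h _ hne
      rw [if_neg]
      intro h1
      apply hne
      refine Subtype.ext ?_
      rw [MulAut.conjNormal_apply, inv_inv]
      exact h1
    · simp
  have h2 : ∀ (y : ε.ker) (z : ε.ker), χ (MulAut.conjNormal (y : G)⁻¹ z) = χ z := by
    intro y z
    have : MulAut.conjNormal (y : G)⁻¹ z = y⁻¹ * z * y := by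
      refine Subtype.ext ?_
      simp
    rw [this, hχ.conj]
  rw [Finset.sum_congr rfl fun x _ => h1 x, sum_eq_sum_ker_add ε hs]
  simp only [h2, mul_inv_rev, map_mul, MulAut.mul_apply]
  rw [Finset.sum_const, Finset.sum_const, Finset.card_univ, ← Nat.card_eq_fintype_card, ← smul_add,
    nsmul_eq_mul, inv_mul_cancel_left₀ hN]

/-- The linear character of order two with values in the field. -/
def unitsChar (K : Type*) [Field K] {G : Type*} [Group G] (ε : G →* ℤˣ) (g : G) : K :=
  ((ε g : ℤ) : K)

omit [Fintype G] [Fintype ε.ker] [CharZero K] in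
theorem unitsChar_ker (g : ε.ker) : unitsChar K ε g = 1 := by
  have hg : ε g = 1 := g.2
  simp [unitsChar, hg]

theorem indChar_ker_comp {φ : G → K} (hφ : IsClassFun φ) {s : G} (hs : ε s = -1) :
    indChar ε.ker.subtype (φ ∘ ε.ker.subtype) = φ + φ * unitsChar K ε := by
  ext g
  by_cases hg : g ∈ ε.ker
  · have h1 := indChar_ker_apply ε (hφ.comp ε.ker.subtype) hs ⟨g, hg⟩
    have h2 := unitsChar_ker (K := K) ε ⟨g, hg⟩
    simp only [Function.comp_apply, Subgroup.subtype_apply, MulAut.conjNormal_apply,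
      hφ.conj'] at h1 h2
    rw [h1, Pi.add_apply, Pi.mul_apply, h2, mul_one]
  · rw [indChar_ker_apply_of_notMem ε _ hg]
    have : ε g = -1 := (Int.units_eq_one_or (ε g)).resolve_left hg
    simp [unitsChar, this]

/-- The function `1 + ε` is twice the indicator of the kernel, and the factor two is compensated by
the index. -/
theorem charInner_comp_ker (φ ψ : G → K) {s : G} (hs : ε s = -1) :
    charInner (φ ∘ ε.ker.subtype) (ψ ∘ ε.ker.subtype) =
      charInner φ ψ + charInner φ (ψ * unitsChar K ε) := by
  have hN : (Nat.card ε.ker : K) ≠ 0 := Nat.cast_ne_zero.2 Nat.card_pos.ne'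
  have h1 : charInner φ ψ + charInner φ (ψ * unitsChar K ε) =
      charForm K G φ (ψ + ψ * unitsChar K ε) := by rw [map_add]; rfl
  have h2 : ∀ x, (ψ + ψ * unitsChar K ε) x⁻¹ = ψ x⁻¹ * (1 + unitsChar K ε x) := by
    intro x
    simp [unitsChar, mul_add]
  rw [h1, charForm_apply]
  unfold charInner
  rw [card_eq_two_mul_card_ker ε hs, sum_eq_sum_ker_add ε hs]
  simp only [h2, unitsChar_ker]
  have h3 : ∀ y : ε.ker, unitsChar K ε (s * y) = -1 := by
    intro y
    have hy : ε y = 1 := y.2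
    simp [unitsChar, hs, hy]
  simp only [h3]
  have h4 : ∑ y : ε.ker, φ (s * y) * (ψ (s * (y : G))⁻¹ * (1 + -1)) = 0 :=
    Finset.sum_eq_zero fun y _ => by ring
  rw [h4, add_zero, mul_inv, mul_comm (2 : K)⁻¹, mul_assoc _ (2 : K)⁻¹,
    Finset.mul_sum Finset.univ _ (2 : K)⁻¹]
  congr 1
  refine Finset.sum_congr rfl fun y _ => ?_
  simp only [Function.comp_apply, Subgroup.subtype_apply, Subgroup.coe_inv]
  ring

end IndexTwo

/-! ### Common constituents and Clifford theory in index two. -/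

section Constituents

variable {K : Type*} [Field K] [CharZero K] [IsAlgClosed K] {G : Type*} [Group G] [Fintype G]

/-- The scalar product is a sum of products of natural multiplicities, and the common constituent
contributes a positive term. -/
theorem IsChar.charInner_ne_zero {χ χ' ψ : G → K} (h : IsChar χ) (h' : IsChar χ')
    (hψ : IsIrrChar ψ) (h1 : charInner χ ψ ≠ 0) (h2 : charInner χ' ψ ≠ 0) : charInner χ χ' ≠ 0 := by
  obtain ⟨m, hirr, hm, hχ⟩ := h.exists_mult
  have h3 : charInner χ χ' = ∑ φ ∈ m.support, (m φ : K) * charInner φ χ' := by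
    conv_lhs => rw [hχ]
    rw [← charForm_apply, map_sum, LinearMap.sum_apply]
    simp [charForm_apply]
  have h4 : ∀ φ, ∃ n : ℕ, φ ∈ m.support → charInner φ χ' = n := by
    intro φ
    by_cases hφ : φ ∈ m.support
    · obtain ⟨n, hn⟩ := (hirr φ hφ).isChar.exists_nat_charInner h'
      exact ⟨n, fun _ => hn⟩
    · exact ⟨0, fun h => absurd h hφ⟩
  choose n hn using h4
  have h5 : charInner χ χ' = ((∑ φ ∈ m.support, m φ * n φ : ℕ) : K) := by
    rw [h3]
    push_cast
    exact Finset.sum_congr rfl fun φ hφ => by rw [hn φ hφ]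
  rw [h5, Nat.cast_ne_zero]
  rw [hm ψ hψ, Nat.cast_ne_zero] at h1
  have hmem : ψ ∈ m.support := Finsupp.mem_support_iff.2 h1
  rw [charInner_comm, hn ψ hmem, Nat.cast_ne_zero] at h2
  have h6 := Finset.single_le_sum (f := fun φ => m φ * n φ) (fun _ _ => Nat.zero_le _) hmem
  have h7 : 0 < m ψ * n ψ := Nat.mul_pos (Nat.pos_of_ne_zero h1) (Nat.pos_of_ne_zero h2)
  exact (h7.trans_le h6).ne'

theorem IsIrrChar.eq_of_charInner_ne_zero {χ ψ : G → K} (h : IsIrrChar χ) (h' : IsIrrChar ψ)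
    (hne : charInner χ ψ ≠ 0) : χ = ψ := by
  by_contra hcon
  exact hne (h.charInner_of_ne h' hcon)

/-- If the restriction of an irreducible character to a subgroup of index two has norm two, then its
constituents are not invariant under conjugation. -/
theorem comp_conj_ne_of_charInner_eq_two (ε : G →* ℤˣ) [Fintype ε.ker] {s : G} (hs : ε s = -1)
    {C : G → K} (hC : IsIrrChar C)
    (h2 : charInner (C ∘ ε.ker.subtype) (C ∘ ε.ker.subtype) = 2) {φ : ε.ker → K}
    (hφ : IsIrrChar φ) (hφC : charInner φ (C ∘ ε.ker.subtype) ≠ 0) :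
    φ ∘ MulAut.conjNormal s⁻¹ ≠ φ := by
  intro hcon
  have hI : IsChar (indChar ε.ker.subtype φ) := hφ.isChar.indChar _
  have hCr : IsChar (C ∘ ε.ker.subtype) := hC.isChar.comp _
  have hIC : charInner (indChar ε.ker.subtype φ) C ≠ 0 := by
    rwa [charInner_indChar _ _ hC.isChar.isClassFun]
  -- If `φ` were invariant, inducing and restricting would just double it. Any constituent `ψ` of
  -- the restriction of `C` then equals `φ`: both induced characters contain `C`, so their scalar
  -- product, which is that of `ψ` with `2 • φ`, is nonzero. The norm of the restriction would thus
  -- be a perfect square, which two is not.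
  have hres : indChar ε.ker.subtype φ ∘ ε.ker.subtype = (2 : K) • φ := by
    ext g
    have h1 := indChar_ker_apply ε hφ.isChar.isClassFun hs g
    have h3 := congrFun hcon g
    simp only [Function.comp_apply] at h3
    rw [h3] at h1
    simp only [Function.comp_apply, Subgroup.subtype_apply, Pi.smul_apply, smul_eq_mul]
    rw [h1, two_mul]
  obtain ⟨m, hirr, hm, hχ⟩ := hCr.exists_mult
  have hsub : ∀ ψ ∈ m.support, ψ = φ := by
    intro ψ hψ
    by_contra hne
    have h4 : charInner (C ∘ ε.ker.subtype) ψ ≠ 0 := by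
      rw [hm ψ (hirr ψ hψ), Nat.cast_ne_zero]
      exact Finsupp.mem_support_iff.1 hψ
    have h5 : charInner (indChar ε.ker.subtype ψ) C ≠ 0 := by
      rw [charInner_indChar _ _ hC.isChar.isClassFun, charInner_comm]
      exact h4
    have h6 := hI.charInner_ne_zero ((hirr ψ hψ).isChar.indChar ε.ker.subtype) hC hIC h5
    rw [charInner_comm, charInner_indChar _ _ hI.isClassFun, hres, ← charForm_apply, map_smul,
      charForm_apply, (hirr ψ hψ).charInner_of_ne hφ hne, smul_zero] at h6
    exact h6 rfl
  rw [IsChar.charInner_self_eq hirr hχ] at h2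
  have h2 : ∑ ψ ∈ m.support, m ψ ^ 2 = 2 := by exact_mod_cast h2
  have h7 : m.support ⊆ {φ} := fun ψ hψ => Finset.mem_singleton.2 (hsub ψ hψ)
  rcases Finset.subset_singleton_iff.1 h7 with h8 | h8
  · simp [h8] at h2
  · rw [h8, Finset.sum_singleton] at h2
    have : m φ ≤ 1 := by nlinarith
    interval_cases m φ <;> omega

omit [CharZero K] [IsAlgClosed K] [Fintype G] in
theorem isChar_unitsChar (ε : G →* ℤˣ) : IsChar (unitsChar K ε) := by
  let f : G →* K := ((Units.coeHom K).comp (Units.map (Int.castRingHom K).toMonoidHom)).comp ε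
  let ρ : Representation K G K :=
    (Algebra.lmul K K).toMonoidHom.comp f
  have h := IsChar.of_rep ρ
  convert! h using 1
  ext g
  have : ρ g = f g • LinearMap.id := by
    ext
    simp [ρ]
  rw [character, this, map_smul, LinearMap.trace_id]
  simp [f, unitsChar]

end Constituents

end

/-! ### Characters of types B and D labelled by symbols. -/

noncomputable section

theorem indChar_of_subsingleton {K G H : Type*} [Field K] [Group G] [Fintype G] [Group H]
    [Fintype H] [Subsingleton G] [Subsingleton H] (f : H →* G) (χ : H → K) (g : G) :
    indChar f χ g = χ 1 := by
  unfold indChar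
  rw [Fintype.sum_subsingleton _ 1, Fintype.sum_subsingleton _ 1, if_pos (Subsingleton.elim _ _),
    Nat.card_unique, Nat.cast_one, inv_one, one_mul]

namespace BetaPair

open BetaSet

variable {K : Type*} [Field K] {n : ℕ}

/-- The pair with the two rows exchanged. -/
def swap (P : BetaPair n) : BetaPair n where
  row := ![P.row 1, P.row 0]
  defect_zero := P.defect_zero.symm
  rank_eq := (add_comm _ _).trans P.rank_eq

/-- The pair with both rows shifted. -/
def shift (k : ℕ) (P : BetaPair n) : BetaPair n where
  row i := BetaSet.shift k (P.row i)
  defect_zero := by rw [card_shift, card_shift, P.defect_zero]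
  rank_eq := by rw [rank_shift, rank_shift, P.rank_eq]

theorem shift_rel (k : ℕ) (P : BetaPair n) : (BetaPair.setoid n).r P (P.shift k) :=
  ⟨1, k, Or.inl fun _ => rfl⟩

theorem Degenerate.swap_row {P : BetaPair n} (h : P.Degenerate) : P.swap.row = P.row := by
  ext1 i
  fin_cases i
  · exact h.symm
  · exact h

theorem ext_row {P Q : BetaPair n} (h : P.row = Q.row) : P = Q := by
  cases P
  cases Q
  cases h
  rfl

theorem Degenerate.swap_eq {P : BetaPair n} (h : P.Degenerate) : P.swap = P :=
  ext_row h.swap_row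

theorem charB_eq_inflInd (P : BetaPair n) {k l : ℕ} (hk : rank (P.row 0) = k)
    (hl : rank (P.row 1) = l) (e : Fin k ⊕ Fin l ≃ Fin n) :
    P.charB K = inflInd e (symChar K (P.row 0) hk) (symChar K (P.row 1) hl) := by
  subst hk hl
  rw [charB_eq]
  exact inflInd_congr _ _ _ _

theorem charB_isClassFun (P : BetaPair n) : IsClassFun (P.charB K) :=
  indChar_isClassFun _ _

theorem charB_swap (P : BetaPair n) : P.swap.charB K = P.charB K * epsB K (Fin n) := by
  rw [P.charB_eq, inflInd_swap]
  exact P.swap.charB_eq_inflInd rfl rfl _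

variable [CharZero K]

theorem charB_isChar (P : BetaPair n) : IsChar (P.charB K) := by
  refine IsChar.indChar (IsChar.boxChar ?_ (IsChar.mul ?_ ?_)) _
  · exact (symChar_isChar (P.row 0) rfl).comp SemidirectProduct.rightHom
  · exact (symChar_isChar (P.row 1) rfl).comp SemidirectProduct.rightHom
  · exact isChar_unitsChar (signChar _)

omit [CharZero K] in
theorem charB_eq_of_shift_eq {P Q : BetaPair n} {k : ℕ}
    (h : ∀ i, BetaSet.shift k (P.row i) = Q.row i) : Q.charB K = P.charB K := by
  have h0 : rank (P.row 0) = rank (Q.row 0) := by rw [← h, rank_shift]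
  have h1 : rank (P.row 1) = rank (Q.row 1) := by rw [← h, rank_shift]
  rw [P.charB_eq_inflInd h0 h1 (finSumFinEquiv.trans (finCongr Q.rank_eq)), Q.charB_eq]
  congr 1
  · rw [← symChar_shift k _ h0 ((rank_shift k _).trans h0)]
    congr! 1
    exact (h 0).symm
  · rw [← symChar_shift k _ h1 ((rank_shift k _).trans h1)]
    congr! 1
    exact (h 1).symm

omit [CharZero K] in
theorem charB_shift (k : ℕ) (P : BetaPair n) : (P.shift k).charB K = P.charB K :=
  charB_eq_of_shift_eq fun _ => rfl

omit [CharZero K] in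
theorem resD_swap (P : BetaPair n) : P.swap.resD K = P.resD K := by
  ext g
  have h : epsB K (Fin n) g = 1 := unitsChar_ker (signChar (Fin n)) g
  simp [resD, charB_swap, h]

omit [CharZero K] in
theorem resD_eq_of_rel {P Q : BetaPair n} (h : (BetaPair.setoid n).r P Q) :
    P.resD K = Q.resD K := by
  have key : ∀ {P Q : BetaPair n} {σ : Equiv.Perm (Fin 2)} {k : ℕ},
      (∀ i, BetaSet.shift k (P.row (σ i)) = Q.row i) → P.resD K = Q.resD K := by
    intro P Q σ k h
    have hσ : ∀ σ : Equiv.Perm (Fin 2), σ = 1 ∨ σ = Equiv.swap 0 1 := by decide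
    rcases hσ σ with rfl | rfl
    · ext g
      exact congrFun (charB_eq_of_shift_eq h).symm _
    · rw [← resD_swap]
      ext g
      refine congrFun (charB_eq_of_shift_eq (k := k) fun i => ?_).symm _
      rw [← h i]
      fin_cases i <;> rfl
  obtain ⟨σ, k, h | h⟩ := h
  · exact key h
  · refine (key (σ := σ⁻¹) (k := k) fun i => ?_).symm
    rw [← h]
    simp

theorem charInner_inflInd_charB (P : BetaPair n) {k l : ℕ} (e : Fin k ⊕ Fin l ≃ Fin n)
    (hk : rank (P.row 0) = k) (hl : rank (P.row 1) = l) (φ : Equiv.Perm (Fin k) → K)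
    (ψ : Equiv.Perm (Fin l) → K) :
    charInner (inflInd e φ ψ) (P.charB K) =
      charInner φ (symChar K (P.row 0) hk) * charInner ψ (symChar K (P.row 1) hl) := by
  rw [P.charB_eq_inflInd hk hl e,
    charInner_inflInd e _ _ _ _ (symChar_isClassFun _ _) (symChar_isClassFun _ _)]

theorem charInner_inflInd_charB_of_ne (P : BetaPair n) {k l : ℕ} (e : Fin k ⊕ Fin l ≃ Fin n)
    (hk : k ≠ rank (P.row 0)) (φ : Equiv.Perm (Fin k) → K) (ψ : Equiv.Perm (Fin l) → K) :
    charInner (inflInd e φ ψ) (P.charB K) = 0 := by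
  rw [P.charB_eq]
  exact charInner_inflInd_eq_zero _ _ _ _ _ _ (by simpa using hk)

variable [IsAlgClosed K]

theorem charInner_charB_self (P : BetaPair n) : charInner (P.charB K) (P.charB K) = 1 := by
  rw [P.charB_eq, charInner_inflInd _ _ _ _ _ (symChar_isClassFun _ _) (symChar_isClassFun _ _),
    (symChar_isIrrChar _ _).charInner_self, (symChar_isIrrChar _ _).charInner_self, one_mul]

theorem charB_isIrrChar (P : BetaPair n) : IsIrrChar (P.charB K) :=
  P.charB_isChar.isIrrChar_of_charInner_self P.charInner_charB_self

/-- If the upper rows have different ranks, the Mackey argument applies; otherwise the scalar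
product factors, and some row gives two distinct Specht characters. -/
theorem charInner_charB_eq_zero {P Q : BetaPair n} (hcard : (P.row 0).card = (Q.row 0).card)
    (hne : P.row ≠ Q.row) : charInner (P.charB K) (Q.charB K) = 0 := by
  by_cases hr : rank (P.row 0) = rank (Q.row 0)
  · have hr' : rank (Q.row 1) = rank (P.row 1) := by
      have h1 := P.rank_eq
      have h2 := Q.rank_eq
      omega
    rw [P.charB_eq, Q.charInner_inflInd_charB _ hr.symm hr']
    by_cases h0 : P.row 0 = Q.row 0
    · have h1 : P.row 1 ≠ Q.row 1 := fun h1 => hne (by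
        ext1 i
        fin_cases i
        · exact h0
        · exact h1)
      rw [charInner_symChar_eq_zero _ _ _ h1, mul_zero]
      rw [← P.defect_zero, ← Q.defect_zero, hcard]
    · rw [charInner_symChar_eq_zero _ _ hcard h0, zero_mul]
  · rw [P.charB_eq, Q.charInner_inflInd_charB_of_ne _ hr]

/-- Shifting each pair by the row length of the other makes all rows equally long without changing
the characters. -/
theorem charInner_charB_eq_zero_of_not_rel {P Q : BetaPair n} (h : ¬ (BetaPair.setoid n).r P Q) :
    charInner (P.charB K) (Q.charB K) = 0 := by
  rw [← charB_shift (Q.row 0).card P, ← charB_shift (P.row 0).card Q]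
  refine charInner_charB_eq_zero ?_ fun hrow => h ?_
  · simp only [shift, card_shift, add_comm]
  · refine (BetaPair.setoid n).trans (P.shift_rel (Q.row 0).card) ?_
    rw [ext_row hrow]
    exact (BetaPair.setoid n).symm (Q.shift_rel _)

theorem swap_rel (P : BetaPair n) : (BetaPair.setoid n).r P P.swap :=
  ⟨Equiv.swap 0 1, 0, Or.inl fun i => by
    rw [BetaSet.shift_zero]
    fin_cases i <;> rfl⟩

theorem charInner_charB_swap {P : BetaPair n} (h : ¬ P.Degenerate) :
    charInner (P.charB K) (P.swap.charB K) = 0 :=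
  charInner_charB_eq_zero P.defect_zero fun hrow => h (congrFun hrow 0)

omit [IsAlgClosed K] in
theorem resD_isChar (P : BetaPair n) : IsChar (P.resD K) :=
  P.charB_isChar.comp (WeylD n).subtype

omit [IsAlgClosed K] in
-- The second term is the contribution of the sign twist, which exchanges rows. For `Q = P` it is
-- zero or one according to whether `P` is non-degenerate or degenerate. Positive rank is needed for
-- an element of sign `-1` to exist.
theorem charInner_resD (hn : 0 < n) (P Q : BetaPair n) :
    charInner (P.resD K) (Q.resD K) =
      charInner (P.charB K) (Q.charB K) + charInner (P.charB K) (Q.swap.charB K) := by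
  rw [charB_swap]
  exact charInner_comp_ker (signChar (Fin n)) _ _ (signChar_diag ⟨0, hn⟩)

theorem charInner_resD_of_not_rel (hn : 0 < n) {P Q : BetaPair n}
    (h : ¬ (BetaPair.setoid n).r P Q) : charInner (P.resD K) (Q.resD K) = 0 := by
  rw [charInner_resD hn, charInner_charB_eq_zero_of_not_rel h,
    charInner_charB_eq_zero_of_not_rel, add_zero]
  exact fun h' => h ((BetaPair.setoid n).trans h' ((BetaPair.setoid n).symm Q.swap_rel))

theorem charInner_resD_self_of_degenerate (hn : 0 < n) {P : BetaPair n} (h : P.Degenerate) :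
    charInner (P.resD K) (P.resD K) = 2 := by
  rw [charInner_resD hn, h.swap_eq, charInner_charB_self, one_add_one_eq_two]

theorem degenerate_of_rank_eq_zero {P : BetaPair 0} : P.Degenerate := by
  have key : ∀ B : Finset ℕ, rank B = 0 → B = Finset.range B.card := by
    intro B hB
    have h0 : cells B = ∅ := by rw [← Finset.card_eq_zero, card_cells, hB]
    have hlow : ∀ x ∈ B, ∀ y < x, y ∈ B := by
      intro x hx y hy
      by_contra hyB
      have : (x, y) ∈ cells B := mem_cells.2 ⟨hx, hyB, hy⟩
      simp [h0] at this
    refine Finset.eq_of_subset_of_card_le (fun x hx => ?_) (by simp)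
    rw [Finset.mem_range]
    have h2 : Finset.range (x + 1) ⊆ B := fun y hy => by
      rcases (Nat.lt_succ_iff.1 (Finset.mem_range.1 hy)).lt_or_eq with h | rfl
      · exact hlow x hx y h
      · exact hx
    have h3 := Finset.card_le_card h2
    rw [Finset.card_range] at h3
    omega
  have h := P.rank_eq
  rw [Degenerate, key _ (show rank (P.row 0) = 0 by omega),
    key _ (show rank (P.row 1) = 0 by omega), P.defect_zero]

theorem resD_isIrrChar {P : BetaPair n} (h : ¬ P.Degenerate) : IsIrrChar (P.resD K) := by
  have hn : 0 < n := by
    rcases Nat.eq_zero_or_pos n with rfl | hn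
    · exact absurd P.degenerate_of_rank_eq_zero h
    · exact hn
  refine P.resD_isChar.isIrrChar_of_charInner_self ?_
  rw [charInner_resD hn, charInner_charB_self, charInner_charB_swap h, add_zero]

/-- This covers rank zero, where the symbol is degenerate but the restriction does not split. -/
theorem resD_isIrrChar_of_surjective (P : BetaPair n)
    (h : Function.Surjective (WeylD n).subtype) : IsIrrChar (P.resD K) :=
  P.charB_isIrrChar.comp_surjective (WeylD n).subtype h

theorem IsLabelOf.eq_resD {P : BetaPair n} {φ : WeylD n → K} (hφ : P.IsLabelOf φ)
    (h : ¬ P.Degenerate) : φ = P.resD K :=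
  IsIrrChar.eq_of_charInner_ne_zero hφ.1 (resD_isIrrChar h) hφ.2

theorem IsLabelOf.add_eq_resD (hn : 0 < n) {P : BetaPair n} (h : P.Degenerate)
    {φ ψ : WeylD n → K} (hφ : P.IsLabelOf φ) (hψ : P.IsLabelOf ψ) (hne : φ ≠ ψ) :
    P.resD K = φ + ψ := by
  refine P.resD_isChar.eq_add_of_charInner_self (charInner_resD_self_of_degenerate hn h) hφ.1 hψ.1
    hne ?_ ?_
  · rw [charInner_comm]
    exact hφ.2
  · rw [charInner_comm]
    exact hψ.2

omit [CharZero K] [IsAlgClosed K] in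
theorem resD_comp_conj (P : BetaPair n) (s : SignedPerm (Fin n)) :
    P.resD K ∘ (MulAut.conjNormal s : MulAut (WeylD n)) = P.resD K := by
  ext g
  exact P.charB_isClassFun.conj' _ _

omit [CharZero K] [IsAlgClosed K] in
theorem IsLabelOf.comp_conj {P : BetaPair n} {φ : WeylD n → K} (hφ : P.IsLabelOf φ)
    (s : SignedPerm (Fin n)) : P.IsLabelOf (φ ∘ (MulAut.conjNormal s : MulAut (WeylD n))) := by
  refine ⟨hφ.1.comp_surjective (MulAut.conjNormal s : MulAut (WeylD n)).toMonoidHom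
    (MulAut.conjNormal s : MulAut (WeylD n)).surjective, ?_⟩
  rw [← P.resD_comp_conj s, charInner_comp_equiv]
  exact hφ.2

/-- The conjugate of `φ` has the same label and differs from `φ` by Clifford theory, so it is the
other constituent. -/
theorem IsLabelOf.resD_eq_add_comp_conj {P : BetaPair n} {φ : WeylD n → K} (hn : 0 < n)
    (hφ : P.IsLabelOf φ) (h : P.Degenerate) {s : SignedPerm (Fin n)} (hs : signChar _ s = -1) :
    P.resD K = φ + φ ∘ (MulAut.conjNormal s⁻¹ : MulAut (WeylD n)) :=
  hφ.add_eq_resD hn h (hφ.comp_conj s⁻¹)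
    (comp_conj_ne_of_charInner_eq_two _ hs P.charB_isIrrChar
      (charInner_resD_self_of_degenerate hn h) hφ.1 hφ.2).symm

/-- The character induced from `W'_n` to `W_n` by a character with a given label. -/
theorem IsLabelOf.indChar_eq {P : BetaPair n} {φ : WeylD n → K} (hφ : P.IsLabelOf φ) :
    indChar (WeylD n).subtype φ =
      P.charB K + (if P.Degenerate then 0 else 1 : K) • P.swap.charB K := by
  rcases Nat.eq_zero_or_pos n with rfl | hn
  · have : Subsingleton (SignedPerm (Fin 0)) :=
      SemidirectProduct.equivProd.injective.subsingleton
    have hsurj : Function.Surjective (WeylD 0).subtype := fun g => ⟨1, Subsingleton.elim _ _⟩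
    have h0 : IsIrrChar (P.resD K) := P.resD_isIrrChar_of_surjective hsurj
    have h1 : φ = P.resD K := IsIrrChar.eq_of_charInner_ne_zero hφ.1 h0 hφ.2
    rw [if_pos P.degenerate_of_rank_eq_zero, zero_smul, add_zero]
    ext g
    rw [indChar_of_subsingleton, h1]
    change P.charB K 1 = _
    rw [this.elim 1 g]
  have hs := signChar_diag (⟨0, hn⟩ : Fin n)
  by_cases h : P.Degenerate
  · rw [if_pos h, zero_smul, add_zero]
    ext g
    by_cases hg : g ∈ WeylD n
    · rw [indChar_ker_apply (signChar (Fin n)) hφ.1.isChar.isClassFun hs ⟨g, hg⟩]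
      exact (congrFun (hφ.resD_eq_add_comp_conj hn h hs) ⟨g, hg⟩).symm
    · rw [indChar_ker_apply_of_notMem (signChar (Fin n)) _ hg]
      -- Off `W'_n` the induced character vanishes, and so does the type B character: its rows
      -- agree, so it is invariant under the sign twist and equals its own negative there.
      have h1 : signChar _ g = -1 := (Int.units_eq_one_or (signChar _ g)).resolve_left hg
      have h2 := congrFun (P.charB_swap (K := K)) g
      rw [h.swap_eq, Pi.mul_apply, epsB, h1] at h2
      push_cast at h2
      linear_combination (-1 / 2) * h2
  · rw [if_neg h, one_smul, hφ.eq_resD h, charB_swap]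
    exact indChar_ker_comp (signChar (Fin n)) P.charB_isClassFun hs

end BetaPair

end

noncomputable section

open BetaSet

/-! ### The span of the labelled characters of type B. -/

section Span

variable {K : Type*} [Field K] {n : ℕ}

/-- The class function `inflInd e φ ψ` as a bilinear function of `φ` and `ψ`. -/
def inflIndBilin (K : Type*) [Field K] {k l n : ℕ} (e : Fin k ⊕ Fin l ≃ Fin n) :
    (Equiv.Perm (Fin k) → K) →ₗ[K] (Equiv.Perm (Fin l) → K) →ₗ[K] (SignedPerm (Fin n) → K) :=
  LinearMap.mk₂ K (inflInd e)
    (fun φ φ' ψ => by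
      unfold inflInd
      rw [← indChar_add]
      congr 1
      ext
      simp only [boxChar, Pi.add_apply]
      ring)
    (fun c φ ψ => by
      unfold inflInd
      rw [← indChar_smul]
      congr 1
      ext
      simp only [boxChar, Pi.smul_apply, smul_eq_mul]
      ring)
    (fun φ ψ ψ' => by
      unfold inflInd
      rw [← indChar_add]
      congr 1
      ext
      simp only [boxChar, Pi.add_apply]
      ring)
    (fun c φ ψ => by
      unfold inflInd
      rw [← indChar_smul]
      congr 1
      ext
      simp only [boxChar, Pi.smul_apply, smul_eq_mul]
      ring)

variable [CharZero K] [IsAlgClosed K]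

theorem inflInd_mem_span_charB {k l : ℕ} (e : Fin k ⊕ Fin l ≃ Fin n) {φ : Equiv.Perm (Fin k) → K}
    {ψ : Equiv.Perm (Fin l) → K} (hφ : IsClassFun φ) (hψ : IsClassFun ψ) :
    inflInd e φ ψ ∈ Submodule.span K (Set.range fun Z : BetaPair n => Z.charB K) := by
  have hn : k + l = n := by simpa using Fintype.card_congr e
  -- β-sets with `n` elements suffice for both ranks `k` and `l`, and the common size gives pairs of
  -- defect zero.
  refine LinearMap.BilinMap.apply_apply_mem_of_mem_span _ _ _ (inflIndBilin K e) ?_ φ ψ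
    (mem_span_symChar (N := n) (by omega) hφ) (mem_span_symChar (N := n) (by omega) hψ)
  rintro _ ⟨B, rfl⟩ _ ⟨C, rfl⟩
  let Z : BetaPair n := ⟨![B.1, C.1], B.2.1.trans C.2.1.symm, by
    change rank B.1 + rank C.1 = n
    rw [B.2.2, C.2.2, hn]⟩
  exact Submodule.subset_span ⟨Z, Z.charB_eq_inflInd B.2.2 C.2.2 e⟩

end Span

/-! ### Multiplicities in characters induced from block subgroups. -/

section Block

variable {K : Type*} [Field K] {a b : ℕ}

/-- The character of `W_(a+b)` induced from the characters of `W_a` and `W_b` labelled by two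
symbols. -/
def blockB (K : Type*) [Field K] {a b : ℕ} (P : BetaPair a) (Q : BetaPair b) :
    SignedPerm (Fin (a + b)) → K :=
  indChar (signedBlock finSumFinEquiv) (boxChar (P.charB K) (Q.charB K))

variable [CharZero K]

theorem blockB_eq (P : BetaPair a) (Q : BetaPair b)
    (e : Fin (rank (P.row 0) + rank (Q.row 0)) ⊕ Fin (rank (P.row 1) + rank (Q.row 1)) ≃
      Fin (a + b)) :
    blockB K P Q = inflInd e
      (indChar (symBlock finSumFinEquiv)
        (boxChar (symChar K (P.row 0) rfl) (symChar K (Q.row 0) rfl)))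
      (indChar (symBlock finSumFinEquiv)
        (boxChar (symChar K (P.row 1) rfl) (symChar K (Q.row 1) rfl))) := by
  rw [blockB, P.charB_eq, Q.charB_eq]
  exact indChar_boxChar_inflInd _ _ _ _ _ _ _ _ _ _

theorem BetaPair.rank_add_eq (P : BetaPair a) (Q : BetaPair b) :
    rank (P.row 0) + rank (Q.row 0) + (rank (P.row 1) + rank (Q.row 1)) = a + b := by
  have h1 := P.rank_eq
  have h2 := Q.rank_eq
  omega

/-- After regrouping by rows, the scalar product factors into two scalar products for symmetric
groups. If the ranks do not match, both sides are zero. -/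
theorem charInner_blockB_charB (P : BetaPair a) (Q : BetaPair b) (X : BetaPair (a + b)) :
    charInner (blockB K P Q) (X.charB K) =
      lrCoeff K (P.row 0) (Q.row 0) (X.row 0) * lrCoeff K (P.row 1) (Q.row 1) (X.row 1) := by
  have hPQ := P.rank_add_eq Q
  have hX := X.rank_eq
  rw [blockB_eq P Q (finSumFinEquiv.trans (finCongr hPQ))]
  by_cases h : rank (X.row 0) = rank (P.row 0) + rank (Q.row 0)
  · have h' : rank (X.row 1) = rank (P.row 1) + rank (Q.row 1) := by omega
    rw [X.charInner_inflInd_charB _ h h', lrCoeff, lrCoeff, dif_pos h, dif_pos h']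
  · rw [X.charInner_inflInd_charB_of_ne _ (Ne.symm h), lrCoeff, dif_neg h, zero_mul]

omit [CharZero K] in
theorem lrCoeff_eq_zero {X Y Z : Finset ℕ} (h : rank Z ≠ rank X + rank Y) :
    lrCoeff K X Y Z = 0 :=
  dif_neg h

omit [CharZero K] in
theorem lrCoeff_mul_eq_zero_of_not_admissible {A : BetaPair a} {B : BetaPair b}
    {X : BetaPair (a + b)} {i j : Equiv.Perm (Fin 2)} (h : ¬ Admissible A B X i j) :
    lrCoeff K (A.row (i 0)) (B.row (j 0)) (X.row 0) *
      lrCoeff K (A.row (i 1)) (B.row (j 1)) (X.row 1) = 0 := by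
  by_cases h0 : rank (X.row 0) = rank (A.row (i 0)) + rank (B.row (j 0))
  · by_cases h1 : rank (X.row 1) = rank (A.row (i 1)) + rank (B.row (j 1))
    · refine absurd (fun k => ?_) h
      fin_cases k
      · exact h0
      · exact h1
    · rw [lrCoeff_eq_zero h1, mul_zero]
  · rw [lrCoeff_eq_zero h0, zero_mul]

omit [CharZero K] in
-- A delta is redundant in front of a coefficient whose nonvanishing already forces the equality of
-- ranks it tests.
theorem kdelta_mul_lrCoeff {X Y Z : Finset ℕ} {r s : ℕ} (h : rank Z = rank X + rank Y → r = s)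
    (y : K) : kdelta K r s * (lrCoeff K X Y Z * y) = lrCoeff K X Y Z * y := by
  by_cases hr : r = s
  · rw [kdelta, if_pos hr, one_mul]
  · rw [lrCoeff_eq_zero fun h' => hr (h h')]
    simp

/-- The multiplicities in the induced character of the restrictions of characters of `W_(a+b)`. -/
def blockMult (K : Type*) [Field K] {a b : ℕ} (A : BetaPair a) (B : BetaPair b)
    (X : BetaPair (a + b)) : K :=
  let c (p q p' q' : Fin 2) : K :=
    lrCoeff K (A.row p) (B.row q) (X.row 0) * lrCoeff K (A.row p') (B.row q') (X.row 1)
  let dA : K := if A.Degenerate then 0 else 1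
  let dB : K := if B.Degenerate then 0 else 1
  c 0 0 1 1 + dA * c 1 0 0 1 + dB * c 0 1 1 0 + dA * dB * c 1 1 0 0

omit [CharZero K] in
-- Admissibility fixes the ranks of the rows of `X`, which makes all deltas redundant. What is left
-- is the same sum with its terms permuted by the indexings; if a symbol is degenerate, its equal
-- rows identify the terms.
theorem aCoeff_eq_blockMult {A : BetaPair a} {B : BetaPair b} {X : BetaPair (a + b)}
    {i j : Equiv.Perm (Fin 2)} (h : Admissible A B X i j) :
    aCoeff K A B X i j = blockMult K A B X := by
  have hσ : ∀ σ : Equiv.Perm (Fin 2), σ = 1 ∨ σ = Equiv.swap 0 1 := by decide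
  have h0 := h 0
  have h1 := h 1
  rcases hσ i with rfl | rfl <;> rcases hσ j with rfl | rfl <;>
    by_cases hA : A.Degenerate <;> by_cases hB : B.Degenerate <;>
    simp only [aCoeff, blockMult, hA, hB, if_true, if_false, Equiv.Perm.one_apply,
      Equiv.swap_apply_left, Equiv.swap_apply_right] at h0 h1 ⊢ <;>
    (try rw [kdelta_mul_lrCoeff (by omega)]) <;>
    (try rw [kdelta_mul_lrCoeff (by omega)]) <;>
    (try rw [kdelta_mul_lrCoeff (by omega)]) <;>
    (try rw [show A.row 0 = A.row 1 from hA]) <;>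
    (try rw [show B.row 0 = B.row 1 from hB]) <;>
    ring

omit [CharZero K] in
theorem blockMult_eq_zero_of_not_admissible {A : BetaPair a} {B : BetaPair b}
    {X : BetaPair (a + b)} (h : ¬ ∃ i j, Admissible A B X i j) : blockMult K A B X = 0 := by
  push Not at h
  have key : ∀ i j : Equiv.Perm (Fin 2), _ := fun i j =>
    lrCoeff_mul_eq_zero_of_not_admissible (K := K) (h i j)
  have h1 := key 1 1
  have h2 := key (Equiv.swap 0 1) 1
  have h3 := key 1 (Equiv.swap 0 1)
  have h4 := key (Equiv.swap 0 1) (Equiv.swap 0 1)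
  simp only [Equiv.Perm.one_apply, Equiv.swap_apply_left, Equiv.swap_apply_right] at h1 h2 h3 h4
  simp [blockMult, h1, h2, h3, h4]

/-- Both sides are induced in stages from `W'_a × W'_b` to `W_(a+b)`, through `W'_(a+b)` or through
`W_a × W_b`. -/
theorem indChar_subtype_weylDBlock (φA : WeylD a → K) (φB : WeylD b → K) :
    indChar (WeylD (a + b)).subtype (indChar (weylDBlock a b) (boxChar φA φB)) =
      indChar (signedBlock finSumFinEquiv)
        (boxChar (indChar (WeylD a).subtype φA) (indChar (WeylD b).subtype φB)) := by
  rw [indChar_indChar, ← indChar_boxChar, indChar_indChar]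
  rfl

variable [IsAlgClosed K]

theorem blockB_mem_span_charB (P : BetaPair a) (Q : BetaPair b) :
    blockB K P Q ∈ Submodule.span K (Set.range fun Z : BetaPair (a + b) => Z.charB K) := by
  rw [blockB_eq P Q (finSumFinEquiv.trans (finCongr (P.rank_add_eq Q)))]
  exact inflInd_mem_span_charB _ (indChar_isClassFun _ _) (indChar_isClassFun _ _)

section

variable {A : BetaPair a} {B : BetaPair b} {φA : WeylD a → K} {φB : WeylD b → K}
  (hA : A.IsLabelOf φA) (hB : B.IsLabelOf φB)

include hA hB

theorem indChar_subtype_weylDBlock_eq :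
    indChar (WeylD (a + b)).subtype (indChar (weylDBlock a b) (boxChar φA φB)) =
      blockB K A B + (if A.Degenerate then 0 else 1 : K) • blockB K A.swap B +
        (if B.Degenerate then 0 else 1 : K) • blockB K A B.swap +
        ((if A.Degenerate then 0 else 1 : K) * (if B.Degenerate then 0 else 1 : K)) •
          blockB K A.swap B.swap := by
  rw [indChar_subtype_weylDBlock, hA.indChar_eq, hB.indChar_eq]
  simp only [blockB, ← indChar_smul, ← indChar_add]
  congr 1
  ext p
  simp only [boxChar, Pi.add_apply, Pi.smul_apply, smul_eq_mul]
  ring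

theorem charInner_indChar_weylDBlock_resD (X : BetaPair (a + b)) :
    charInner (indChar (weylDBlock a b) (boxChar φA φB)) (X.resD K) = blockMult K A B X := by
  refine (charInner_indChar (WeylD (a + b)).subtype _ X.charB_isClassFun).symm.trans ?_
  rw [indChar_subtype_weylDBlock_eq hA hB, ← charForm_apply]
  simp only [map_add, map_smul, LinearMap.add_apply, LinearMap.smul_apply, charForm_apply,
    charInner_blockB_charB, smul_eq_mul]
  rfl

omit [IsAlgClosed K] in
theorem indChar_weylDBlock_isChar : IsChar (indChar (weylDBlock a b) (boxChar φA φB)) :=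
  (hA.1.isChar.boxChar hB.1.isChar).indChar _

/-- Inducing `V` to `W_(a+b)` and restricting back gives `V` plus its conjugate, and lies in the
span of the restrictions of labelled characters. An unlabelled `χ` is orthogonal to that span. -/
theorem exists_isLabelOf_of_constituent (hn : 0 < a + b) {χ : WeylD (a + b) → K}
    (hχ : IsIrrChar χ) (h : charInner (indChar (weylDBlock a b) (boxChar φA φB)) χ ≠ 0) :
    ∃ Z : BetaPair (a + b), Z.IsLabelOf χ := by
  set V := indChar (weylDBlock a b) (boxChar φA φB) with hV
  have hVc : IsChar V := indChar_weylDBlock_isChar hA hB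
  have hs := signChar_diag (⟨0, hn⟩ : Fin (a + b))
  set s := SignedPerm.diag (⟨0, hn⟩ : Fin (a + b))
  let c : MulAut (WeylD (a + b)) := MulAut.conjNormal s⁻¹
  have hVs : IsChar (V ∘ c) := hVc.comp c.toMonoidHom
  by_contra hcon
  have hzero : ∀ Z : BetaPair (a + b), charInner χ (Z.resD K) = 0 := fun Z => by
    by_contra hZ
    exact hcon ⟨Z, hχ, hZ⟩
  let L : (SignedPerm (Fin (a + b)) → K) →ₗ[K] K :=
    (charForm K (WeylD (a + b)) χ).comp (LinearMap.funLeft K K (WeylD (a + b)).subtype)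
  have hL : Submodule.span K (Set.range fun Z : BetaPair (a + b) => Z.charB K) ≤ L.ker := by
    rw [Submodule.span_le]
    rintro _ ⟨Z, rfl⟩
    exact hzero Z
  have h1 : L (indChar (WeylD (a + b)).subtype V) = 0 := by
    refine hL ?_
    rw [hV, indChar_subtype_weylDBlock_eq hA hB]
    refine Submodule.add_mem _ (Submodule.add_mem _ (Submodule.add_mem _ ?_ ?_) ?_) ?_
    · exact blockB_mem_span_charB _ _
    all_goals exact Submodule.smul_mem _ _ (blockB_mem_span_charB _ _)
  have h2 : indChar (WeylD (a + b)).subtype V ∘ (WeylD (a + b)).subtype = V + V ∘ c :=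
    funext fun g => indChar_ker_apply (signChar _) hVc.isClassFun hs g
  have h3 : charForm K (WeylD (a + b)) χ (V + V ∘ c) = 0 := by
    rw [← h2]
    exact h1
  rw [map_add, charForm_apply, charForm_apply, charInner_comm χ V] at h3
  obtain ⟨p, hp⟩ := hVc.exists_nat_charInner hχ.isChar
  obtain ⟨q, hq⟩ := hχ.isChar.exists_nat_charInner hVs
  -- Both multiplicities are natural numbers, so a vanishing sum forces each of them to vanish.
  rw [hp, hq, ← Nat.cast_add, Nat.cast_eq_zero] at h3
  refine h ?_
  rw [hp, Nat.cast_eq_zero]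
  omega

end

omit [CharZero K] [IsAlgClosed K] in
theorem indChar_weylDBlock_comp_conj {φA : WeylD a → K} {φB : WeylD b → K}
    (x : SignedPerm (Fin a)) (y : SignedPerm (Fin b))
    (hA : φA ∘ (MulAut.conjNormal x : MulAut (WeylD a)) = φA)
    (hB : φB ∘ (MulAut.conjNormal y : MulAut (WeylD b)) = φB) :
    indChar (weylDBlock a b) (boxChar φA φB) ∘
        (MulAut.conjNormal (signedBlock finSumFinEquiv (x, y)) : MulAut (WeylD (a + b))) =
      indChar (weylDBlock a b) (boxChar φA φB) := by
  ext g
  refine indChar_comp_equiv _ (MulAut.conjNormal (signedBlock finSumFinEquiv (x, y)))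
    (MulEquiv.prodCongr (MulAut.conjNormal x) (MulAut.conjNormal y)) _ (fun h => ?_)
    (fun h => ?_) g
  · refine Subtype.ext ?_
    rw [MulAut.conjNormal_apply]
    change _ * signedBlock finSumFinEquiv (h.1.1, h.2.1) * _ =
      signedBlock finSumFinEquiv (_, _)
    rw [← map_inv, ← map_mul, ← map_mul]
    rfl
  · exact congrArg₂ (· * ·) (congrFun hA h.1) (congrFun hB h.2)

/-- A non-degenerate label means that the character extends to the type B group, so it is invariant
under a single sign change. Performing this in its own block, with the identity in the other,
preserves the induced character. -/
theorem exists_comp_conj_eq_of_not_degenerate {A : BetaPair a} {B : BetaPair b}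
    {φA : WeylD a → K} {φB : WeylD b → K} (hA : A.IsLabelOf φA) (hB : B.IsLabelOf φB)
    (h : ¬ A.Degenerate ∨ ¬ B.Degenerate) :
    ∃ s : SignedPerm (Fin (a + b)), signChar _ s = -1 ∧
      indChar (weylDBlock a b) (boxChar φA φB) ∘
          (MulAut.conjNormal s⁻¹ : MulAut (WeylD (a + b))) =
        indChar (weylDBlock a b) (boxChar φA φB) := by
  have hone : ∀ {m : ℕ} (φ : WeylD m → K),
      φ ∘ (MulAut.conjNormal (1 : SignedPerm (Fin m)) : MulAut (WeylD m)) = φ := by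
    intro m φ
    rw [map_one]
    rfl
  have hpos : ∀ {m : ℕ} {P : BetaPair m}, ¬ P.Degenerate → 0 < m := by
    intro m P hP
    rcases Nat.eq_zero_or_pos m with rfl | hm
    · exact absurd P.degenerate_of_rank_eq_zero hP
    · exact hm
  rcases h with h | h
  · refine ⟨(signedBlock finSumFinEquiv (SignedPerm.diag ⟨0, hpos h⟩, 1))⁻¹, ?_, ?_⟩
    · rw [map_inv, signChar_signedBlock, signChar_diag, map_one]
      rfl
    · rw [inv_inv, hA.eq_resD h]
      exact indChar_weylDBlock_comp_conj _ _ (A.resD_comp_conj _) (hone _)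
  · refine ⟨(signedBlock finSumFinEquiv (1, SignedPerm.diag ⟨0, hpos h⟩))⁻¹, ?_, ?_⟩
    · rw [map_inv, signChar_signedBlock, signChar_diag, map_one]
      rfl
    · rw [inv_inv, hB.eq_resD h]
      exact indChar_weylDBlock_comp_conj _ _ (hone _) (B.resD_comp_conj _)

end Block

/-! ### Uniqueness of labels. -/

section Labels

variable {K : Type*} [Field K] [CharZero K] [IsAlgClosed K] {n : ℕ}

/-- Restrictions for inequivalent symbols are orthogonal, so they have no common constituent. -/
theorem BetaPair.IsLabelOf.rel (hn : 0 < n) {P Q : BetaPair n} {φ : WeylD n → K}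
    (hP : P.IsLabelOf φ) (hQ : Q.IsLabelOf φ) : (BetaPair.setoid n).r P Q := by
  by_contra h
  refine P.resD_isChar.charInner_ne_zero Q.resD_isChar hP.1 ?_ ?_
    (BetaPair.charInner_resD_of_not_rel (K := K) hn h)
  · rw [charInner_comm]
    exact hP.2
  · rw [charInner_comm]
    exact hQ.2

omit [CharZero K] [IsAlgClosed K] in
theorem BetaPair.IsLabelOf.of_rel {P Q : BetaPair n} {φ : WeylD n → K}
    (hP : P.IsLabelOf φ) (h : (BetaPair.setoid n).r P Q) : Q.IsLabelOf φ :=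
  ⟨hP.1, BetaPair.resD_eq_of_rel (K := K) h ▸ hP.2⟩

theorem BetaPair.isLabelOf_resD {P : BetaPair n} (h : ¬ P.Degenerate) :
    P.IsLabelOf (P.resD K) := by
  refine ⟨BetaPair.resD_isIrrChar h, ?_⟩
  rw [(BetaPair.resD_isIrrChar h).charInner_self]
  exact one_ne_zero

theorem BetaPair.IsLabelOf.eq_or_eq (hn : 0 < n) {P : BetaPair n} (h : P.Degenerate)
    {φ ψ χ : WeylD n → K} (hφ : P.IsLabelOf φ) (hψ : P.IsLabelOf ψ) (hne : φ ≠ ψ)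
    (hχ : P.IsLabelOf χ) : χ = φ ∨ χ = ψ := by
  by_contra hcon
  push Not at hcon
  refine hχ.2 ?_
  rw [hφ.add_eq_resD hn h hψ hne, ← charForm_apply, map_add, charForm_apply, charForm_apply,
    hχ.1.charInner_of_ne hφ.1 hcon.1, hχ.1.charInner_of_ne hψ.1 hcon.2, add_zero]

end Labels

end

/-! ### The decomposition of the induced character. -/

theorem mainTheorem7 {K : Type*} [Field K] [IsAlgClosed K] [CharZero K]
    (a b : ℕ) (hn : 0 < a + b) (A : BetaPair a) (B : BetaPair b)
    -- irreducible characters of `W'_a` and `W'_b` labelled by the symbols `A` and `B`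
    (φA : WeylD a → K) (hA : A.IsLabelOf φA) (φB : WeylD b → K) (hB : B.IsLabelOf φB)
    -- any choice of representatives of the unordered symbols
    (rep : USymbol (a + b) → BetaPair (a + b)) (hrep : ∀ X, Quotient.mk _ (rep X) = X)
    -- any choice of the characters `X_+` and `X_-` labelled by the degenerate symbols
    (pos neg : USymbol (a + b) → WeylD (a + b) → K)
    (hdeg : ∀ X, (rep X).Degenerate →
      (rep X).IsLabelOf (pos X) ∧ (rep X).IsLabelOf (neg X) ∧ pos X ≠ neg X)
    -- any choice of indexing sets
    (i j : USymbol (a + b) → Equiv.Perm (Fin 2))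
    (hij : ∀ X ∈ sumIndex A B rep, Admissible A B (rep X) (i X) (j X)) :
    ∃ aplus aminus : USymbol (a + b) → ℕ,
      (∀ g : WeylD (a + b),
        indChar (weylDBlock a b) (boxChar φA φB) g =
          (∑ X ∈ sumIndex A B rep with ¬ (rep X).Degenerate,
            aCoeff K A B (rep X) (i X) (j X) * (rep X).resD K g) +
          ∑ X ∈ sumIndex A B rep with (rep X).Degenerate,
            ((aplus X : K) * pos X g + (aminus X : K) * neg X g)) ∧
      ∀ X ∈ sumIndex A B rep, (rep X).Degenerate →
        (aplus X : K) + (aminus X : K) = aCoeff K A B (rep X) (i X) (j X) ∧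
        (¬ A.Degenerate ∨ ¬ B.Degenerate →
          (aplus X : K) = aCoeff K A B (rep X) (i X) (j X) / 2 ∧
          (aminus X : K) = aCoeff K A B (rep X) (i X) (j X) / 2) := by
  classical
  set V := indChar (weylDBlock a b) (boxChar φA φB) with hV
  have hVc : IsChar V := indChar_weylDBlock_isChar hA hB
  obtain ⟨m, hirr, hm, hVm⟩ := hVc.exists_mult
  -- `T X` is the set of all irreducible characters with label `X`. These sets are disjoint, and
  -- those of the admissible symbols cover the constituents of `V`.
  let T : USymbol (a + b) → Finset (WeylD (a + b) → K) := fun X =>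
    if (rep X).Degenerate then {pos X, neg X} else {(rep X).resD K}
  have hT : ∀ X ψ, ψ ∈ T X ↔ (rep X).IsLabelOf ψ := by
    intro X ψ
    by_cases hX : (rep X).Degenerate
    · obtain ⟨h1, h2, h3⟩ := hdeg X hX
      simp only [T, if_pos hX, Finset.mem_insert, Finset.mem_singleton]
      constructor
      · rintro (rfl | rfl)
        · exact h1
        · exact h2
      · exact h1.eq_or_eq hn hX h2 h3
    · simp only [T, if_neg hX, Finset.mem_singleton]
      constructor
      · rintro rfl
        exact BetaPair.isLabelOf_resD hX
      · exact fun h => h.eq_resD hX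
  have hmult : ∀ X, charInner V ((rep X).resD K) = blockMult K A B (rep X) := fun X =>
    charInner_indChar_weylDBlock_resD hA hB (rep X)
  have hcoeff : ∀ X ∈ sumIndex A B rep,
      aCoeff K A B (rep X) (i X) (j X) = charInner V ((rep X).resD K) := fun X hX =>
    (aCoeff_eq_blockMult (hij X hX)).trans (hmult X).symm
  have hsupp : m.support ⊆ (sumIndex A B rep).biUnion T := by
    intro ψ hψ
    have h1 : charInner V ψ ≠ 0 := by
      rw [hm ψ (hirr ψ hψ), Nat.cast_ne_zero]
      exact Finsupp.mem_support_iff.1 hψ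
    obtain ⟨Z, hZ⟩ := exists_isLabelOf_of_constituent hA hB hn (hirr ψ hψ) h1
    have hrel : (BetaPair.setoid (a + b)).r Z (rep (Quotient.mk _ Z)) :=
      (BetaPair.setoid (a + b)).symm (Quotient.exact (hrep (Quotient.mk _ Z)))
    have hlab := hZ.of_rel hrel
    refine Finset.mem_biUnion.2 ⟨Quotient.mk _ Z, ?_, (hT _ _).2 hlab⟩
    simp only [sumIndex, Finset.mem_filter, Finset.mem_univ, true_and]
    -- For a symbol that is not admissible all Littlewood–Richardson products vanish, so its
    -- restriction is orthogonal to `V` and cannot share a constituent with it.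
    by_contra hcon
    refine hVc.charInner_ne_zero ((rep (Quotient.mk _ Z)).resD_isChar) hlab.1 h1 ?_ ?_
    · rw [charInner_comm]
      exact hlab.2
    · rw [hmult, blockMult_eq_zero_of_not_admissible hcon]
  have hdisj : (sumIndex A B rep : Set (USymbol (a + b))).PairwiseDisjoint T := by
    intro X _ Y _ hXY
    refine Finset.disjoint_left.2 fun ψ h1 h2 => hXY ?_
    have h3 := ((hT X ψ).1 h1).rel hn ((hT Y ψ).1 h2)
    rw [← hrep X, ← hrep Y]
    exact Quotient.sound h3
  have hsum : V = ∑ X ∈ sumIndex A B rep, ∑ ψ ∈ T X, (m ψ : K) • ψ := by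
    rw [← Finset.sum_biUnion hdisj]
    conv_lhs => rw [hVm]
    refine Finset.sum_subset hsupp fun ψ _ hψ => ?_
    rw [Finsupp.notMem_support_iff.1 hψ, Nat.cast_zero, zero_smul]
  have hadd : ∀ X, (rep X).Degenerate →
      charInner V ((rep X).resD K) = (m (pos X) : K) + (m (neg X) : K) := by
    intro X hX
    obtain ⟨h1, h2, h3⟩ := hdeg X hX
    rw [h1.add_eq_resD hn hX h2 h3, ← charForm_apply, map_add, charForm_apply, charForm_apply,
      hm _ h1.1, hm _ h2.1]
  refine ⟨fun X => m (pos X), fun X => m (neg X), fun g => ?_, fun X hX hXd => ⟨?_, fun hnd => ?_⟩⟩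
  · rw [hsum, ← Finset.sum_filter_add_sum_filter_not (sumIndex A B rep)
      (fun X => ¬ (rep X).Degenerate), Pi.add_apply, Finset.sum_apply, Finset.sum_apply]
    simp only [not_not]
    congr 1
    · refine Finset.sum_congr rfl fun X hX => ?_
      obtain ⟨hX, hXd⟩ := Finset.mem_filter.1 hX
      rw [hcoeff X hX, hm _ (BetaPair.resD_isIrrChar hXd)]
      simp [T, hXd]
    · refine Finset.sum_congr rfl fun X hX => ?_
      obtain ⟨hX, hXd⟩ := Finset.mem_filter.1 hX
      simp only [T, if_pos hXd]
      rw [Finset.sum_pair (hdeg X hXd).2.2]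
      rfl
  · rw [hcoeff X hX, hadd X hXd]
  · obtain ⟨h1, h2, h3⟩ := hdeg X hXd
    obtain ⟨s, hs, hVs⟩ := exists_comp_conj_eq_of_not_degenerate hA hB hnd
    -- The restriction is the sum of `pos X` and `neg X`, but also of `pos X` and its conjugate. As
    -- `V` is invariant under this conjugation, both constituents have the same multiplicity.
    have hneg : neg X = pos X ∘ (MulAut.conjNormal s⁻¹ : MulAut (WeylD (a + b))) :=
      add_left_cancel ((h1.add_eq_resD hn hXd h2 h3).symm.trans
        (h1.resD_eq_add_comp_conj hn hXd hs))
    have heq : (m (neg X) : K) = m (pos X) := by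
      rw [← hm _ h2.1, ← hm _ h1.1, hneg, ← charInner_comp_equiv
        (MulAut.conjNormal s⁻¹ : MulAut (WeylD (a + b))) V (pos X)]
      congr 1
      exact hVs.symm
    have hc := hcoeff X hX
    rw [hadd X hXd, heq, ← two_mul] at hc
    change (m (pos X) : K) = _ ∧ (m (neg X) : K) = _
    rw [heq, hc, mul_div_cancel_left₀ _ two_ne_zero]
    exact ⟨rfl, rfl⟩
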